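/- **Setting.** $G=(V,E)$ is a directed graph with $n=|V|\ge 2$ nodes and $m=|E|$ edges, with the triggering model: every node $v$ independently draws a triggering set $T_v$ from a distribution $D_v$ on the sets of in-neighbours of $v$; a node becomes active one step after some node of its triggering set is active; $\sigma(S)$ is the expected number of nodes that are ever active when the seed set is $S$. An RR set $R$ is the random set of the nodes that reach a uniformly random root in the graph with the edges $(w,u)$, $w\in T_u$; put $\nu^{(j)}=\mathbb E|R|^j$. Strategy mixes are points of a convex set $\mathcal D\subseteq\mathbb R_+^d$. The strategy activation functions $h_v$ are defined, $[0,1]$-valued, monotone and DR-submodular on a region $\prod_i[0,u_i]$, $u_i\in[0,\infty]$, that contains $\mathcal D$ (for instance $\mathbb R^d_+$ or $[0,1]^d$), and are $L_h$-Lipschitz and $\beta_h$-smooth on $\mathcal D$, $L_h>0$, $\beta_h\ge0$. The cost $c\ge0$ is convex and $L_c$-Lipschitz on $\mathcal D$; $k$ is the budget, $\lambda\ge 0$ the balance parameter, $s(x)=\lambda(k-c(x))$, $\mathcal P=\{x\in\mathcal D: c(x)\le k\}$ has diameter at most $\Delta$, $\Delta>0$, and $g(x)=\sum_{S\subseteq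 V}\sigma(S)\prod_{u\in S}h_u(x)\prod_{v\notin S}(1-h_v(x))$. The maximum $\mathrm{OPT}_{g+s}$ of $g+s$ on $\mathcal P$ is attained. $\mathcal N(\mathcal P,r)$ is the least number of closed Euclidean balls of radius $r$ that cover $\mathcal P$. For RR sets $\mathcal R=(R_1,\dots,R_\theta)$ let $\hat g_{\mathcal R}(x)=\frac n\theta\sum_{R\in\mathcal R}\bigl(1-\prod_{v\in R}(1-h_v(x))\bigr)$, let $\nu^{(j)}(\mathcal R)$ be the average of $|R|^j$ over $\mathcal R$, and $\hat\beta(\mathcal R)=\nu^{(1)}(\mathcal R)n\beta_h+\nu^{(2)}(\mathcal R)nL_h^2$. **Algorithm** (ProxGrad-RIS, revised by resampling the RR sets in each round), for $0<\varepsilon<\frac12$ and $\ell$. $\mathcal A(\mathcal R,a)$ starts at a given point of $\mathcal P$, performs $\lceil 3\hat\beta(\mathcal R)\Delta^2/(4a)\rceil$ proximal gradient steps $x\mapsto\arg\min_{y\in\mathcal P}\bigl(-\eta s(y)+\frac12\|x+\eta\nabla\hat g_{\mathcal R}(x)-y\|^2\bigr)$ with $\eta=1/\hat\beta(\mathcal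 R)$, and returns the iterate with the largest value of $\hat g_{\mathcal R}+s$. Put $\varepsilon'=\sqrt2\varepsilon/3$, $L=n^2L_h+\lambda L_c$, $x_i=(n+\lambda k)/2^i$ and $$\theta_i=\Bigl\lceil \tfrac{n(2+\frac23\varepsilon')\left(\ln\mathcal N(\mathcal P,\frac{\varepsilon/3}{L}x_i)+\ell\ln n+\ln2+\ln\log_2(n+\lambda k)\right)}{\varepsilon'^2x_i}\Bigr\rceil .$$ For $i=1,\dots,\lfloor\log_2(n+\lambda k)-1\rfloor$ draw $\theta_i$ new RR sets $\mathcal R_i$, let $y_i=\mathcal A(\mathcal R_i,\varepsilon x_i/3)$, and if $(\hat g_{\mathcal R_i}+s)(y_i)\ge(1+\varepsilon'+\varepsilon/3)x_i$ put $LB=(\hat g_{\mathcal R_i}+s)(y_i)/(1+\varepsilon'+\varepsilon/3)$ and leave the loop; if this never happens, $LB=1$. Finally draw $\lceil\max\{\theta^{(1)},\theta^{(2)}\}\rceil$ new RR sets $\mathcal R$ and return $\mathcal A(\mathcal R,\varepsilon LB)$, where, with $\alpha=\frac12$ and $\alpha'=\alpha-\varepsilon/3$, $$\theta^{(1)}=\tfrac{8n\ln(4n^\ell)}{LB\,\alpha'^2\varepsilon^2/9},\qquad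 \theta^{(2)}=\tfrac{2\alpha' n\ln\left(4n^\ell\mathcal N(\mathcal P,\frac{\varepsilon/3}{2L}LB)\right)}{(\varepsilon/3-\frac14\alpha'^2\varepsilon/3)^2LB}.$$ **Running time.** A triggering set of $v$ is sampled in time at most $\kappa\,|N^-(v)|$, where $|N^-(v)|$ is the in-degree of $v$, and RR sets are generated by reverse search; $h_v(x)$ and $\nabla h_v(x)$ are computed in time at most $T_h$, $c(x)$ in time at most $T_c$, a proximal step in time at most $T_{prox}$ (each oracle spends at least one step per coordinate that it writes: every nonzero coordinate of $\nabla h_v(x)$, all $d$ coordinates of a proximal step). An arithmetic operation on real numbers takes one step, and an operation on vectors one step per coordinate that it touches. **Theorem.** Assume in addition that $\max_{x\in\mathcal P}g(x)\ge\max_{v\in V}\sigma(\{v\})$, $\lambda k\le n$ and $n+\lambda k\le n^\ell$. Then the expected running time is at most $$C\Bigl(\tfrac{n^2(\nu^{(2)}\beta_h+\nu^{(3)}L_h^2)\ln\left(n^\ell\mathcal N(\mathcal P,r)\right)}{\varepsilon^3\,\mathrm{OPT}_{g+s}}(1+T_h)+\tfrac{\nu^{(1)}n\beta_h+\nu^{(2)}nL_h^2}{\varepsilon}\log_2(n+\lambda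 k)(T_c+T_{prox})+\tfrac{(m+n)\ln\left(n^\ell\mathcal N(\mathcal P,r)\right)}{\varepsilon^2}\Bigr)$$ (a) with $r=\frac{\varepsilon}{3(2n^2L_h+2\lambda L_c)}$ and a constant $C$ that depends only on $\kappa$, an upper bound of $\Delta$ and a positive lower bound of $\beta_h+L_h^2$; and (b) with $r=\frac{\varepsilon}{2n^2L_h+2\lambda L_c}$ and a constant $C$ that depends only on these and on the dimension $d$. -/

import Mathlib

open scoped ENNReal NNReal

noncomputable section

namespace CIMBS

/-! ### Programs with a step count -/

/-- The result of a deterministic computation together with the number of steps it takes. -/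
structure Timed (α : Type) where
  val : α
  time : ℕ

instance : Monad Timed where
  pure a := ⟨a, 0⟩
  bind x f := ⟨(f x.val).val, x.time + (f x.val).time⟩

/-- Spend `n` steps. -/
def tick (n : ℕ) : Timed Unit := ⟨(), n⟩

/-- A randomized program: the joint law of its result and of the number of steps it takes. -/
def Prog (α : Type) : Type := PMF (α × ℕ)

instance : Monad Prog where
  pure a := PMF.pure (a, 0)
  bind p f := PMF.bind p fun x => PMF.map (fun y => (y.1, x.2 + y.2)) (f x.1)

/-- A deterministic computation as a randomized program. -/
def Prog.ofTimed {α : Type} (t : Timed α) : Prog α := PMF.pure (t.val, t.time)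

/-- The expected running time (possibly infinite) of a randomized program. -/
def Prog.expTime {α : Type} (p : Prog α) : ℝ≥0∞ :=
  ∑' x : α × ℕ, (show PMF (α × ℕ) from p) x * (x.2 : ℝ≥0∞)

/-! ### The triggering model -/

/-- A triggering model: a directed graph and, for every node `v`, a distribution `D v` on the sets
of in-neighbours of `v`. -/
structure TriggeringModel (V : Type) where
  G : Digraph V
  D : V → PMF (Finset V)
  D_subset : ∀ v, ∀ S ∈ (D v).support, ∀ u ∈ S, G.Adj u v

namespace TriggeringModel

variable {V : Type} [Fintype V] [DecidableEq V] (M : TriggeringModel V)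

open Classical in
/-- The number of in-neighbours of `v`. -/
def inDegree (v : V) : ℕ := (Finset.univ.filter fun u => M.G.Adj u v).card

/-- The number of edges. -/
def numEdges : ℕ := ∑ v, M.inDegree v

/-- The law of the profile of all triggering sets, which are drawn independently. -/
def profile : PMF (V → Finset V) :=
  PMF.ofFintype (fun T => ∏ v, M.D v (T v)) (by
    rw [← Fintype.piFinset_univ, ← Finset.prod_univ_sum]
    refine Finset.prod_eq_one fun v _ => ?_
    rw [← tsum_fintype (L := .unconditional _)]
    exact (M.D v).tsum_coe)

/-- The active nodes at time `t`, when the seed set is `S` and the triggering sets are `T`. -/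
def active (T : V → Finset V) (S : Finset V) : ℕ → Finset V
  | 0 => S
  | t + 1 => active T S t ∪ Finset.univ.filter fun v => ∃ u ∈ T v, u ∈ active T S t

open Classical in
/-- The nodes that are activated at some time. -/
def finalActive (T : V → Finset V) (S : Finset V) : Finset V :=
  Finset.univ.filter fun v => ∃ t, v ∈ active T S t

/-- The influence spread `σ(S)`. -/
def spread (S : Finset V) : ℝ :=
  ∑ T : V → Finset V, (M.profile T).toReal * ((finalActive T S).card : ℝ)

open Classical in
/-- The nodes that reach `v` in the live-edge graph with the edges `(w, u)`, `w ∈ T u`. -/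
def rrSet (T : V → Finset V) (v : V) : Finset V :=
  Finset.univ.filter fun u => Relation.ReflTransGen (fun a b => a ∈ T b) u v

/-- The `j`-th moment `𝔼 |R| ^ j` of the size of an RR set whose root is uniformly random. -/
def rrMoment (j : ℕ) : ℝ :=
  ∑ v : V, (1 / (Fintype.card V : ℝ)) *
    ∑ T : V → Finset V, (M.profile T).toReal * ((rrSet T v).card : ℝ) ^ j

end TriggeringModel

/-! ### Continuous influence maximization with budget saving -/

/-- Strategy mixes, with the Euclidean norm. -/
abbrev Mix (d : ℕ) : Type := EuclideanSpace ℝ (Fin d)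

/-- The region `∏ i, [0, u i]`; it is the nonnegative orthant if every `u i` is `∞`. -/
def box {d : ℕ} (u : Fin d → ℝ≥0∞) : Set (Mix d) :=
  {x | ∀ i, 0 ≤ x i ∧ ENNReal.ofReal (x i) ≤ u i}

/-- Monotonicity on `X` for the coordinatewise order. -/
def MonotoneOnMix {d : ℕ} (f : Mix d → ℝ) (X : Set (Mix d)) : Prop :=
  ∀ x ∈ X, ∀ y ∈ X, (∀ i, x i ≤ y i) → f x ≤ f y

/-- DR-submodularity on `X`. -/
def DRSubmodularOn {d : ℕ} (f : Mix d → ℝ) (X : Set (Mix d)) : Prop :=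
  ∀ x ∈ X, ∀ y ∈ X, (∀ i, x i ≤ y i) → ∀ (i : Fin d) (δ : ℝ), 0 < δ →
    x + EuclideanSpace.single i δ ∈ X → y + EuclideanSpace.single i δ ∈ X →
    f (y + EuclideanSpace.single i δ) - f y ≤ f (x + EuclideanSpace.single i δ) - f x

/-- `f` is `L`-Lipschitz on `X` for the Euclidean norm. -/
def LipschitzOnMix {d : ℕ} (L : ℝ) (f : Mix d → ℝ) (X : Set (Mix d)) : Prop :=
  ∀ x ∈ X, ∀ y ∈ X, |f x - f y| ≤ L * ‖x - y‖

/-- The data of a CIM-BS problem and of a run of the algorithm on it. -/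
structure Problem (V : Type) (d : ℕ) extends TriggeringModel V where
  /-- upper ends of the region on which the strategy activation functions live -/
  u : Fin d → ℝ≥0∞
  /-- the domain `𝒟` of strategy mixes -/
  dom : Set (Mix d)
  /-- the strategy activation functions and their gradients -/
  h : V → Mix d → ℝ
  gradh : V → Mix d → Mix d
  /-- cost function, budget, balance parameter -/
  c : Mix d → ℝ
  k : ℝ
  lam : ℝ
  /-- Lipschitz and smoothness constants of `h`, Lipschitz constant of `c` -/
  Lh : ℝ
  βh : ℝ
  Lc : ℝ
  /-- approximation and confidence parameter -/
  ε : ℝ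
  ℓ : ℝ
  /-- an upper bound of the diameter of the feasible set -/
  Δ : ℝ
  /-- the starting point of the proximal gradient iteration -/
  x₀ : Mix d
  /-- `prox η z` is the proximal step with step size `η` at `z` -/
  prox : ℝ → Mix d → Mix d
  /-- time to sample a triggering set of `v` -/
  timeTrig : V → ℕ
  /-- time to compute `h v x` and `gradh v x` -/
  timeH : V → Mix d → ℕ
  /-- time to compute `c x` (and a gradient of `c`) at `x` -/
  timeC : Mix d → ℕ
  /-- time of the proximal step -/
  timeProx : ℝ → Mix d → ℕ

namespace Problem

variable {V : Type} [Fintype V] [DecidableEq V] {d : ℕ} (I : Problem V d)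

/-- The number of nodes, as a real number. -/
def n (_ : Problem V d) : ℝ := (Fintype.card V : ℝ)

/-- The feasible set `𝒫`. -/
def feasible : Set (Mix d) := {x | x ∈ I.dom ∧ I.c x ≤ I.k}

/-- The influence spread `g` of a strategy mix. -/
def g (x : Mix d) : ℝ :=
  ∑ S : Finset V, I.spread S * ((∏ u ∈ S, I.h u x) * ∏ v ∈ Sᶜ, (1 - I.h v x))

/-- The budget saving `s`. -/
def s (x : Mix d) : ℝ := I.lam * (I.k - I.c x)

/-- The optimal value of `g + s` on the feasible set. -/
def OPT : ℝ := sSup ((fun x => I.g x + I.s x) '' I.feasible)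

/-- The covering number of the feasible set: the least number of closed balls of radius `r`,
with arbitrary centres, that cover it. -/
def covering (r : ℝ) : ℝ :=
  ((Metric.externalCoveringNumber r.toNNReal I.feasible).toNat : ℝ)

/-! #### Generating RR sets

The profile of all triggering sets serves as the random tape. The reverse search reads the
triggering set of a node when it visits the node, and pays for sampling it then; the triggering
sets that it never reads are never paid for. -/

/-- Mark and push the nodes of a list that are not yet marked. `stack` holds the nodes that are
reached but not yet expanded, `seen` all the nodes reached so far. -/
def expand : List V → List V → List V → Timed (List V × List V)
  | [], stack, seen => pure (stack, seen)
  | w :: ws, stack, seen => do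
    tick 1
    if w ∈ seen then expand ws stack seen
    else do
      tick 3
      expand ws (w :: stack) (w :: seen)

/-- Reverse search. The first argument bounds the number of expanded nodes. -/
def search (T : V → Finset V) : ℕ → List V → List V → Timed (List V)
  | 0, _, seen => pure seen
  | _ + 1, [], seen => pure seen
  | fuel + 1, v :: stack, seen => do
    tick (I.timeTrig v + 1)
    let r ← expand (T v).toList stack seen
    search T fuel r.1 r.2

/-- Generate one RR set, listed without repetition. -/
def genRR [Nonempty V] : Prog (List V) :=
  (PMF.uniformOfFintype V).bind fun v => I.profile.map fun T =>
    ((I.search T (Fintype.card V) [v] [v]).val,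
      (I.search T (Fintype.card V) [v] [v]).time + 4)

/-- Generate `θ` independent RR sets. -/
def genRRs [Nonempty V] : ℕ → Prog (List (List V))
  | 0 => pure []
  | θ + 1 => do
    let R ← I.genRR
    let Rs ← genRRs θ
    Prog.ofTimed (tick 1)
    pure (R :: Rs)

/-! #### The gradient algorithm

Let `ĝ_Rs (x) = n / θ * ∑ R ∈ Rs, (1 - ∏ v ∈ R, (1 - h_v (x)))`, where `θ` is the length of `Rs`.
One step pays for an arithmetic operation on real numbers; an operation on vectors pays for every
coordinate it touches. -/

/-- The number of nonzero coordinates of the gradient of `h v` at `x`. -/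
def gradSize (v : V) (x : Mix d) : ℕ := (Finset.univ.filter fun i => I.gradh v x i ≠ 0).card

/-- The contribution of one RR set: the value is `∏ v ∈ R, (1 - h_v (x))`, and `acc` is increased
by `pre * ∑ v' ∈ R, (∏ v ∈ R \ {v'}, (1 - h_v (x))) • ∇ h_v' (x)`. -/
def rrTerm (x : Mix d) : List V → ℝ → Mix d → Timed (ℝ × Mix d)
  | [], _, acc => pure (1, acc)
  | v :: vs, pre, acc => do
    tick (I.timeH v x + 2 * I.gradSize v x + 5)
    let q := 1 - I.h v x
    let r ← rrTerm x vs (pre * q) acc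
    pure (q * r.1, r.2 + (pre * r.1) • I.gradh v x)

/-- The sum of `1 - ∏ v ∈ R, (1 - h_v (x))` over the RR sets, and `acc` plus its gradient. -/
def sumTerms (x : Mix d) : List (List V) → Mix d → Timed (ℝ × Mix d)
  | [], acc => pure (0, acc)
  | R :: Rs, acc => do
    let r ← I.rrTerm x R 1 acc
    let t ← sumTerms x Rs r.2
    tick 3
    pure (t.1 + (1 - r.1), t.2)

/-- The value of `ĝ_Rs + s` and the gradient of `ĝ_Rs` at `x`. -/
def evalObj (Rs : List (List V)) (x : Mix d) : Timed (ℝ × Mix d) := do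
  tick d
  let t ← I.sumTerms x Rs 0
  tick (I.timeC x + d + 6)
  pure (I.n / Rs.length * t.1 + I.lam * (I.k - I.c x), (I.n / Rs.length) • t.2)

/-- The sums of the sizes and of the squared sizes of the RR sets. -/
def sizes : List (List V) → Timed (ℝ × ℝ)
  | [] => pure (0, 0)
  | R :: Rs => do
    tick (R.length + 4)
    let t ← sizes Rs
    pure (t.1 + R.length, t.2 + (R.length : ℝ) ^ 2)

/-- Proximal gradient iteration with step size `η` from the point `x`, at which the gradient of
`ĝ_Rs` is `v`; `best` is the best point so far with its value. -/
def iterate (η : ℝ) (Rs : List (List V)) : ℕ → Mix d → Mix d → Mix d × ℝ → Timed (Mix d × ℝ)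
  | 0, _, _, best => pure best
  | t + 1, x, v, best => do
    tick (2 * d)
    tick (I.timeProx η (x + η • v))
    let y := I.prox η (x + η • v)
    let w ← I.evalObj Rs y
    tick (d + 2)
    iterate η Rs t y w.2 (if best.2 < w.1 then (y, w.1) else best)

/-- The smoothness constant `ν¹(Rs) n β_h + ν²(Rs) n L_h²` of `ĝ_Rs`, where `ν¹(Rs)` and `ν²(Rs)`
are the averages of the sizes and of the squared sizes of the RR sets. -/
def smoothness (Rs : List (List V)) : ℝ :=
  (sizes Rs).val.1 / Rs.length * I.n * I.βh + (sizes Rs).val.2 / Rs.length * I.n * I.Lh ^ 2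

/-- The proximal gradient algorithm for `ĝ_Rs + s` with additive error `err`. It returns the best
of its iterates with the value of `ĝ_Rs + s` there. -/
def proxGrad (Rs : List (List V)) (err : ℝ) : Timed (Mix d × ℝ) := do
  let _ ← sizes Rs
  tick 20
  let w ← I.evalObj Rs I.x₀
  tick d
  I.iterate (1 / I.smoothness Rs) Rs ⌈3 * I.smoothness Rs * I.Δ ^ 2 / (4 * err)⌉₊
    I.x₀ w.2 (I.x₀, w.1)

/-! #### ProxGrad-RIS with resampling -/

/-- The common Lipschitz constant `L₁ = L₂` of `g + s` and `ĝ + s`. -/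
def L : ℝ := I.n ^ 2 * I.Lh + I.lam * I.Lc

/-- `ε' = √2 ε / 3` -/
def ε' : ℝ := Real.sqrt 2 * I.ε / 3

/-- The number of rounds of the sampling procedure. -/
def numRounds : ℕ := ⌊Real.logb 2 (I.n + I.lam * I.k) - 1⌋₊

/-- The guess `x_i` of round `i`. -/
def guess (i : ℕ) : ℝ := (I.n + I.lam * I.k) / 2 ^ i

/-- The number `θ_i` of RR sets of round `i`. -/
def theta (i : ℕ) : ℕ :=
  ⌈I.n * (2 + 2 / 3 * I.ε') *
    (Real.log (I.covering (I.ε / 3 / I.L * I.guess i)) + I.ℓ * Real.log I.n + Real.log 2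
      + Real.log (Real.logb 2 (I.n + I.lam * I.k))) / (I.ε' ^ 2 * I.guess i)⌉₊

/-- `θ⁽¹⁾`, with the approximation ratio `α = 1 / 2` -/
def theta1 (LB : ℝ) : ℝ :=
  8 * I.n * Real.log (4 * I.n ^ I.ℓ) / (LB * ((1 / 2 - I.ε / 3) ^ 2 * I.ε ^ 2 / 9))

/-- `θ⁽²⁾`, with `α = 1 / 2` and `α' = α - ε / 3` -/
def theta2 (LB : ℝ) : ℝ :=
  2 * (1 / 2 - I.ε / 3) * I.n *
      Real.log (4 * I.n ^ I.ℓ * I.covering (I.ε / 3 / (I.L + I.L) * LB)) /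
    ((I.ε / 3 - 1 / 4 * (1 / 2 - I.ε / 3) ^ 2 * (I.ε / 3)) ^ 2 * LB)

/-- The rounds `i, i + 1, …, i + j - 1` of the sampling procedure, each with newly sampled RR sets.
The result is the lower bound `LB`, which is `1` if no round breaks the loop. -/
def rounds [Nonempty V] : ℕ → ℕ → Prog ℝ
  | 0, _ => pure 1
  | j + 1, i => do
    Prog.ofTimed (tick 30)
    let Rs ← I.genRRs (I.theta i)
    let y ← Prog.ofTimed (I.proxGrad Rs (I.ε * I.guess i / 3))
    if (1 + I.ε' + I.ε / 3) * I.guess i ≤ y.2 then pure (y.2 / (1 + I.ε' + I.ε / 3))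
    else rounds j (i + 1)

/-- ProxGrad-RIS, where every round of the sampling procedure samples all its RR sets anew. -/
def proxGradRIS [Nonempty V] : Prog (Mix d) := do
  let LB ← I.rounds I.numRounds 1
  Prog.ofTimed (tick 40)
  let Rs ← I.genRRs ⌈max (I.theta1 LB) (I.theta2 LB)⌉₊
  let y ← Prog.ofTimed (I.proxGrad Rs (I.ε * LB))
  pure y.1

/-! #### The assumptions and the bound -/

/-- The standing assumptions on the data. `Th`, `Tc`, `Tprox` bound the times of the oracles, and
`κ` is the constant of proportionality in the time for sampling a triggering set. -/
structure Assumptions (κ : ℝ) (Th Tc Tprox : ℕ) : Prop where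
  two_le_n : 2 ≤ I.n
  -- the domain, the cost function, the budget and the balance parameter
  dom_subset : I.dom ⊆ box I.u
  c_convex : ConvexOn ℝ I.dom I.c
  c_nonneg : ∀ x ∈ I.dom, 0 ≤ I.c x
  c_lipschitz : LipschitzOnMix I.Lc I.c I.dom
  Lc_nonneg : 0 ≤ I.Lc
  lam_nonneg : 0 ≤ I.lam
  lam_mul_k_le : I.lam * I.k ≤ I.n
  n_add_le : I.n + I.lam * I.k ≤ I.n ^ I.ℓ
  -- the strategy activation functions
  h_mem : ∀ v, ∀ x ∈ box I.u, I.h v x ∈ Set.Icc (0 : ℝ) 1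
  h_mono : ∀ v, MonotoneOnMix (I.h v) (box I.u)
  h_dr : ∀ v, DRSubmodularOn (I.h v) (box I.u)
  h_lipschitz : ∀ v, LipschitzOnMix I.Lh (I.h v) I.dom
  h_grad : ∀ v, ∀ x ∈ I.dom, HasGradientWithinAt (I.h v) (I.gradh v x) (box I.u) x
  h_smooth : ∀ v, ∀ x ∈ I.dom, ∀ y ∈ I.dom, ‖I.gradh v x - I.gradh v y‖ ≤ I.βh * ‖x - y‖
  Lh_pos : 0 < I.Lh
  βh_nonneg : 0 ≤ I.βh
  -- the parameters of the algorithm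
  ε_pos : 0 < I.ε
  ε_lt : I.ε < 1 / 2
  Δ_pos : 0 < I.Δ
  dist_le : ∀ x ∈ I.feasible, ∀ y ∈ I.feasible, ‖x - y‖ ≤ I.Δ
  x₀_mem : I.x₀ ∈ I.feasible
  -- the proximal step is an exact minimizer over the feasible set
  prox_mem : ∀ η > 0, ∀ z, I.prox η z ∈ I.feasible
  prox_min : ∀ η > 0, ∀ z, ∀ y ∈ I.feasible,
    -η * I.s (I.prox η z) + 1 / 2 * ‖z - I.prox η z‖ ^ 2 ≤ -η * I.s y + 1 / 2 * ‖z - y‖ ^ 2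
  -- the optimum is attained, and it is not below the influence spread of a single node
  opt_attained : ∃ x ∈ I.feasible, ∀ y ∈ I.feasible, I.g y + I.s y ≤ I.g x + I.s x
  spread_le : ∀ v, ∃ x ∈ I.feasible, I.spread {v} ≤ I.g x
  -- the times of the oracles
  timeTrig_le : ∀ v, (I.timeTrig v : ℝ) ≤ κ * I.inDegree v
  timeH_le : ∀ v x, I.timeH v x ≤ Th
  timeC_le : ∀ x, I.timeC x ≤ Tc
  timeProx_le : ∀ η z, I.timeProx η z ≤ Tprox
  -- an oracle needs a step for every coordinate that it writes
  gradSize_le : ∀ v x, I.gradSize v x ≤ I.timeH v x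
  dim_le : ∀ η z, d ≤ I.timeProx η z

/-- The bound on the expected running time, with the radius `r` in the covering number. -/
def timeBound (Th Tc Tprox : ℕ) (r : ℝ) : ℝ :=
  I.n ^ 2 * (I.rrMoment 2 * I.βh + I.rrMoment 3 * I.Lh ^ 2)
      * Real.log (I.n ^ I.ℓ * I.covering r) / (I.ε ^ 3 * I.OPT) * (1 + Th)
    + (I.rrMoment 1 * I.n * I.βh + I.rrMoment 2 * I.n * I.Lh ^ 2) / I.ε
      * Real.logb 2 (I.n + I.lam * I.k) * (Tc + Tprox)
    + ((I.numEdges : ℝ) + I.n) * Real.log (I.n ^ I.ℓ * I.covering r) / I.ε ^ 2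

end Problem

end CIMBS

end

set_option linter.unusedSectionVars false

noncomputable section

namespace CIMBS

/-! ### Expectations of randomized programs -/

/-! The run is a sequence of phases, each at a scale `x` (a guess, or finally the lower bound `LB`).
A phase draws at most a constant times `n Λ / (ε² x)` RR sets, where `Λ` is `logCover`, and runs the
gradient method with an error of order at least `ε x`. Its mean cost is at most a constant times `a
/ x² + c / x` (`mean_phase_le`), from two estimates.

Sampling: a node `u` lies in a random RR set with probability `σ({u}) / n ≤ OPT / n`, so a reverse
search costs `O((m + n) OPT / n)` on average (`mean_genRR_time_le`). Gradient steps: their number is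
proportional to the empirical smoothness constant, and the cost of evaluating one is proportional to
the total size of the RR sets. By Chebyshev's sum inequality the product of these two dependent
quantities is at most a linear expression in the empirical moments (`proxGrad_time_le`), whose mean
is controlled by `ν⁽²⁾` and `ν⁽³⁾`.

A wrong stop of the loop is harmless for the time: a round that breaks at guess `x` returns `LB ≥ x`
with certainty, so the final phase is no dearer than a phase at `x`. Late stops are rare. The
gradient method returns at least half of the empirical value at an optimal point, up to the additive
error (`proxGrad_spec`, from the gradient inequality for monotone DR-submodular functions). Hence,
if a round with `x ≤ OPT / 6` does not break, the empirical objective at one fixed optimal point is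
far below its mean, which has probability at most `1 / 8` by a Chernoff bound (`mean_fail_le`). No
union bound over a net is needed here.

Since each round resamples, these failure factors multiply. Halving the scale multiplies the cost by
at most 4, so below `OPT / 6` the expected costs decrease by a factor of at least 2 per round; above
that scale the costs grow at least geometrically towards the one at `OPT / 12`. The whole sum is
therefore a constant times the cost at scale `OPT / 12` (`remainingCost_step`, `totalTime_le`), and
`OPT ≥ 1` yields bound (a). For (b), a ball of radius `3 r` in dimension `d` is covered by `K =
K(d)` balls of radius `r`, and the factor `K` under the logarithm is absorbed into the constant. -/

@[simp] theorem Timed.val_pure {α : Type} (a : α) : (pure a : Timed α).val = a := rfl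
@[simp] theorem Timed.time_pure {α : Type} (a : α) : (pure a : Timed α).time = 0 := rfl
@[simp] theorem Timed.val_bind {α β : Type} (x : Timed α) (f : α → Timed β) :
    (x >>= f).val = (f x.val).val := rfl
@[simp] theorem Timed.time_bind {α β : Type} (x : Timed α) (f : α → Timed β) :
    (x >>= f).time = x.time + (f x.val).time := rfl
@[simp] theorem time_tick (n : ℕ) : (tick n).time = n := rfl

/-- Expectation of a nonnegative function under a `PMF`. -/
def pmfMean {β : Type} (p : PMF β) (f : β → ℝ≥0∞) : ℝ≥0∞ := ∑' x, p x * f x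

theorem pmfMean_pure {β : Type} (a : β) (f : β → ℝ≥0∞) : pmfMean (PMF.pure a) f = f a := by
  unfold pmfMean
  rw [tsum_eq_single a]
  · simp
  · intro b hb; simp [hb]

theorem pmfMean_bind {β γ : Type} (p : PMF β) (q : β → PMF γ) (f : γ → ℝ≥0∞) :
    pmfMean (p.bind q) f = pmfMean p fun x => pmfMean (q x) f := by
  unfold pmfMean
  simp_rw [PMF.bind_apply, ← ENNReal.tsum_mul_right, ← ENNReal.tsum_mul_left]
  rw [ENNReal.tsum_comm]
  simp_rw [mul_assoc]

theorem pmfMean_map {β γ : Type} (p : PMF β) (q : β → γ) (f : γ → ℝ≥0∞) :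
    pmfMean (p.map q) f = pmfMean p fun x => f (q x) := by
  rw [PMF.map, pmfMean_bind]
  simp only [Function.comp_apply, pmfMean_pure]

theorem pmfMean_mono {β : Type} (p : PMF β) {f g : β → ℝ≥0∞} (h : ∀ x, f x ≤ g x) :
    pmfMean p f ≤ pmfMean p g :=
  ENNReal.tsum_le_tsum fun x => by gcongr; exact h x

theorem pmfMean_add {β : Type} (p : PMF β) (f g : β → ℝ≥0∞) :
    (pmfMean p fun x => f x + g x) = pmfMean p f + pmfMean p g := by
  unfold pmfMean
  simp_rw [mul_add]
  exact ENNReal.tsum_add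

theorem pmfMean_const_mul {β : Type} (p : PMF β) (c : ℝ≥0∞) (f : β → ℝ≥0∞) :
    (pmfMean p fun x => c * f x) = c * pmfMean p f := by
  unfold pmfMean
  simp_rw [mul_left_comm _ c]
  exact ENNReal.tsum_mul_left

theorem pmfMean_const {β : Type} (p : PMF β) (c : ℝ≥0∞) : (pmfMean p fun _ => c) = c := by
  unfold pmfMean
  rw [ENNReal.tsum_mul_right, PMF.tsum_coe, one_mul]

/-- Expectation of a nonnegative function of the result and the number of steps. -/
def Prog.mean {α : Type} (p : Prog α) (F : α → ℕ → ℝ≥0∞) : ℝ≥0∞ :=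
  pmfMean (β := α × ℕ) p fun x => F x.1 x.2

namespace Prog

variable {α β : Type}

theorem expTime_eq (p : Prog α) : p.expTime = p.mean fun _ t => (t : ℝ≥0∞) := rfl

theorem mean_pure (a : α) (F : α → ℕ → ℝ≥0∞) : (pure a : Prog α).mean F = F a 0 :=
  pmfMean_pure (a, 0) _

theorem mean_ofTimed (t : Timed α) (F : α → ℕ → ℝ≥0∞) :
    (ofTimed t).mean F = F t.val t.time := pmfMean_pure (t.val, t.time) _

/-- The tower rule for a function of both the result and the clock: the continuation is averaged
with its clock shifted by the time already spent. -/
theorem mean_bind (p : Prog α) (f : α → Prog β) (F : β → ℕ → ℝ≥0∞) :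
    (p >>= f).mean F = p.mean fun a s => (f a).mean fun b t => F b (s + t) := by
  refine (pmfMean_bind (β := α × ℕ) p _ _).trans ?_
  refine congrArg (pmfMean (β := α × ℕ) p) (funext fun x => ?_)
  exact pmfMean_map (β := β × ℕ) (f x.1) _ _

theorem mean_mono (p : Prog α) {F G : α → ℕ → ℝ≥0∞} (h : ∀ a t, F a t ≤ G a t) :
    p.mean F ≤ p.mean G := pmfMean_mono _ fun x => h x.1 x.2

theorem mean_add (p : Prog α) (F G : α → ℕ → ℝ≥0∞) :
    (p.mean fun a t => F a t + G a t) = p.mean F + p.mean G := pmfMean_add _ _ _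

theorem mean_const_mul (p : Prog α) (c : ℝ≥0∞) (F : α → ℕ → ℝ≥0∞) :
    (p.mean fun a t => c * F a t) = c * p.mean F := pmfMean_const_mul _ _ _

theorem mean_const (p : Prog α) (c : ℝ≥0∞) : (p.mean fun _ _ => c) = c := pmfMean_const _ _

theorem const_add_mean (p : Prog α) (c : ℝ≥0∞) (F : α → ℕ → ℝ≥0∞) :
    c + p.mean F = p.mean fun a t => c + F a t := by rw [mean_add, mean_const]

end Prog

/-! ### Reachability -/

namespace TriggeringModel

variable {V : Type} [Fintype V] [DecidableEq V] (M : TriggeringModel V)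

theorem mem_rrSet {T : V → Finset V} {u v : V} :
    u ∈ rrSet T v ↔ Relation.ReflTransGen (fun a b => a ∈ T b) u v := by
  simp [rrSet]

theorem self_mem_rrSet (T : V → Finset V) (v : V) : v ∈ rrSet T v :=
  mem_rrSet.2 .refl

/-- Forward activation and reverse reachability are the same relation on the live-edge graph. This
duality turns influence spread into hitting probabilities of RR sets. -/
theorem mem_finalActive {T : V → Finset V} {S : Finset V} {v : V} :
    v ∈ finalActive T S ↔ ∃ u ∈ S, u ∈ rrSet T v := by
  simp only [finalActive, Finset.mem_filter, Finset.mem_univ, true_and, mem_rrSet]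
  constructor
  · rintro ⟨t, ht⟩
    induction t generalizing v with
    | zero => exact ⟨v, ht, .refl⟩
    | succ t ih =>
      rw [active, Finset.mem_union, Finset.mem_filter] at ht
      rcases ht with ht | ⟨_, w, hw, hwt⟩
      · exact ih ht
      · obtain ⟨u, hu, huw⟩ := ih hwt
        exact ⟨u, hu, huw.tail hw⟩
  · rintro ⟨u, hu, huv⟩
    induction huv with
    | refl => exact ⟨0, hu⟩
    | tail _ hbc ih =>
      obtain ⟨t, ht⟩ := ih
      refine ⟨t + 1, ?_⟩
      rw [active, Finset.mem_union, Finset.mem_filter]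
      exact .inr ⟨Finset.mem_univ _, _, hbc, ht⟩

theorem sum_profile : ∑ T : V → Finset V, (M.profile T).toReal = 1 := by
  rw [← ENNReal.toReal_sum (fun T _ => M.profile.apply_ne_top T),
    ← tsum_fintype (L := .unconditional _), PMF.tsum_coe, ENNReal.toReal_one]

/-! ### Averages over a random root and a random profile -/

/-- The mean of `f T v` for a uniformly random root `v` and a random profile `T`. -/
def rootMean (f : (V → Finset V) → V → ℝ) : ℝ :=
  ∑ v : V, (1 / (Fintype.card V : ℝ)) * ∑ T : V → Finset V, (M.profile T).toReal * f T v

theorem rrMoment_eq (j : ℕ) : M.rrMoment j = M.rootMean fun T v => ((rrSet T v).card : ℝ) ^ j :=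
  rfl

theorem rootMean_mono {f f' : (V → Finset V) → V → ℝ} (h : ∀ T v, f T v ≤ f' T v) :
    M.rootMean f ≤ M.rootMean f' := by
  unfold rootMean
  gcongr with v _ T _
  exact h T v

theorem rootMean_add (f f' : (V → Finset V) → V → ℝ) :
    M.rootMean (fun T v => f T v + f' T v) = M.rootMean f + M.rootMean f' := by
  simp only [rootMean, mul_add, Finset.sum_add_distrib]

theorem rootMean_const_mul (a : ℝ) (f : (V → Finset V) → V → ℝ) :
    M.rootMean (fun T v => a * f T v) = a * M.rootMean f := by
  simp only [rootMean, Finset.mul_sum]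
  refine Finset.sum_congr rfl fun v _ => Finset.sum_congr rfl fun T _ => by ring

theorem rootMean_const [Nonempty V] (a : ℝ) : M.rootMean (fun _ _ => a) = a := by
  have : (Fintype.card V : ℝ) ≠ 0 := by exact_mod_cast Fintype.card_ne_zero
  simp only [rootMean, ← Finset.sum_mul, M.sum_profile]
  simp [this]

theorem rootMean_sum {ι : Type} (s : Finset ι) (f : ι → (V → Finset V) → V → ℝ) :
    M.rootMean (fun T v => ∑ i ∈ s, f i T v) = ∑ i ∈ s, M.rootMean (f i) := by
  classical
  induction s using Finset.induction_on with
  | empty => simp [rootMean]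
  | insert a s ha ih => simp only [Finset.sum_insert ha, rootMean_add, ih]

-- Counting activated nodes amounts to testing whether a uniformly random root is activated and
-- multiplying by the number of nodes.
open Classical in
theorem spread_eq [Nonempty V] (S : Finset V) :
    M.spread S = Fintype.card V *
      M.rootMean fun T v => if ∃ u ∈ S, u ∈ rrSet T v then (1 : ℝ) else 0 := by
  have : (Fintype.card V : ℝ) ≠ 0 := by exact_mod_cast Fintype.card_ne_zero
  unfold spread rootMean
  rw [← Finset.mul_sum, ← mul_assoc, mul_one_div_cancel this, one_mul, Finset.sum_comm]
  refine Finset.sum_congr rfl fun T _ => ?_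
  rw [← Finset.mul_sum, Finset.sum_boole]
  congr 3
  ext v
  simp [mem_finalActive]

theorem one_le_spread_singleton (v : V) : 1 ≤ M.spread {v} := by
  unfold spread
  rw [← M.sum_profile]
  refine Finset.sum_le_sum fun T _ => ?_
  refine le_mul_of_one_le_right ENNReal.toReal_nonneg ?_
  have : 0 < (finalActive T {v}).card :=
    Finset.card_pos.2 ⟨v, mem_finalActive.2 ⟨v, by simp, self_mem_rrSet T v⟩⟩
  exact_mod_cast this

-- By linearity, since a random RR set contains `u` with probability `σ({u}) / n`. With
-- degree-dependent weights this prices a reverse search.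
open Classical in
theorem rootMean_sum_rrSet [Nonempty V] (w : V → ℝ) :
    M.rootMean (fun T v => ∑ u ∈ rrSet T v, w u) =
      ∑ u, w u * (M.spread {u} / Fintype.card V) := by
  have hc : (Fintype.card V : ℝ) ≠ 0 := by exact_mod_cast Fintype.card_ne_zero
  have : (fun (T : V → Finset V) v => ∑ u ∈ rrSet T v, w u) =
      fun T v => ∑ u, w u * if u ∈ rrSet T v then (1 : ℝ) else 0 := by
    funext T v
    simp
  rw [this, rootMean_sum]
  refine Finset.sum_congr rfl fun u _ => ?_
  rw [rootMean_const_mul, spread_eq]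
  simp [hc]

-- The weights are the law of a random set containing each `u` independently with probability `p u`;
-- such a set misses `R` with probability `∏ v ∈ R, (1 - p v)`. The identity is algebraic and does
-- not need `p` to lie in `[0, 1]`.
open Classical in
theorem sum_weights_of_hit (p : V → ℝ) (R : Finset V) :
    ∑ S : Finset V, (if ∃ u ∈ S, u ∈ R then (1 : ℝ) else 0) *
      ((∏ u ∈ S, p u) * ∏ v ∈ Sᶜ, (1 - p v)) = 1 - ∏ v ∈ R, (1 - p v) := by
  have h1 : ∑ S : Finset V, ((∏ u ∈ S, p u) * ∏ v ∈ Sᶜ, (1 - p v)) = 1 := by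
    have := Finset.prod_add p (fun v => 1 - p v) Finset.univ
    simp only [add_sub_cancel, Finset.prod_const_one, Finset.powerset_univ] at this
    refine Eq.trans ?_ this.symm
    exact Finset.sum_congr rfl fun S _ => by rw [Finset.compl_eq_univ_sdiff]
  have h2 : ∑ S : Finset V, (if ∃ u ∈ S, u ∈ R then (0 : ℝ) else 1) *
      ((∏ u ∈ S, p u) * ∏ v ∈ Sᶜ, (1 - p v)) = ∏ v ∈ R, (1 - p v) := by
    -- Replacing `p` by zero on `R` kills exactly the terms of those `S` that meet `R`.
    have := Finset.prod_add (fun v => if v ∈ R then 0 else p v) (fun v => 1 - p v) Finset.univ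
    simp only [Finset.powerset_univ] at this
    have h3 : ∏ v, ((if v ∈ R then 0 else p v) + (1 - p v)) = ∏ v ∈ R, (1 - p v) := by
      rw [← Finset.prod_filter_mul_prod_filter_not Finset.univ (· ∈ R)]
      have e1 : ∏ v ∈ Finset.univ.filter (· ∈ R), ((if v ∈ R then 0 else p v) + (1 - p v)) =
          ∏ v ∈ Finset.univ.filter (· ∈ R), (1 - p v) :=
        Finset.prod_congr rfl fun v hv => by simp only [Finset.mem_filter] at hv; simp [hv.2]
      have e2 : ∏ v ∈ Finset.univ.filter (· ∉ R), ((if v ∈ R then 0 else p v) + (1 - p v)) = 1 :=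
        Finset.prod_eq_one fun v hv => by simp only [Finset.mem_filter] at hv; simp [hv.2]
      rw [e1, e2, mul_one]
      simp
    rw [← h3, this]
    refine Finset.sum_congr rfl fun S _ => ?_
    rw [← Finset.compl_eq_univ_sdiff]
    split_ifs with h
    · obtain ⟨u, hu, huR⟩ := h
      have h0 : ∏ u ∈ S, (if u ∈ R then 0 else p u) = 0 := Finset.prod_eq_zero hu (if_pos huR)
      rw [h0, zero_mul, zero_mul]
    · push Not at h
      rw [one_mul]
      congr 1
      exact Finset.prod_congr rfl fun u hu => by simp [h u hu]
  rw [eq_sub_iff_add_eq, ← h2, ← Finset.sum_add_distrib]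
  refine Eq.trans (Finset.sum_congr rfl fun S _ => ?_) h1
  split_ifs <;> ring

end TriggeringModel

namespace Problem

open TriggeringModel

variable {V : Type} [Fintype V] [DecidableEq V] {d : ℕ} (I : Problem V d)

theorem g_eq [Nonempty V] (x : Mix d) :
    I.g x = I.n * I.rootMean fun T v => 1 - ∏ u ∈ rrSet T v, (1 - I.h u x) := by
  classical
  unfold g
  simp only [spread_eq, ← sum_weights_of_hit (fun u => I.h u x)]
  rw [rootMean_sum, Finset.mul_sum]
  refine Finset.sum_congr rfl fun S _ => ?_
  simp only [mul_comm _ ((∏ u ∈ S, I.h u x) * ∏ v ∈ Sᶜ, (1 - I.h v x)), rootMean_const_mul]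
  unfold n
  ring

/-! ### Reverse search -/

theorem expand_spec (ws : List V) : ∀ stack seen : List V, ws.Nodup → ∃ new : List V,
    (expand ws stack seen).val = (new ++ stack, new ++ seen) ∧ new.Nodup ∧
    (∀ w, w ∈ new ↔ w ∈ ws ∧ w ∉ seen) ∧
    (expand ws stack seen).time ≤ 4 * ws.length := by
  induction ws with
  | nil => intro stack seen _; exact ⟨[], rfl, by simp, by simp, by simp [expand]⟩
  | cons a ws ih =>
    intro stack seen hnd
    rw [List.nodup_cons] at hnd
    by_cases ha : a ∈ seen
    · obtain ⟨new, h1, h2, h3, h4⟩ := ih stack seen hnd.2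
      refine ⟨new, by simp [expand, ha, h1], h2, fun w => ?_, ?_⟩
      · rw [h3, List.mem_cons]
        constructor
        · rintro ⟨h, h'⟩; exact ⟨.inr h, h'⟩
        · rintro ⟨h | h, h'⟩
          · exact absurd (h ▸ ha) h'
          · exact ⟨h, h'⟩
      · simp [expand, ha]; omega
    · obtain ⟨new, h1, h2, h3, h4⟩ := ih (a :: stack) (a :: seen) hnd.2
      refine ⟨new ++ [a], by simp [expand, ha, h1], ?_, fun w => ?_, ?_⟩
      · rw [List.nodup_append]
        refine ⟨h2, by simp, ?_⟩
        intro x hx y hy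
        rw [List.mem_singleton] at hy
        rw [h3] at hx
        rintro rfl
        exact hx.2 (by simp [hy])
      · simp only [List.mem_append, h3, List.mem_cons, not_or, List.not_mem_nil, or_false]
        constructor
        · rintro (⟨h, h', h''⟩ | rfl)
          · exact ⟨.inr h, h''⟩
          · exact ⟨.inl rfl, ha⟩
        · rintro ⟨rfl | h, h'⟩
          · exact .inr rfl
          · by_cases hw : w = a
            · exact .inr hw
            · exact .inl ⟨h, hw, h'⟩
      · simp [expand, ha]; omega

/-- The invariant says that marked nodes reach the root and that every marked node off the stack has
its whole triggering set marked; with an empty stack the marked set is then closed under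
predecessors. The time bound charges each node once, when it is expanded: the nodes still to be
expanded are those of the final list that are not yet marked, together with the stack. -/
theorem search_spec (T : V → Finset V) (root : V) : ∀ (fuel : ℕ) (stack seen : List V),
    stack.Nodup → seen.Nodup → stack ⊆ seen → root ∈ seen → (∀ w ∈ seen, w ∈ rrSet T root) →
    (∀ w ∈ seen, w ∉ stack → ∀ u ∈ T w, u ∈ seen) →
    Fintype.card V + stack.length ≤ fuel + seen.length →
    (I.search T fuel stack seen).val.Nodup ∧
    (I.search T fuel stack seen).val.toFinset = rrSet T root ∧
    (I.search T fuel stack seen).time +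
        (seen.map fun w => I.timeTrig w + 1 + 4 * (T w).card).sum ≤
      (stack.map fun w => I.timeTrig w + 1 + 4 * (T w).card).sum +
        ((I.search T fuel stack seen).val.map fun w => I.timeTrig w + 1 + 4 * (T w).card).sum := by
  have key : ∀ seen : List V, root ∈ seen → (∀ w ∈ seen, w ∈ rrSet T root) →
      (∀ w ∈ seen, ∀ u ∈ T w, u ∈ seen) → seen.toFinset = rrSet T root := by
    intro seen hr hs hc
    refine Finset.Subset.antisymm (fun w hw => hs w (List.mem_toFinset.1 hw)) fun w hw => ?_
    rw [mem_rrSet] at hw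
    rw [List.mem_toFinset]
    induction hw using Relation.ReflTransGen.head_induction_on with
    | refl => exact hr
    | head hab _ ih => exact hc _ ih _ hab
  intro fuel
  induction fuel with
  | zero =>
    intro stack seen h1 h2 h3 h4 h5 h6 h7
    -- Marked nodes are distinct, so running out of fuel forces the stack to be empty.
    have : seen.length ≤ Fintype.card V := h2.length_le_card
    have hst : stack = [] := List.eq_nil_of_length_eq_zero (by omega)
    subst hst
    exact ⟨h2, key seen h4 h5 fun w hw => h6 w hw (by simp), by simp [search]⟩
  | succ fuel ih =>
    intro stack seen h1 h2 h3 h4 h5 h6 h7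
    cases stack with
    | nil => exact ⟨h2, key seen h4 h5 fun w hw => h6 w hw (by simp), by simp [search]⟩
    | cons v stack =>
      obtain ⟨new, e1, e2, e3, e4⟩ := expand_spec (T v).toList stack seen (Finset.nodup_toList _)
      rw [Finset.length_toList] at e4
      have hrec : (I.search T (fuel + 1) (v :: stack) seen).val =
          (I.search T fuel (new ++ stack) (new ++ seen)).val := by
        simp [search, e1]
      have htime : (I.search T (fuel + 1) (v :: stack) seen).time =
          I.timeTrig v + 1 + ((expand (T v).toList stack seen).time +
            (I.search T fuel (new ++ stack) (new ++ seen)).time) := by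
        simp [search, e1]
      rw [List.nodup_cons] at h1
      have hvs : v ∈ seen := h3 (by simp)
      have hss : stack ⊆ seen := fun w hw => h3 (by simp [hw])
      obtain ⟨i1, i2, i3⟩ := ih (new ++ stack) (new ++ seen)
        (List.nodup_append.2 ⟨e2, h1.2, fun a ha b hb hab =>
          ((e3 a).1 ha).2 (hab ▸ hss hb)⟩)
        (List.nodup_append.2 ⟨e2, h2, fun a ha b hb hab => ((e3 a).1 ha).2 (hab ▸ hb)⟩)
        (by
          intro w hw
          rcases List.mem_append.1 hw with hw | hw
          · exact List.mem_append.2 (.inl hw)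
          · exact List.mem_append.2 (.inr (hss hw)))
        (List.mem_append.2 (.inr h4))
        (by
          intro w hw
          rcases List.mem_append.1 hw with hw | hw
          · have := (e3 w).1 hw
            rw [Finset.mem_toList] at this
            exact mem_rrSet.2 (.head this.1 (mem_rrSet.1 (h5 v hvs)))
          · exact h5 w hw)
        (by
          intro w hw hws u hu
          rw [List.mem_append, not_or] at hws
          have hw' : w ∈ seen := (List.mem_append.1 hw).resolve_left hws.1
          by_cases hus : u ∈ seen
          · exact List.mem_append.2 (.inr hus)
          · refine List.mem_append.2 (.inl ?_)
            by_cases hwv : w = v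
            · subst hwv
              exact (e3 u).2 ⟨Finset.mem_toList.2 hu, hus⟩
            · exact absurd (h6 w hw' (by simp [hwv, hws.2]) u hu) hus)
        (by simp only [List.length_append, List.length_cons] at h7 ⊢; omega)
      rw [hrec, htime]
      refine ⟨i1, i2, ?_⟩
      simp only [List.map_append, List.sum_append, List.map_cons, List.sum_cons] at i3 ⊢
      omega

theorem search_root_spec (T : V → Finset V) (v : V) :
    (I.search T (Fintype.card V) [v] [v]).val.Nodup ∧
    (I.search T (Fintype.card V) [v] [v]).val.toFinset = rrSet T v ∧
    (I.search T (Fintype.card V) [v] [v]).time ≤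
      ∑ w ∈ rrSet T v, (I.timeTrig w + 1 + 4 * (T w).card) := by
  obtain ⟨h1, h2, h3⟩ := I.search_spec T v (Fintype.card V) [v] [v] (by simp) (by simp)
    (by simp) (by simp) (by simp [self_mem_rrSet]) (by simp) (by simp)
  refine ⟨h1, h2, ?_⟩
  rw [← h2, List.sum_toFinset _ h1]
  omega

variable [Nonempty V]

theorem mean_genRR (F : List V → ℕ → ℝ≥0∞) :
    I.genRR.mean F = ∑ v : V, (Fintype.card V : ℝ≥0∞)⁻¹ * ∑ T : V → Finset V, I.profile T *
      F (I.search T (Fintype.card V) [v] [v]).val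
        ((I.search T (Fintype.card V) [v] [v]).time + 4) := by
  unfold genRR Prog.mean
  rw [pmfMean_bind]
  simp only [pmfMean_map]
  simp [pmfMean, tsum_fintype]

/-- Only profiles of positive probability have to be checked. This matters because triggering sets
consist of in-neighbours only on the support. -/
theorem mean_genRR_le (F : List V → ℕ → ℝ≥0∞) (f : (V → Finset V) → V → ℝ)
    (hf : ∀ T v, 0 ≤ f T v)
    (h : ∀ T ∈ I.profile.support, ∀ v, F (I.search T (Fintype.card V) [v] [v]).val
        ((I.search T (Fintype.card V) [v] [v]).time + 4) ≤ ENNReal.ofReal (f T v)) :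
    I.genRR.mean F ≤ ENNReal.ofReal (I.rootMean f) := by
  rw [mean_genRR, rootMean, ENNReal.ofReal_sum_of_nonneg]
  swap
  · intro v _
    exact mul_nonneg (by positivity)
      (Finset.sum_nonneg fun T _ => mul_nonneg ENNReal.toReal_nonneg (hf T v))
  refine Finset.sum_le_sum fun v _ => ?_
  rw [ENNReal.ofReal_mul (by positivity), one_div, ENNReal.ofReal_inv_of_pos
    (by exact_mod_cast Fintype.card_pos), ENNReal.ofReal_natCast,
    ENNReal.ofReal_sum_of_nonneg fun T _ => mul_nonneg ENNReal.toReal_nonneg (hf T v)]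
  gcongr with T _
  rw [ENNReal.ofReal_mul ENNReal.toReal_nonneg, ENNReal.ofReal_toReal (PMF.apply_ne_top _ _)]
  by_cases hT : I.profile T = 0
  · simp [hT]
  · gcongr
    exact h T (by simpa using hT) v

theorem card_le_inDegree {T : V → Finset V} (hT : T ∈ I.profile.support) (v : V) :
    (T v).card ≤ I.inDegree v := by
  classical
  refine Finset.card_le_card fun u hu => ?_
  have : I.D v (T v) ≠ 0 := by
    intro h0
    rw [PMF.mem_support_iff] at hT
    exact hT (Finset.prod_eq_zero (Finset.mem_univ v) h0)
  simpa using I.D_subset v (T v) this u hu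

theorem genRR_length (T : V → Finset V) (v : V) :
    (I.search T (Fintype.card V) [v] [v]).val.length = (rrSet T v).card := by
  obtain ⟨h1, h2, -⟩ := I.search_root_spec T v
  rw [← h2, List.toFinset_card_of_nodup h1]

theorem mean_genRR_length_pow (j : ℕ) :
    (I.genRR.mean fun R _ => (R.length : ℝ≥0∞) ^ j) ≤ ENNReal.ofReal (I.rrMoment j) := by
  rw [rrMoment_eq]
  refine I.mean_genRR_le _ _ (fun T v => by positivity) fun T _ v => ?_
  rw [genRR_length, ENNReal.ofReal_pow (by positivity), ENNReal.ofReal_natCast]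

/-- Expanding `w` costs at most `(κ + 4)` times its in-degree plus one, and `w` is visited with
probability `σ({w}) / n ≤ O / n`. Summing over `w` turns the in-degrees into the number of edges. -/
theorem mean_genRR_time_le {κ O : ℝ} (hκ : 0 ≤ κ) (hO : ∀ v, I.spread {v} ≤ O)
    (ht : ∀ v, (I.timeTrig v : ℝ) ≤ κ * I.inDegree v) :
    (I.genRR.mean fun _ t => (t : ℝ≥0∞)) ≤
      ENNReal.ofReal ((κ + 8) * (I.numEdges + I.n) / I.n * O) := by
  have hO1 : 1 ≤ O := (I.one_le_spread_singleton (Classical.arbitrary V)).trans (hO _)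
  have hn : (0 : ℝ) < Fintype.card V := by exact_mod_cast Fintype.card_pos
  refine (I.mean_genRR_le _
    (fun T v => ∑ w ∈ rrSet T v, ((κ + 4) * I.inDegree w + 1) + 4) (fun T v => ?_)
      fun T hT v => ?_).trans ?_
  · have : ∀ w ∈ rrSet T v, 0 ≤ (κ + 4) * (I.inDegree w : ℝ) + 1 := fun w _ => by positivity
    linarith [Finset.sum_nonneg this]
  · rw [← ENNReal.ofReal_natCast]
    refine ENNReal.ofReal_le_ofReal ?_
    push_cast
    gcongr
    refine (Nat.cast_le.2 (I.search_root_spec T v).2.2).trans ?_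
    push_cast
    refine Finset.sum_le_sum fun w _ => ?_
    have h1 := ht w
    have h2 : ((T w).card : ℝ) ≤ I.inDegree w := by exact_mod_cast I.card_le_inDegree hT w
    linarith
  · refine ENNReal.ofReal_le_ofReal ?_
    rw [rootMean_add, rootMean_const, rootMean_sum_rrSet]
    have hsum : ∑ u, ((κ + 4) * (I.inDegree u : ℝ) + 1) * (I.spread {u} / Fintype.card V) ≤
        ∑ u, ((κ + 4) * (I.inDegree u : ℝ) + 1) * (O / Fintype.card V) := by
      gcongr with u _
      exact hO u
    have hm : ∑ u, ((κ + 4) * (I.inDegree u : ℝ) + 1) = (κ + 4) * I.numEdges + Fintype.card V := by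
      simp [Finset.sum_add_distrib, ← Finset.mul_sum, numEdges]
    rw [← Finset.sum_mul, hm] at hsum
    refine (add_le_add_left hsum 4).trans ?_
    unfold n
    -- The constant overhead of a search is absorbed because `O ≥ 1`; this raises `κ + 4` to `κ +
    -- 8`.
    have h4 : (4 : ℝ) ≤ 4 * O * ((I.numEdges + Fintype.card V) / Fintype.card V) := by
      have : (1 : ℝ) ≤ (I.numEdges + Fintype.card V) / Fintype.card V := by
        rw [one_le_div hn]; linarith [(Nat.cast_nonneg I.numEdges : (0 : ℝ) ≤ _)]
      nlinarith
    have h5 : ((κ + 4) * (I.numEdges : ℝ) + Fintype.card V) * (O / Fintype.card V) ≤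
        (κ + 4) * (I.numEdges + Fintype.card V) * (O / Fintype.card V) := by
      have : (Fintype.card V : ℝ) ≤ (κ + 4) * Fintype.card V := by nlinarith
      gcongr
      linarith
    calc _ ≤ (κ + 4) * (I.numEdges + Fintype.card V) * (O / Fintype.card V) +
        4 * O * ((I.numEdges + Fintype.card V) / Fintype.card V) := add_le_add h5 h4
      _ = _ := by field_simp; ring

/-! ### Samples of RR sets -/

theorem mean_genRRs_succ (θ : ℕ) (F : List (List V) → ℕ → ℝ≥0∞) :
    (I.genRRs (θ + 1)).mean F =
      I.genRR.mean fun R s => (I.genRRs θ).mean fun Rs t => F (R :: Rs) (s + (t + 1)) := by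
  rw [genRRs]
  simp [Prog.mean_bind, Prog.mean_ofTimed, Prog.mean_pure]

/-- An almost sure comparison: a sample has exactly `θ` members, and each is nonempty because it
contains its root. -/
theorem mean_genRRs_mono (θ : ℕ) {F G : List (List V) → ℕ → ℝ≥0∞}
    (h : ∀ Rs t, Rs.length = θ → (∀ R ∈ Rs, R ≠ []) → F Rs t ≤ G Rs t) :
    (I.genRRs θ).mean F ≤ (I.genRRs θ).mean G := by
  induction θ generalizing F G with
  | zero =>
    rw [genRRs, Prog.mean_pure, Prog.mean_pure]
    exact h _ _ rfl (by simp)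
  | succ θ ih =>
    rw [mean_genRRs_succ, mean_genRRs_succ, mean_genRR, mean_genRR]
    gcongr with v _ T _
    refine ih fun Rs t h1 h2 => h _ _ (by simp [h1]) ?_
    intro R hR
    rcases List.mem_cons.1 hR with rfl | hR
    · intro h0
      have := (I.search_root_spec T v).2.1
      rw [h0] at this
      exact absurd (self_mem_rrSet T v) (by simp [← this])
    · exact h2 R hR

theorem mean_genRRs_time (θ : ℕ) :
    ((I.genRRs θ).mean fun _ t => (t : ℝ≥0∞)) = θ * ((I.genRR.mean fun _ t => (t : ℝ≥0∞)) + 1) := by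
  induction θ with
  | zero => rw [genRRs, Prog.mean_pure]; simp
  | succ θ ih =>
    rw [mean_genRRs_succ]
    push_cast
    simp only [Prog.mean_add, Prog.mean_const, ih]
    ring

theorem mean_genRRs_sum (θ : ℕ) (f : List V → ℝ≥0∞) :
    ((I.genRRs θ).mean fun Rs _ => (Rs.map f).sum) = θ * I.genRR.mean fun R _ => f R := by
  induction θ with
  | zero => rw [genRRs, Prog.mean_pure]; simp
  | succ θ ih =>
    rw [mean_genRRs_succ]
    simp only [List.map_cons, List.sum_cons, Prog.mean_add, Prog.mean_const, ih]
    push_cast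
    ring

/-- Independence of the RR sets, in the form needed for exponential moments. -/
theorem mean_genRRs_prod (θ : ℕ) (f : List V → ℝ≥0∞) :
    ((I.genRRs θ).mean fun Rs _ => (Rs.map f).prod) = (I.genRR.mean fun R _ => f R) ^ θ := by
  induction θ with
  | zero => rw [genRRs, Prog.mean_pure]; simp
  | succ θ ih =>
    rw [mean_genRRs_succ]
    simp only [List.map_cons, List.prod_cons, Prog.mean_const_mul, ih]
    simp only [mul_comm _ (_ ^ θ), Prog.mean_const_mul]
    rw [pow_succ]

end Problem

open Filter Topology InnerProductSpace

/-! ### DR-submodular functions on boxes -/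

section Box

variable {d : ℕ} {u : Fin d → ℝ≥0∞}

theorem mem_box_of_le {y z : Mix d} (hy : y ∈ box u) (h0 : ∀ i, 0 ≤ z i) (h : ∀ i, z i ≤ y i) :
    z ∈ box u :=
  fun i => ⟨h0 i, (ENNReal.ofReal_le_ofReal (h i)).trans (hy i).2⟩

theorem le_add_single {x : Mix d} {i : Fin d} {δ : ℝ} (hδ : 0 ≤ δ) (j : Fin d) :
    x j ≤ (x + EuclideanSpace.single i δ) j := by
  simp only [PiLp.add_apply, PiLp.single_apply]
  split_ifs <;> linarith

theorem add_single_mono {x y : Mix d} (h : ∀ i, x i ≤ y i) (i : Fin d) (δ : ℝ) (j : Fin d) :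
    (x + EuclideanSpace.single i δ) j ≤ (y + EuclideanSpace.single i δ) j := by
  simp only [PiLp.add_apply]
  linarith [h j]

/-- Diminishing returns for an arbitrary nonnegative increment follow by adding its coordinates one
at a time; all intermediate points stay in the box because `y + w` does. -/
theorem DRSubmodularOn.sub_le_sub {f : Mix d → ℝ} (hf : DRSubmodularOn f (box u)) {x y w : Mix d}
    (hx : x ∈ box u) (hxy : ∀ i, x i ≤ y i) (hw : ∀ i, 0 ≤ w i) (hyw : y + w ∈ box u) :
    f (y + w) - f y ≤ f (x + w) - f x := by
  have key : ∀ s : Finset (Fin d),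
      f (y + ∑ i ∈ s, EuclideanSpace.single i (w i)) - f y ≤
        f (x + ∑ i ∈ s, EuclideanSpace.single i (w i)) - f x := by
    have hcoord : ∀ (s : Finset (Fin d)) (j : Fin d),
        (∑ i ∈ s, EuclideanSpace.single i (w i) : Mix d) j = if j ∈ s then w j else 0 := by
      intro s j
      simp [WithLp.ofLp_sum, Finset.sum_apply]
    have hc0 : ∀ (s : Finset (Fin d)) (j : Fin d),
        0 ≤ (∑ i ∈ s, EuclideanSpace.single i (w i) : Mix d) j ∧
        (∑ i ∈ s, EuclideanSpace.single i (w i) : Mix d) j ≤ w j := by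
      intro s j
      rw [hcoord]
      split_ifs
      · exact ⟨hw j, le_rfl⟩
      · exact ⟨le_rfl, hw j⟩
    have hby : ∀ s : Finset (Fin d), y + ∑ i ∈ s, EuclideanSpace.single i (w i) ∈ box u := by
      intro s
      refine mem_box_of_le hyw (fun j => ?_) fun j => ?_ <;> simp only [PiLp.add_apply] <;>
        linarith [hc0 s j, (hx j).1, hxy j]
    have hbx : ∀ s : Finset (Fin d), x + ∑ i ∈ s, EuclideanSpace.single i (w i) ∈ box u := by
      intro s
      refine mem_box_of_le hyw (fun j => ?_) fun j => ?_ <;> simp only [PiLp.add_apply] <;>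
        linarith [hc0 s j, (hx j).1, hxy j]
    intro s
    induction s using Finset.induction_on with
    | empty => simp
    | insert a s ha ih =>
      have hby' := hby (insert a s)
      have hbx' := hbx (insert a s)
      simp only [Finset.sum_insert ha, add_comm (EuclideanSpace.single a (w a)), ← add_assoc]
        at hby' hbx' ⊢
      -- Diminishing returns is only postulated for positive increments, so a vanishing coordinate
      -- is treated apart.
      rcases (hw a).eq_or_lt with h0 | h0
      · have hz : (EuclideanSpace.single a (0 : ℝ) : Mix d) = 0 := by ext j; simp
        rw [← h0, hz, add_zero, add_zero]
        exact ih
      · have := hf _ (hbx s) _ (hby s) (fun j => by simp only [PiLp.add_apply]; linarith [hxy j])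
          a (w a) h0 hbx' hby'
        linarith
  have hsum : ∑ i, EuclideanSpace.single i (w i) = w := by
    ext j
    simp [WithLp.ofLp_sum, Finset.sum_apply]
  simpa [hsum] using key Finset.univ

/-- Difference quotients along a segment converge to the directional derivative. -/
theorem HasGradientWithinAt.tendsto_segment {f : Mix d → ℝ} {f' x w : Mix d} {S : Set (Mix d)}
    (hf : HasGradientWithinAt f f' S x) (hS : ∀ t : ℝ, 0 ≤ t → t ≤ 1 → x + t • w ∈ S) :
    Tendsto (fun N : ℕ => ((N : ℝ) + 1) * (f (x + (1 / ((N : ℝ) + 1)) • w) - f x)) atTop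
      (𝓝 (inner ℝ f' w)) := by
  have hlim : Tendsto (fun N : ℕ => 1 / ((N : ℝ) + 1)) atTop (𝓝 0) :=
    tendsto_one_div_add_atTop_nhds_zero_nat
  have := HasFDerivWithinAt.lim hf.hasFDerivWithinAt (l := atTop) (c := fun N : ℕ => (N : ℝ) + 1)
    (d := fun N : ℕ => (1 / ((N : ℝ) + 1)) • w) (v := w)
    (by simpa using hlim.smul_const w)
    (Eventually.of_forall fun N => hS _ (by positivity) (by
      rw [div_le_one (by positivity)]; linarith [(Nat.cast_nonneg N : (0 : ℝ) ≤ N)])) ?_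
  · simpa using this
  · refine tendsto_const_nhds.congr fun N => ?_
    rw [smul_smul, mul_one_div_cancel (by positivity), one_smul]

/-- A DR-submodular function is concave along nonnegative directions: cut `w` into `N + 1` equal
steps, none of which gains more than the first, and let `N` tend to infinity. -/
theorem DRSubmodularOn.sub_le_inner {f : Mix d → ℝ} (hf : DRSubmodularOn f (box u))
    {f' x w : Mix d} (hx : x ∈ box u) (hw : ∀ i, 0 ≤ w i) (hxw : x + w ∈ box u)
    (hg : HasGradientWithinAt f f' (box u) x) : f (x + w) - f x ≤ inner ℝ f' w := by
  have hmem : ∀ t : ℝ, 0 ≤ t → t ≤ 1 → x + t • w ∈ box u := fun t h0 h1 =>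
    mem_box_of_le hxw
      (fun i => by
        simp only [PiLp.add_apply, PiLp.smul_apply, smul_eq_mul]
        linarith [mul_nonneg h0 (hw i), (hx i).1])
      (fun i => by
        simp only [PiLp.add_apply, PiLp.smul_apply, smul_eq_mul]
        linarith [mul_le_of_le_one_left (hw i) h1])
  refine ge_of_tendsto' (HasGradientWithinAt.tendsto_segment hg hmem) fun N => ?_
  set e : ℝ := 1 / ((N : ℝ) + 1) with he
  have he0 : 0 ≤ e := by positivity
  have hstep : ∀ j : ℕ, (j : ℝ) * e ≤ 1 →
      f (x + ((j : ℝ) * e) • w) - f x ≤ j * (f (x + e • w) - f x) := by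
    intro j
    induction j with
    | zero => simp
    | succ j ih =>
      intro hj
      push_cast at hj ⊢
      have h1 := hf.sub_le_sub (x := x) (y := x + ((j : ℝ) * e) • w) (w := e • w) hx
        (fun i => by
          simp only [PiLp.add_apply, PiLp.smul_apply, smul_eq_mul]
          linarith [mul_nonneg (mul_nonneg (Nat.cast_nonneg (α := ℝ) j) he0) (hw i)])
        (fun i => by
          simp only [PiLp.smul_apply, smul_eq_mul]
          exact mul_nonneg he0 (hw i))
        (by
          rw [add_assoc, ← add_smul]
          exact hmem _ (by positivity) (by linarith))
      have h2 := ih (by linarith)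
      have h3 : x + (((j : ℝ) + 1) * e) • w = x + ((j : ℝ) * e) • w + e • w := by
        rw [add_assoc, ← add_smul]; ring_nf
      rw [h3]
      linarith
  have h1 : ((N : ℝ) + 1) * e = 1 := mul_one_div_cancel (by positivity)
  have := hstep (N + 1) (by push_cast; exact h1.le)
  push_cast at this
  rwa [h1, one_smul] at this

/-- The same subdivision, walking down from `x`: every step loses at least as much as the first one.
-/
theorem DRSubmodularOn.inner_le_sub {f : Mix d → ℝ} (hf : DRSubmodularOn f (box u))
    {f' x w : Mix d} (hx : x ∈ box u) (hw : ∀ i, 0 ≤ w i) (hxw : x - w ∈ box u)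
    (hg : HasGradientWithinAt f f' (box u) x) : inner ℝ f' w ≤ f x - f (x - w) := by
  have hmem : ∀ t : ℝ, 0 ≤ t → t ≤ 1 → x + t • (-w) ∈ box u := fun t h0 h1 =>
    mem_box_of_le hx
      (fun i => by
        have := (hxw i).1
        simp only [PiLp.add_apply, PiLp.sub_apply, PiLp.smul_apply, PiLp.neg_apply,
          smul_eq_mul] at this ⊢
        linarith [mul_le_of_le_one_left (hw i) h1])
      (fun i => by
        simp only [PiLp.add_apply, PiLp.smul_apply, PiLp.neg_apply, smul_eq_mul]
        linarith [mul_nonneg h0 (hw i)])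
  have hlim := HasGradientWithinAt.tendsto_segment hg hmem
  rw [inner_neg_right] at hlim
  suffices f (x - w) - f x ≤ -inner ℝ f' w by linarith
  refine ge_of_tendsto' hlim fun N => ?_
  set e : ℝ := 1 / ((N : ℝ) + 1) with he
  have he0 : 0 ≤ e := by positivity
  have hstep : ∀ j : ℕ, (j : ℝ) * e ≤ 1 →
      f (x + ((j : ℝ) * e) • (-w)) - f x ≤ j * (f (x + e • (-w)) - f x) := by
    intro j
    induction j with
    | zero => simp
    | succ j ih =>
      intro hj
      push_cast at hj ⊢
      have h1 := hf.sub_le_sub (x := x + (((j : ℝ) + 1) * e) • (-w)) (y := x + e • (-w))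
        (w := e • w) (hmem _ (by positivity) hj)
        (fun i => by
          simp only [PiLp.add_apply, PiLp.smul_apply, PiLp.neg_apply, smul_eq_mul]
          linarith [mul_nonneg (mul_nonneg (Nat.cast_nonneg (α := ℝ) j) he0) (hw i)])
        (fun i => by
          simp only [PiLp.smul_apply, smul_eq_mul]
          exact mul_nonneg he0 (hw i))
        (by rwa [smul_neg, neg_add_cancel_right])
      have h2 := ih (by linarith)
      have h3 : x + (((j : ℝ) + 1) * e) • (-w) + e • w = x + ((j : ℝ) * e) • (-w) := by
        rw [add_mul, add_smul, one_mul, smul_neg, smul_neg]; abel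
      rw [h3, smul_neg e, neg_add_cancel_right, ← smul_neg] at h1
      linarith
  have h1 : ((N : ℝ) + 1) * e = 1 := mul_one_div_cancel (by positivity)
  have := hstep (N + 1) (by push_cast; exact h1.le)
  push_cast at this
  rwa [h1, one_smul, ← sub_eq_add_neg] at this

/-- The gradient inequality that yields the approximation ratio `1 / 2`. -/
theorem DRSubmodularOn.sub_two_mul_le_inner {f : Mix d → ℝ} (hf : DRSubmodularOn f (box u))
    (hmono : MonotoneOnMix f (box u)) (h0 : ∀ x ∈ box u, 0 ≤ f x) {f' x y : Mix d}
    (hx : x ∈ box u) (hy : y ∈ box u) (hg : HasGradientWithinAt f f' (box u) x) :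
    f y - 2 * f x ≤ inner ℝ f' (y - x) := by
  -- With `p` and `m` the positive and negative parts of `y - x`, the points `x + p` and `x - m` are
  -- the join and the meet of `x` and `y`. Concavity along `p` and along `m` gives `f (x ∨ y) + f (x
  -- ∧ y) - 2 f x` as a lower bound; monotonicity handles the join and nonnegativity the meet.
  set p : Mix d := WithLp.toLp 2 fun i => max (y i - x i) 0 with hp
  set m : Mix d := WithLp.toLp 2 fun i => max (x i - y i) 0 with hm
  have hpi : ∀ i, p i = max (y i - x i) 0 := fun i => rfl
  have hmi : ∀ i, m i = max (x i - y i) 0 := fun i => rfl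
  have hpm : y - x = p - m := by
    ext i
    simp only [PiLp.sub_apply, hpi, hmi]
    rcases le_total (y i) (x i) with h | h
    · rw [max_eq_right (by linarith), max_eq_left (by linarith)]; ring
    · rw [max_eq_left (by linarith), max_eq_right (by linarith)]; ring
  have hxp : x + p ∈ box u := by
    intro i
    have : (x + p) i = max (y i) (x i) := by
      simp only [PiLp.add_apply, hpi]
      rcases le_total (y i) (x i) with h | h
      · rw [max_eq_right (by linarith), max_eq_right h]; ring
      · rw [max_eq_left (by linarith), max_eq_left h]; ring
    rw [this]
    rcases max_choice (y i) (x i) with h | h <;> rw [h]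
    · exact hy i
    · exact hx i
  have hxm : x - m ∈ box u := by
    refine mem_box_of_le hx (fun i => ?_) fun i => ?_ <;> simp only [PiLp.sub_apply, hmi]
    · rcases le_total (x i) (y i) with h | h
      · rw [max_eq_right (by linarith)]; linarith [(hx i).1]
      · rw [max_eq_left (by linarith)]; linarith [(hy i).1]
    · linarith [le_max_right (x i - y i) 0]
  have h1 := hf.sub_le_inner hx (fun i => le_max_right _ _) hxp hg
  have h2 := hf.inner_le_sub hx (fun i => le_max_right _ _) hxm hg
  have h3 : f y ≤ f (x + p) := hmono y hy _ hxp fun i => by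
    simp only [PiLp.add_apply, hpi]
    linarith [le_max_left (y i - x i) 0]
  rw [hpm, inner_sub_right]
  linarith [h0 _ hxm]

/-- A lower quadratic bound for functions whose gradient is one-sided Lipschitz. -/
theorem sub_le_of_inner_grad_sub_ge {f : Mix d → ℝ} {f' : Mix d → Mix d} {S X : Set (Mix d)}
    {K : ℝ} (hX : Convex ℝ X) (hXS : X ⊆ S)
    (hg : ∀ x ∈ X, HasGradientWithinAt f (f' x) S x)
    (hK : ∀ x ∈ X, ∀ z ∈ X, -(K * ‖z - x‖ ^ 2) ≤ inner ℝ (f' z - f' x) (z - x))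
    {x y : Mix d} (hx : x ∈ X) (hy : y ∈ X) :
    f x + inner ℝ (f' x) (y - x) - K / 2 * ‖y - x‖ ^ 2 ≤ f y := by
  have hmem : ∀ t ∈ Set.Icc (0 : ℝ) 1, x + t • (y - x) ∈ X := fun t ht =>
    hX.add_smul_sub_mem hx hy ht
  have hγ : ∀ t : ℝ, HasDerivAt (fun t : ℝ => x + t • (y - x)) (y - x) t := fun t => by
    simpa using ((hasDerivAt_id t).smul_const (y - x)).const_add x
  have hφ : ∀ t ∈ Set.Icc (0 : ℝ) 1, HasDerivWithinAt (fun t : ℝ => f (x + t • (y - x)))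
      (inner ℝ (f' (x + t • (y - x))) (y - x)) (Set.Icc 0 1) t := by
    intro t ht
    have := (hg _ (hmem t ht)).hasFDerivWithinAt.comp_hasDerivWithinAt t
      (hγ t).hasDerivWithinAt (s := Set.Icc (0 : ℝ) 1) (fun s hs => hXS (hmem s hs))
    exact this
  -- Removing the tangent line and adding the quadratic term makes the restriction to the segment
  -- nondecreasing, by the one-sided Lipschitz hypothesis.
  have hψ : ∀ t ∈ Set.Icc (0 : ℝ) 1, HasDerivWithinAt
      (fun t : ℝ => f (x + t • (y - x)) - t * inner ℝ (f' x) (y - x) +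
        K / 2 * ‖y - x‖ ^ 2 * t ^ 2)
      (inner ℝ (f' (x + t • (y - x))) (y - x) - inner ℝ (f' x) (y - x) +
        K / 2 * ‖y - x‖ ^ 2 * (2 * t)) (Set.Icc 0 1) t := by
    intro t ht
    refine ((hφ t ht).sub ?_).add ?_
    · simpa using ((hasDerivAt_id t).mul_const (inner ℝ (f' x) (y - x))).hasDerivWithinAt
    · simpa using (((hasDerivAt_id t).pow 2).const_mul (K / 2 * ‖y - x‖ ^ 2)).hasDerivWithinAt
  have hmono := monotoneOn_of_hasDerivWithinAt_nonneg (convex_Icc (0 : ℝ) 1)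
    (fun t ht => (hψ t ht).continuousWithinAt)
    (fun t ht => (hψ t (interior_subset ht)).mono interior_subset) (fun t ht => ?_)
  · have := hmono (Set.left_mem_Icc.2 zero_le_one) (Set.right_mem_Icc.2 zero_le_one) zero_le_one
    simp only [zero_smul, add_zero, zero_mul, sub_zero, one_smul, one_mul, one_pow, mul_one,
      add_sub_cancel, ne_eq, OfNat.ofNat_ne_zero, not_false_eq_true, zero_pow, mul_zero] at this
    linarith
  · rw [interior_Icc] at ht
    have h1 := hK x hx _ (hmem t ⟨ht.1.le, ht.2.le⟩)
    rw [add_sub_cancel_left, norm_smul, inner_smul_right, inner_sub_left, mul_pow,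
      Real.norm_of_nonneg ht.1.le] at h1
    have h2 : 0 ≤ t * (inner ℝ (f' (x + t • (y - x))) (y - x) - inner ℝ (f' x) (y - x) +
        K / 2 * ‖y - x‖ ^ 2 * (2 * t)) := by nlinarith
    exact nonneg_of_mul_nonneg_right h2 ht.1

end Box

namespace Problem

variable {V : Type} [Fintype V] [DecidableEq V] {d : ℕ} (I : Problem V d)

/-! ### The empirical objective -/

/-- The probability that no node of `R` is activated. -/
def miss (R : List V) (x : Mix d) : ℝ := (R.map fun v => 1 - I.h v x).prod

/-- The gradient of `1 - miss R`. -/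
def hitGrad (x : Mix d) : List V → Mix d
  | [] => 0
  | v :: vs => (1 - I.h v x) • hitGrad x vs + I.miss vs x • I.gradh v x

/-- The sum over `Rs` of the probabilities that an RR set is hit. -/
def hits (Rs : List (List V)) (x : Mix d) : ℝ := (Rs.map fun R => 1 - I.miss R x).sum

def hitsGrad (Rs : List (List V)) (x : Mix d) : Mix d := (Rs.map fun R => I.hitGrad x R).sum

/-- The estimate `ĝ` of `g`. -/
def estimate (Rs : List (List V)) (x : Mix d) : ℝ := I.n / Rs.length * I.hits Rs x

def estimateGrad (Rs : List (List V)) (x : Mix d) : Mix d := (I.n / Rs.length) • I.hitsGrad Rs x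

/-- The sum of the `j`-th powers of the sizes. -/
def powSum (j : ℕ) (Rs : List (List V)) : ℝ := (Rs.map fun R => (R.length : ℝ) ^ j).sum

@[simp] theorem miss_nil (x : Mix d) : I.miss [] x = 1 := rfl

theorem miss_cons (v : V) (R : List V) (x : Mix d) :
    I.miss (v :: R) x = (1 - I.h v x) * I.miss R x := by simp [miss]

@[simp] theorem hits_nil (x : Mix d) : I.hits [] x = 0 := rfl

theorem hits_cons (R : List V) (Rs : List (List V)) (x : Mix d) :
    I.hits (R :: Rs) x = (1 - I.miss R x) + I.hits Rs x := by simp [hits]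

@[simp] theorem hitsGrad_nil (x : Mix d) : I.hitsGrad [] x = 0 := rfl

theorem hitsGrad_cons (R : List V) (Rs : List (List V)) (x : Mix d) :
    I.hitsGrad (R :: Rs) x = I.hitGrad x R + I.hitsGrad Rs x := by simp [hitsGrad]

@[simp] theorem powSum_nil (j : ℕ) : powSum j ([] : List (List V)) = 0 := rfl

theorem powSum_cons (j : ℕ) (R : List V) (Rs : List (List V)) :
    powSum j (R :: Rs) = (R.length : ℝ) ^ j + powSum j Rs := by simp [powSum]

theorem powSum_nonneg (j : ℕ) (Rs : List (List V)) : 0 ≤ powSum j Rs :=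
  List.sum_nonneg fun x hx => by
    obtain ⟨R, -, rfl⟩ := List.mem_map.1 hx
    positivity

theorem rrTerm_val (x : Mix d) (R : List V) : ∀ (pre : ℝ) (acc : Mix d),
    (I.rrTerm x R pre acc).val = (I.miss R x, acc + pre • I.hitGrad x R) := by
  induction R with
  | nil => intro pre acc; simp [rrTerm, hitGrad]
  | cons v vs ih =>
    intro pre acc
    simp only [rrTerm, Timed.val_bind, Timed.val_pure, ih, miss_cons, hitGrad]
    refine Prod.ext rfl ?_
    simp only [smul_add, smul_smul, add_assoc]

theorem sumTerms_val (x : Mix d) (Rs : List (List V)) : ∀ acc : Mix d,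
    (I.sumTerms x Rs acc).val = (I.hits Rs x, acc + I.hitsGrad Rs x) := by
  induction Rs with
  | nil => intro acc; simp [sumTerms]
  | cons R Rs ih =>
    intro acc
    simp only [sumTerms, Timed.val_bind, Timed.val_pure, rrTerm_val, ih, hits_cons, hitsGrad_cons]
    refine Prod.ext ?_ ?_
    · simp only; ring
    · simp only [one_smul, add_assoc]

theorem evalObj_val (Rs : List (List V)) (x : Mix d) :
    (I.evalObj Rs x).val = (I.estimate Rs x + I.s x, I.estimateGrad Rs x) := by
  simp [evalObj, sumTerms_val, estimate, estimateGrad, s]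

theorem sizes_val (Rs : List (List V)) : (sizes Rs).val = (powSum 1 Rs, powSum 2 Rs) := by
  induction Rs with
  | nil => simp [sizes]
  | cons R Rs ih =>
    simp only [sizes, Timed.val_bind, Timed.val_pure, ih, powSum_cons]
    refine Prod.ext ?_ ?_ <;> simp only <;> ring

theorem smoothness_eq (Rs : List (List V)) : I.smoothness Rs =
    I.n / Rs.length * (powSum 1 Rs * I.βh + powSum 2 Rs * I.Lh ^ 2) := by
  rw [smoothness, sizes_val]
  ring

theorem n_pos [Nonempty V] : 0 < I.n := by
  unfold n
  exact_mod_cast Fintype.card_pos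

theorem n_nonneg : 0 ≤ I.n := Nat.cast_nonneg _

namespace Assumptions

variable {I} {κ : ℝ} {Th Tc Tprox : ℕ} (A : I.Assumptions κ Th Tc Tprox)

include A

theorem miss_mem {x : Mix d} (hx : x ∈ box I.u) (R : List V) :
    0 ≤ I.miss R x ∧ I.miss R x ≤ 1 := by
  induction R with
  | nil => simp
  | cons v R ih =>
    rw [miss_cons]
    have := A.h_mem v x hx
    exact ⟨mul_nonneg (by linarith [this.2]) ih.1,
      mul_le_one₀ (by linarith [this.1]) ih.1 ih.2⟩

theorem miss_anti {x y : Mix d} (hx : x ∈ box I.u) (hy : y ∈ box I.u) (h : ∀ i, x i ≤ y i)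
    (R : List V) : I.miss R y ≤ I.miss R x := by
  induction R with
  | nil => simp
  | cons v R ih =>
    rw [miss_cons, miss_cons]
    exact mul_le_mul (by linarith [A.h_mono v x hx y hy h]) ih (A.miss_mem hy R).1
      (by linarith [(A.h_mem v x hx).2])

/-- The increment of `1 - (1 - h) * miss` is the increment of `h` times the old `miss`, plus the new
`1 - h` times the decrease of `miss`. Each product has nonnegative factors that are no larger at the
greater point. -/
theorem miss_dr (R : List V) : DRSubmodularOn (fun x => 1 - I.miss R x) (box I.u) := by
  intro x hx y hy hxy i δ hδ hx' hy'
  induction R with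
  | nil => simp
  | cons v R ih =>
    simp only [miss_cons] at ih ⊢
    set x' := x + EuclideanSpace.single i δ
    set y' := y + EuclideanSpace.single i δ
    have hxx' : ∀ j, x j ≤ x' j := le_add_single hδ.le
    have hyy' : ∀ j, y j ≤ y' j := le_add_single hδ.le
    have hxy' : ∀ j, x' j ≤ y' j := add_single_mono hxy i δ
    have a1 := A.h_dr v x hx y hy hxy i δ hδ hx' hy'
    have a2 := A.h_mono v y hy y' hy' hyy'
    have a3 := A.h_mono v x hx x' hx' hxx'
    have a4 := A.miss_anti hx hy hxy R
    have a5 := A.miss_anti hx hx' hxx' R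
    have a6 := A.miss_anti hy hy' hyy' R
    have a7 := A.h_mono v x' hx' y' hy' hxy'
    have m1 : (I.h v y' - I.h v y) * I.miss R y ≤ (I.h v x' - I.h v x) * I.miss R x :=
      mul_le_mul a1 a4 (A.miss_mem hy R).1 (by linarith)
    have m2 : (1 - I.h v y') * (I.miss R y - I.miss R y') ≤
        (1 - I.h v x') * (I.miss R x - I.miss R x') :=
      mul_le_mul (by linarith) (by linarith) (by linarith) (by linarith [(A.h_mem v x' hx').2])
    linarith

theorem hits_nonneg {x : Mix d} (hx : x ∈ box I.u) (Rs : List (List V)) : 0 ≤ I.hits Rs x := by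
  induction Rs with
  | nil => simp
  | cons R Rs ih => rw [hits_cons]; linarith [(A.miss_mem hx R).2]

theorem hits_le {x : Mix d} (hx : x ∈ box I.u) (Rs : List (List V)) :
    I.hits Rs x ≤ Rs.length := by
  induction Rs with
  | nil => simp
  | cons R Rs ih =>
    rw [hits_cons, List.length_cons]
    push_cast
    linarith [(A.miss_mem hx R).1]

theorem hits_mono (Rs : List (List V)) : MonotoneOnMix (I.hits Rs) (box I.u) := by
  intro x hx y hy hxy
  induction Rs with
  | nil => simp
  | cons R Rs ih => rw [hits_cons, hits_cons]; linarith [A.miss_anti hx hy hxy R]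

theorem hits_dr (Rs : List (List V)) : DRSubmodularOn (I.hits Rs) (box I.u) := by
  intro x hx y hy hxy i δ hδ hx' hy'
  induction Rs with
  | nil => simp
  | cons R Rs ih =>
    simp only [hits_cons]
    linarith [A.miss_dr R x hx y hy hxy i δ hδ hx' hy']

theorem estimate_nonneg {x : Mix d} (hx : x ∈ box I.u) (Rs : List (List V)) :
    0 ≤ I.estimate Rs x :=
  mul_nonneg (div_nonneg I.n_nonneg (Nat.cast_nonneg _)) (A.hits_nonneg hx Rs)

theorem estimate_le {x : Mix d} (hx : x ∈ box I.u) (Rs : List (List V)) :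
    I.estimate Rs x ≤ I.n := by
  unfold estimate
  rcases Nat.eq_zero_or_pos Rs.length with h | h
  · simp [h, I.n_nonneg]
  · have h' : (0 : ℝ) < Rs.length := by exact_mod_cast h
    rw [div_mul_eq_mul_div, div_le_iff₀ h']
    exact mul_le_mul_of_nonneg_left (A.hits_le hx Rs) I.n_nonneg

theorem estimate_mono (Rs : List (List V)) : MonotoneOnMix (I.estimate Rs) (box I.u) :=
  fun x hx y hy hxy => mul_le_mul_of_nonneg_left (A.hits_mono Rs x hx y hy hxy)
    (div_nonneg I.n_nonneg (Nat.cast_nonneg _))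

theorem estimate_dr (Rs : List (List V)) : DRSubmodularOn (I.estimate Rs) (box I.u) := by
  intro x hx y hy hxy i δ hδ hx' hy'
  unfold estimate
  rw [← mul_sub, ← mul_sub]
  exact mul_le_mul_of_nonneg_left (A.hits_dr Rs x hx y hy hxy i δ hδ hx' hy')
    (div_nonneg I.n_nonneg (Nat.cast_nonneg _))

theorem hit_hasGradient {x : Mix d} (hx : x ∈ I.dom) (R : List V) :
    HasGradientWithinAt (fun x => 1 - I.miss R x) (I.hitGrad x R) (box I.u) x := by
  induction R with
  | nil =>
    simp only [miss_nil, sub_self, hitGrad]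
    exact hasGradientWithinAt_const _ _ _
  | cons v R ih =>
    rw [hasGradientWithinAt_iff_hasFDerivWithinAt] at ih ⊢
    have hv := (A.h_grad v x hx).hasFDerivWithinAt
    have := ((hv.const_sub 1).mul (ih.const_sub 1)).const_sub 1
    simp only [sub_sub_cancel] at this
    simp only [miss_cons]
    refine this.congr_fderiv ?_
    ext w
    simp [hitGrad, add_comm]

theorem estimate_hasGradient {x : Mix d} (hx : x ∈ I.dom) (Rs : List (List V)) :
    HasGradientWithinAt (I.estimate Rs) (I.estimateGrad Rs x) (box I.u) x := by
  have h1 : HasGradientWithinAt (I.hits Rs) (I.hitsGrad Rs x) (box I.u) x := by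
    induction Rs with
    | nil => exact hasGradientWithinAt_const _ _ _
    | cons R Rs ih =>
      rw [hasGradientWithinAt_iff_hasFDerivWithinAt] at ih ⊢
      have := (A.hit_hasGradient hx R).hasFDerivWithinAt.add ih
      rw [hitsGrad_cons, map_add]
      refine this.congr (fun y _ => ?_) ?_ <;> simp [hits_cons]
  rw [hasGradientWithinAt_iff_hasFDerivWithinAt] at h1 ⊢
  have := h1.const_mul (I.n / Rs.length)
  refine this.congr_fderiv ?_
  ext w
  simp [estimateGrad]

theorem dom_convex : Convex ℝ I.dom := A.c_convex.1

/-- The Lipschitz bound holds only on the convex set `𝒟`, which may have empty interior, so `‖∇h‖`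
itself is not controlled. Difference quotients along a segment in `𝒟` control the component in the
direction `z - x`, and this is all the later estimates use. -/
theorem abs_inner_gradh_le {x z : Mix d} (hx : x ∈ I.dom) (hz : z ∈ I.dom) (v : V) :
    |inner ℝ (I.gradh v x) (z - x)| ≤ I.Lh * ‖z - x‖ := by
  have hmem : ∀ t : ℝ, 0 ≤ t → t ≤ 1 → x + t • (z - x) ∈ I.dom := fun t h0 h1 =>
    A.dom_convex.add_smul_sub_mem hx hz ⟨h0, h1⟩
  have hlim := (HasGradientWithinAt.tendsto_segment (A.h_grad v x hx)
    fun t h0 h1 => A.dom_subset (hmem t h0 h1)).abs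
  refine le_of_tendsto' hlim fun N => ?_
  have hN : (0 : ℝ) < (N : ℝ) + 1 := by positivity
  have h1 := A.h_lipschitz v _ (hmem (1 / ((N : ℝ) + 1)) (by positivity) (by
    rw [div_le_one hN]; linarith [(Nat.cast_nonneg N : (0 : ℝ) ≤ N)])) _ hx
  rw [add_sub_cancel_left, norm_smul, Real.norm_of_nonneg (by positivity)] at h1
  rw [abs_mul, abs_of_pos hN]
  calc _ ≤ ((N : ℝ) + 1) * (I.Lh * (1 / ((N : ℝ) + 1) * ‖z - x‖)) := by gcongr
    _ = _ := by field_simp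

theorem abs_miss_sub_le {x z : Mix d} (hx : x ∈ I.dom) (hz : z ∈ I.dom) (R : List V) :
    |I.miss R z - I.miss R x| ≤ R.length * (I.Lh * ‖z - x‖) := by
  induction R with
  | nil => simp
  | cons v R ih =>
    have e : I.miss (v :: R) z - I.miss (v :: R) x =
        (1 - I.h v z) * (I.miss R z - I.miss R x) + (I.h v x - I.h v z) * I.miss R x := by
      rw [miss_cons, miss_cons]; ring
    have h1 := A.h_mem v z (A.dom_subset hz)
    have h2 := A.miss_mem (A.dom_subset hx) R
    have h3 := A.h_lipschitz v x hx z hz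
    rw [norm_sub_rev] at h3
    rw [e, List.length_cons]
    push_cast
    refine (abs_add_le _ _).trans ?_
    rw [abs_mul, abs_mul, abs_of_nonneg h2.1, abs_of_nonneg (by linarith [h1.2] : 0 ≤ 1 - I.h v z)]
    have h4 : (1 - I.h v z) * |I.miss R z - I.miss R x| ≤ |I.miss R z - I.miss R x| :=
      mul_le_of_le_one_left (abs_nonneg _) (by linarith [h1.1])
    have h5 : |I.h v x - I.h v z| * I.miss R x ≤ |I.h v x - I.h v z| :=
      mul_le_of_le_one_right (abs_nonneg _) h2.2
    linarith

theorem abs_inner_hitGrad_le {x z : Mix d} (hx : x ∈ I.dom) (hz : z ∈ I.dom) (R : List V) :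
    |inner ℝ (I.hitGrad x R) (z - x)| ≤ R.length * (I.Lh * ‖z - x‖) := by
  induction R with
  | nil => simp [hitGrad]
  | cons v R ih =>
    have h1 := A.h_mem v x (A.dom_subset hx)
    have h2 := A.miss_mem (A.dom_subset hx) R
    have h3 := A.abs_inner_gradh_le hx hz v
    rw [hitGrad, inner_add_left, real_inner_smul_left, real_inner_smul_left, List.length_cons]
    push_cast
    refine (abs_add_le _ _).trans ?_
    rw [abs_mul, abs_mul, abs_of_nonneg h2.1, abs_of_nonneg (by linarith [h1.2] : 0 ≤ 1 - I.h v x)]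
    have h4 : (1 - I.h v x) * |inner ℝ (I.hitGrad x R) (z - x)| ≤
        |inner ℝ (I.hitGrad x R) (z - x)| :=
      mul_le_of_le_one_left (abs_nonneg _) (by linarith [h1.1])
    have h5 : I.miss R x * |inner ℝ (I.gradh v x) (z - x)| ≤ |inner ℝ (I.gradh v x) (z - x)| :=
      mul_le_of_le_one_left (abs_nonneg _) h2.2
    linarith

/-- Splitting off one node splits the variation of the gradient into four terms: the inductive one,
one with `βh`, and two mixed terms of size `|R| Lh² ‖z - x‖²` each, which fit since `(r + 1)² ≥ r² +
2 r`. Only the quadratic form along `z - x` is estimated, which suffices for the descent lemma. -/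
theorem abs_inner_hitGrad_sub_le {x z : Mix d} (hx : x ∈ I.dom) (hz : z ∈ I.dom) (R : List V) :
    |inner ℝ (I.hitGrad z R - I.hitGrad x R) (z - x)| ≤
      (R.length * I.βh + (R.length : ℝ) ^ 2 * I.Lh ^ 2) * ‖z - x‖ ^ 2 := by
  induction R with
  | nil => simp [hitGrad]
  | cons v R ih =>
    set D := ‖z - x‖
    have hD : 0 ≤ D := norm_nonneg _
    have h1 := A.h_mem v z (A.dom_subset hz)
    have h2 := A.miss_mem (A.dom_subset hz) R
    have h3 := A.abs_inner_gradh_le hx hz v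
    have h4 := A.h_lipschitz v x hx z hz
    rw [norm_sub_rev] at h4
    have h5 := A.abs_inner_hitGrad_le hx hz R
    have h6 := A.abs_miss_sub_le hx hz R
    have h7 : |inner ℝ (I.gradh v z - I.gradh v x) (z - x)| ≤ I.βh * D * D :=
      (abs_real_inner_le_norm _ _).trans (mul_le_mul_of_nonneg_right (A.h_smooth v z hz x hx) hD)
    have e : inner ℝ (I.hitGrad z (v :: R) - I.hitGrad x (v :: R)) (z - x) =
        (1 - I.h v z) * inner ℝ (I.hitGrad z R - I.hitGrad x R) (z - x) +
        (I.h v x - I.h v z) * inner ℝ (I.hitGrad x R) (z - x) +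
        I.miss R z * inner ℝ (I.gradh v z - I.gradh v x) (z - x) +
        (I.miss R z - I.miss R x) * inner ℝ (I.gradh v x) (z - x) := by
      simp only [hitGrad, inner_sub_left, inner_add_left, real_inner_smul_left]
      ring
    have b1 : |(1 - I.h v z) * inner ℝ (I.hitGrad z R - I.hitGrad x R) (z - x)| ≤
        (R.length * I.βh + (R.length : ℝ) ^ 2 * I.Lh ^ 2) * D ^ 2 := by
      rw [abs_mul, abs_of_nonneg (by linarith [h1.2] : 0 ≤ 1 - I.h v z)]
      exact (mul_le_of_le_one_left (abs_nonneg _) (by linarith [h1.1])).trans ih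
    have b2 : |(I.h v x - I.h v z) * inner ℝ (I.hitGrad x R) (z - x)| ≤
        (I.Lh * D) * (R.length * (I.Lh * D)) := by
      rw [abs_mul]
      exact mul_le_mul h4 h5 (abs_nonneg _) (mul_nonneg A.Lh_pos.le hD)
    have b3 : |I.miss R z * inner ℝ (I.gradh v z - I.gradh v x) (z - x)| ≤ I.βh * D * D := by
      rw [abs_mul, abs_of_nonneg h2.1]
      exact (mul_le_of_le_one_left (abs_nonneg _) h2.2).trans h7
    have b4 : |(I.miss R z - I.miss R x) * inner ℝ (I.gradh v x) (z - x)| ≤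
        (R.length * (I.Lh * D)) * (I.Lh * D) := by
      rw [abs_mul]
      exact mul_le_mul h6 h3 (abs_nonneg _)
        (mul_nonneg (Nat.cast_nonneg _) (mul_nonneg A.Lh_pos.le hD))
    rw [e, List.length_cons]
    push_cast
    have t := (abs_add_le _ _).trans (add_le_add ((abs_add_le _ _).trans
      (add_le_add ((abs_add_le _ _).trans (add_le_add b1 b2)) b3)) b4)
    refine t.trans ?_
    have : 0 ≤ I.Lh ^ 2 * D ^ 2 := by positivity
    nlinarith

theorem abs_inner_estimateGrad_sub_le {x z : Mix d} (hx : x ∈ I.dom) (hz : z ∈ I.dom)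
    (Rs : List (List V)) :
    |inner ℝ (I.estimateGrad Rs z - I.estimateGrad Rs x) (z - x)| ≤
      I.smoothness Rs * ‖z - x‖ ^ 2 := by
  have h1 : |inner ℝ (I.hitsGrad Rs z - I.hitsGrad Rs x) (z - x)| ≤
      (powSum 1 Rs * I.βh + powSum 2 Rs * I.Lh ^ 2) * ‖z - x‖ ^ 2 := by
    induction Rs with
    | nil => simp
    | cons R Rs ih =>
      rw [hitsGrad_cons, hitsGrad_cons, add_sub_add_comm, inner_add_left, powSum_cons, powSum_cons]
      refine (abs_add_le _ _).trans ((add_le_add (A.abs_inner_hitGrad_sub_le hx hz R) ih).trans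
        (le_of_eq ?_))
      ring
  have hn : 0 ≤ I.n / Rs.length := div_nonneg I.n_nonneg (Nat.cast_nonneg _)
  rw [estimateGrad, estimateGrad, ← smul_sub, real_inner_smul_left, abs_mul, abs_of_nonneg hn,
    smoothness_eq, mul_assoc]
  exact mul_le_mul_of_nonneg_left h1 hn

/-! ### The proximal gradient method -/

theorem s_nonneg {x : Mix d} (hx : x ∈ I.feasible) : 0 ≤ I.s x :=
  mul_nonneg A.lam_nonneg (sub_nonneg.2 hx.2)

theorem s_le {x : Mix d} (hx : x ∈ I.feasible) : I.s x ≤ I.lam * I.k :=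
  mul_le_mul_of_nonneg_left (by linarith [A.c_nonneg x hx.1]) A.lam_nonneg

/-- First-order optimality of the proximal point without differentiating `c`: compare `p` with `p +
t (y - p)`, use concavity of `s`, divide by `t` and let `t → 0`. -/
theorem prox_three_point {η : ℝ} (hη : 0 < η) (z : Mix d) {y : Mix d} (hy : y ∈ I.feasible) :
    η * (I.s y - I.s (I.prox η z)) + inner ℝ (z - I.prox η z) (y - I.prox η z) ≤ 0 := by
  set p := I.prox η z
  have hp : p ∈ I.feasible := A.prox_mem η hη z
  set a := η * (I.s y - I.s p) + inner ℝ (z - p) (y - p)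
  have key : ∀ t : ℝ, 0 < t → t ≤ 1 → a ≤ t * (1 / 2 * ‖y - p‖ ^ 2) := by
    intro t h0 h1
    have hc : I.c (p + t • (y - p)) ≤ (1 - t) * I.c p + t * I.c y := by
      have := A.c_convex.2 hp.1 hy.1 (sub_nonneg.2 h1) h0.le (by ring)
      rw [show (1 - t) • p + t • y = p + t • (y - p) by
        rw [sub_smul, one_smul, smul_sub]; abel] at this
      simpa using this
    have hmem : p + t • (y - p) ∈ I.feasible :=
      ⟨A.dom_convex.add_smul_sub_mem hp.1 hy.1 ⟨h0.le, h1⟩, hc.trans (by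
        have h2 : (1 - t) * I.c p ≤ (1 - t) * I.k :=
          mul_le_mul_of_nonneg_left hp.2 (sub_nonneg.2 h1)
        have h3 : t * I.c y ≤ t * I.k := mul_le_mul_of_nonneg_left hy.2 h0.le
        linarith)⟩
    have hs : (1 - t) * I.s p + t * I.s y ≤ I.s (p + t • (y - p)) := by
      unfold s
      have := mul_le_mul_of_nonneg_left hc A.lam_nonneg
      linarith
    have hmin := A.prox_min η hη z _ hmem
    have hnorm : ‖z - (p + t • (y - p))‖ ^ 2 =
        ‖z - p‖ ^ 2 - 2 * (t * inner ℝ (z - p) (y - p)) + t ^ 2 * ‖y - p‖ ^ 2 := by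
      rw [← sub_sub, norm_sub_sq_real, real_inner_smul_right, norm_smul, mul_pow,
        Real.norm_of_nonneg h0.le]
    change -η * I.s p + 1 / 2 * ‖z - p‖ ^ 2 ≤ _ at hmin
    rw [hnorm] at hmin
    have hs' := mul_le_mul_of_nonneg_left hs hη.le
    have : t * a ≤ t * (t * (1 / 2 * ‖y - p‖ ^ 2)) := by
      simp only [a]
      linarith
    exact le_of_mul_le_mul_left this h0
  have hlim : Tendsto (fun N : ℕ => 1 / ((N : ℝ) + 1) * (1 / 2 * ‖y - p‖ ^ 2)) atTop (𝓝 0) := by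
    have := (tendsto_one_div_add_atTop_nhds_zero_nat (𝕜 := ℝ)).mul_const (1 / 2 * ‖y - p‖ ^ 2)
    rwa [zero_mul] at this
  refine ge_of_tendsto' hlim fun N => key _ (by positivity) ?_
  rw [div_le_one (by positivity)]
  linarith [(Nat.cast_nonneg N : (0 : ℝ) ≤ N)]

/-- Progress of one proximal gradient step. -/
theorem step_progress {Rs : List (List V)} (hM : 0 < I.smoothness Rs) {x y : Mix d}
    (hx : x ∈ I.feasible) (hy : y ∈ I.feasible) {p : Mix d}
    (hp : p = I.prox (1 / I.smoothness Rs) (x + (1 / I.smoothness Rs) • I.estimateGrad Rs x)) :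
    I.estimate Rs y + I.s y ≤ I.estimate Rs x + (I.estimate Rs p + I.s p) +
      I.smoothness Rs / 2 * (‖x - y‖ ^ 2 - ‖p - y‖ ^ 2) := by
  set M := I.smoothness Rs
  set v := I.estimateGrad Rs x
  have hpf : p ∈ I.feasible := hp ▸ A.prox_mem _ (by positivity) _
  have h1 := A.prox_three_point (one_div_pos.2 hM) (x + (1 / M) • v) hy
  rw [← hp] at h1
  have h2 : inner ℝ (x + (1 / M) • v - p) (y - p) =
      1 / 2 * (‖x - p‖ ^ 2 + ‖p - y‖ ^ 2 - ‖x - y‖ ^ 2) +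
        1 / M * (inner ℝ v (y - x) - inner ℝ v (p - x)) := by
    have e1 : x + (1 / M) • v - p = (x - p) + (1 / M) • v := by abel
    have e2 : ‖x - y‖ ^ 2 = ‖x - p‖ ^ 2 - 2 * inner ℝ (x - p) (y - p) + ‖y - p‖ ^ 2 := by
      rw [← norm_sub_sq_real, sub_sub_sub_cancel_right]
    rw [e1, inner_add_left, real_inner_smul_left, ← inner_sub_right, sub_sub_sub_cancel_right, e2,
      norm_sub_rev p y]
    ring
  rw [h2] at h1
  have h3 : I.s y - I.s p + (inner ℝ v (y - x) - inner ℝ v (p - x)) +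
      M / 2 * (‖x - p‖ ^ 2 + ‖p - y‖ ^ 2 - ‖x - y‖ ^ 2) ≤ 0 := by
    have := mul_le_mul_of_nonneg_left h1 hM.le
    have e : M * (1 / M) = 1 := mul_one_div_cancel hM.ne'
    have e' : M * (1 / M * (I.s y - I.s p) +
        (1 / 2 * (‖x - p‖ ^ 2 + ‖p - y‖ ^ 2 - ‖x - y‖ ^ 2) +
          1 / M * (inner ℝ v (y - x) - inner ℝ v (p - x)))) =
        (M * (1 / M)) * (I.s y - I.s p) +
        (M / 2 * (‖x - p‖ ^ 2 + ‖p - y‖ ^ 2 - ‖x - y‖ ^ 2) +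
          (M * (1 / M)) * (inner ℝ v (y - x) - inner ℝ v (p - x))) := by ring
    rw [e', e] at this
    linarith
  -- The descent inequality bounds the value at `p` from below by the linear model at `x`, and `h5`
  -- bounds that model at `y` from below by the value at `y` minus twice the value at `x`. With the
  -- step size `1 / M`, the terms `‖x - p‖²` cancel.
  have h4 := sub_le_of_inner_grad_sub_ge A.dom_convex A.dom_subset
    (fun x hx => A.estimate_hasGradient hx Rs)
    (fun x hx z hz => (abs_le.1 (A.abs_inner_estimateGrad_sub_le hx hz Rs)).1) hx.1 hpf.1
  have h5 := (A.estimate_dr Rs).sub_two_mul_le_inner (A.estimate_mono Rs)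
    (fun x hx => A.estimate_nonneg hx Rs) (A.dom_subset hx.1) (A.dom_subset hy.1)
    (A.estimate_hasGradient hx.1 Rs)
  rw [norm_sub_rev p x] at h4
  change I.estimate Rs x + inner ℝ v (p - x) - M / 2 * ‖x - p‖ ^ 2 ≤ _ at h4
  change _ ≤ inner ℝ v (y - x) at h5
  linarith

/-- Telescoping `step_progress`: the squared distances to `y` collapse. Since `s ≥ 0`, each step
contributes at most two objective values of iterates, both bounded by the final best value; this is
the factor 2. -/
theorem iterate_spec {Rs : List (List V)} (hM : 0 < I.smoothness Rs) {y : Mix d}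
    (hy : y ∈ I.feasible) : ∀ (t : ℕ) (x : Mix d) (best : Mix d × ℝ), x ∈ I.feasible →
    I.estimate Rs x + I.s x ≤ best.2 → best.2 ≤ I.n + I.lam * I.k →
    best.2 ≤ (I.iterate (1 / I.smoothness Rs) Rs t x (I.estimateGrad Rs x) best).val.2 ∧
    (I.iterate (1 / I.smoothness Rs) Rs t x (I.estimateGrad Rs x) best).val.2 ≤
      I.n + I.lam * I.k ∧
    t * (I.estimate Rs y + I.s y) ≤
      2 * t * (I.iterate (1 / I.smoothness Rs) Rs t x (I.estimateGrad Rs x) best).val.2 +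
        I.smoothness Rs / 2 * ‖x - y‖ ^ 2 := by
  intro t
  induction t with
  | zero =>
    intro x best _ _ hb
    simp only [iterate, Timed.val_pure, le_refl, true_and, hb, Nat.cast_zero, zero_mul, mul_zero,
      zero_add]
    positivity
  | succ t ih =>
    intro x best hx h1 h2
    simp only [iterate, Timed.val_bind, evalObj_val]
    set p := I.prox (1 / I.smoothness Rs) (x + (1 / I.smoothness Rs) • I.estimateGrad Rs x) with hp
    have hpf : p ∈ I.feasible := A.prox_mem _ (by positivity) _
    set best' := if best.2 < I.estimate Rs p + I.s p then (p, I.estimate Rs p + I.s p) else best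
      with hbest'
    have hb1 : best.2 ≤ best'.2 := by rw [hbest']; split_ifs with h <;> linarith
    have hb2 : I.estimate Rs p + I.s p ≤ best'.2 := by
      rw [hbest']; split_ifs with h
      · exact le_rfl
      · exact not_lt.1 h
    have hb3 : best'.2 ≤ I.n + I.lam * I.k := by
      rw [hbest']; split_ifs with h
      · exact add_le_add (A.estimate_le (A.dom_subset hpf.1) Rs) (A.s_le hpf)
      · exact h2
    obtain ⟨i1, i2, i3⟩ := ih p best' hpf hb2 hb3
    refine ⟨hb1.trans i1, i2, ?_⟩
    have h3 := A.step_progress hM hx hy hp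
    have h4 := A.s_nonneg hx
    push_cast
    linarith

/-- The guarantee of the proximal gradient algorithm. -/
theorem proxGrad_spec {Rs : List (List V)} (hM : 0 < I.smoothness Rs) {a : ℝ} (ha : 0 < a) :
    (I.proxGrad Rs a).val.2 ≤ I.n + I.lam * I.k ∧ ∀ y ∈ I.feasible,
      I.estimate Rs y + I.s y ≤ 2 * (I.proxGrad Rs a).val.2 + 2 / 3 * a := by
  simp only [proxGrad, Timed.val_bind, evalObj_val]
  set T := ⌈3 * I.smoothness Rs * I.Δ ^ 2 / (4 * a)⌉₊
  have hΔ := A.Δ_pos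
  have hT : 3 * I.smoothness Rs * I.Δ ^ 2 / (4 * a) ≤ T := Nat.le_ceil _
  have hT0 : (0 : ℝ) < T := lt_of_lt_of_le (by positivity) hT
  have hb := add_le_add (A.estimate_le (A.dom_subset A.x₀_mem.1) Rs) (A.s_le A.x₀_mem)
  refine ⟨(A.iterate_spec hM A.x₀_mem T I.x₀ (I.x₀, _) A.x₀_mem le_rfl hb).2.1, fun y hy => ?_⟩
  have h := (A.iterate_spec hM hy T I.x₀ (I.x₀, _) A.x₀_mem le_rfl hb).2.2
  have hd : ‖I.x₀ - y‖ ^ 2 ≤ I.Δ ^ 2 := by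
    gcongr
    exact A.dist_le _ A.x₀_mem _ hy
  rw [div_le_iff₀ (by positivity)] at hT
  -- The prescribed number of iterations makes the telescoped distance term, averaged over the
  -- iterations, at most `2 a / 3`.
  have h2 : I.smoothness Rs / 2 * ‖I.x₀ - y‖ ^ 2 ≤ T * (2 / 3 * a) := by
    have := mul_le_mul_of_nonneg_left hd hM.le
    linarith
  refine le_of_mul_le_mul_left ?_ hT0
  linarith

end Assumptions

end Problem

namespace Problem

open TriggeringModel

variable {V : Type} [Fintype V] [DecidableEq V] {d : ℕ} (I : Problem V d)

/-! ### Running time of the gradient algorithm -/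

theorem length_le_powSum (j : ℕ) {Rs : List (List V)} (h : ∀ R ∈ Rs, R ≠ []) :
    (Rs.length : ℝ) ≤ powSum j Rs := by
  induction Rs with
  | nil => simp
  | cons R Rs ih =>
    rw [powSum_cons, List.length_cons]
    have h1 : 0 < R.length := List.length_pos_iff.2 (h R (by simp))
    have h2 : (1 : ℝ) ≤ R.length := by exact_mod_cast h1
    have h3 := one_le_pow₀ h2 (n := j)
    push_cast
    linarith [ih fun R hR => h R (by simp [hR])]

theorem pow_mul_add_le (j : ℕ) {x y : ℝ} (hx : 0 ≤ x) (hy : 0 ≤ y) :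
    x ^ j * y + x * y ^ j ≤ x ^ (j + 1) + y ^ (j + 1) := by
  have : 0 ≤ (x ^ j - y ^ j) * (x - y) := by
    rcases le_total x y with h | h
    · exact mul_nonneg_of_nonpos_of_nonpos (sub_nonpos.2 (pow_le_pow_left₀ hx h j))
        (sub_nonpos.2 h)
    · exact mul_nonneg (sub_nonneg.2 (pow_le_pow_left₀ hy h j)) (sub_nonneg.2 h)
  rw [pow_succ, pow_succ]
  linarith

/-- Chebyshev's sum inequality: `r ↦ r ^ j` and `r ↦ r` are similarly ordered, which
`pow_mul_add_le` expresses for a pair. It replaces a product of dependent empirical moments by a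
single one. -/
theorem powSum_mul_powSum_one_le (j : ℕ) (Rs : List (List V)) :
    powSum j Rs * powSum 1 Rs ≤ Rs.length * powSum (j + 1) Rs := by
  induction Rs with
  | nil => simp
  | cons R Rs ih =>
    have h : (R.length : ℝ) ^ j * powSum 1 Rs + R.length * powSum j Rs ≤
        Rs.length * (R.length : ℝ) ^ (j + 1) + powSum (j + 1) Rs := by
      clear ih
      induction Rs with
      | nil => simp
      | cons Q Rs ih =>
        rw [powSum_cons, powSum_cons, powSum_cons, List.length_cons]
        have := pow_mul_add_le j (Nat.cast_nonneg (α := ℝ) R.length)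
          (Nat.cast_nonneg (α := ℝ) Q.length)
        push_cast
        linarith
    rw [powSum_cons, powSum_cons, powSum_cons, List.length_cons, pow_one]
    push_cast
    have e : (R.length : ℝ) ^ j * R.length = (R.length : ℝ) ^ (j + 1) := (pow_succ _ _).symm
    nlinarith

theorem sum_length_cast (Rs : List (List V)) :
    (((Rs.map List.length).sum : ℕ) : ℝ) = powSum 1 Rs := by
  induction Rs with
  | nil => simp
  | cons R Rs ih => rw [powSum_cons, List.map_cons, List.sum_cons, Nat.cast_add, ih, pow_one]

theorem sizes_time_le {Rs : List (List V)} (h : ∀ R ∈ Rs, R ≠ []) :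
    (sizes Rs).time ≤ 5 * (Rs.map List.length).sum := by
  induction Rs with
  | nil => simp [sizes]
  | cons R Rs ih =>
    have h1 : 0 < R.length := List.length_pos_iff.2 (h R (by simp))
    have := ih fun R hR => h R (by simp [hR])
    simp only [sizes, Timed.time_bind, Timed.time_pure, time_tick, List.map_cons, List.sum_cons]
    omega

namespace Assumptions

variable {I} {κ : ℝ} {Th Tc Tprox : ℕ} (A : I.Assumptions κ Th Tc Tprox)

include A

theorem rrTerm_time_le (x : Mix d) (R : List V) : ∀ (pre : ℝ) (acc : Mix d),
    (I.rrTerm x R pre acc).time ≤ R.length * (3 * Th + 5) := by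
  induction R with
  | nil => intro pre acc; simp [rrTerm]
  | cons v R ih =>
    intro pre acc
    have h1 := A.timeH_le v x
    have h2 := A.gradSize_le v x
    have h3 := ih (pre * (1 - I.h v x)) acc
    simp only [rrTerm, Timed.time_bind, Timed.time_pure, time_tick, List.length_cons, add_mul,
      one_mul] at h3 ⊢
    omega

theorem sumTerms_time_le (x : Mix d) {Rs : List (List V)} (h : ∀ R ∈ Rs, R ≠ []) :
    ∀ acc : Mix d, (I.sumTerms x Rs acc).time ≤ (Rs.map List.length).sum * (3 * Th + 8) := by
  induction Rs with
  | nil => intro acc; simp [sumTerms]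
  | cons R Rs ih =>
    intro acc
    have h1 : 0 < R.length := List.length_pos_iff.2 (h R (by simp))
    have h2 := ih (fun R hR => h R (by simp [hR])) (I.rrTerm x R 1 acc).val.2
    have h3 := A.rrTerm_time_le x R 1 acc
    simp only [sumTerms, Timed.time_bind, Timed.time_pure, time_tick, List.map_cons,
      List.sum_cons, add_mul] at h2 ⊢
    have : R.length * (3 * Th + 8) = R.length * (3 * Th + 5) + 3 * R.length := by ring
    omega

theorem evalObj_time_le (x : Mix d) {Rs : List (List V)} (h : ∀ R ∈ Rs, R ≠ [])
    (h0 : 1 ≤ (Rs.map List.length).sum) :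
    (I.evalObj Rs x).time ≤ (Rs.map List.length).sum * (3 * Th + 14) + Tc + 2 * Tprox := by
  have h1 := A.sumTerms_time_le x h 0
  have h2 := A.timeC_le x
  have h3 := (A.dim_le 0 0).trans (A.timeProx_le 0 0)
  simp only [evalObj, Timed.time_bind, Timed.time_pure, time_tick]
  have : (Rs.map List.length).sum * (3 * Th + 14) =
      (Rs.map List.length).sum * (3 * Th + 8) + 6 * (Rs.map List.length).sum := by ring
  omega

theorem iterate_time_le (η : ℝ) {Rs : List (List V)} (h : ∀ R ∈ Rs, R ≠ [])
    (h0 : 1 ≤ (Rs.map List.length).sum) : ∀ (t : ℕ) (x v : Mix d) (best : Mix d × ℝ),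
    (I.iterate η Rs t x v best).time ≤
      t * ((Rs.map List.length).sum * (3 * Th + 16) + Tc + 6 * Tprox) := by
  intro t
  induction t with
  | zero => intro x v best; simp [iterate]
  | succ t ih =>
    intro x v best
    have h1 := A.timeProx_le η (x + η • v)
    have h2 := A.evalObj_time_le (I.prox η (x + η • v)) h h0
    have h3 := (A.dim_le 0 0).trans (A.timeProx_le 0 0)
    have h4 := ih (I.prox η (x + η • v)) (I.evalObj Rs (I.prox η (x + η • v))).val.2
      (if best.2 < (I.evalObj Rs (I.prox η (x + η • v))).val.1
        then (I.prox η (x + η • v), (I.evalObj Rs (I.prox η (x + η • v))).val.1) else best)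
    simp only [iterate, Timed.time_bind, time_tick, add_mul, one_mul] at h4 ⊢
    have : (Rs.map List.length).sum * (3 * Th + 16) =
        (Rs.map List.length).sum * (3 * Th + 14) + 2 * (Rs.map List.length).sum := by ring
    omega

/-- The total size of the sample, being at least 1, pays for all constant overheads, and `Tprox`
pays for the `d` steps of vector operations. The 39 comes from the start-up: 5 for reading sizes, 20
fixed steps and 14 for the first evaluation. -/
theorem proxGrad_time_le_nat {Rs : List (List V)} (h : ∀ R ∈ Rs, R ≠ [])
    (h0 : 1 ≤ (Rs.map List.length).sum) (a : ℝ) :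
    (I.proxGrad Rs a).time ≤ (⌈3 * I.smoothness Rs * I.Δ ^ 2 / (4 * a)⌉₊ + 1) *
      (39 * ((Rs.map List.length).sum * (1 + Th) + (Tc + Tprox))) := by
  have h1 := sizes_time_le h
  have h2 := A.evalObj_time_le I.x₀ h h0
  have h3 := (A.dim_le 0 0).trans (A.timeProx_le 0 0)
  have h4 := A.iterate_time_le (1 / I.smoothness Rs) h h0
    ⌈3 * I.smoothness Rs * I.Δ ^ 2 / (4 * a)⌉₊ I.x₀ (I.evalObj Rs I.x₀).val.2
    (I.x₀, (I.evalObj Rs I.x₀).val.1)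
  simp only [proxGrad, Timed.time_bind, time_tick]
  set T := ⌈3 * I.smoothness Rs * I.Δ ^ 2 / (4 * a)⌉₊
  set N := (Rs.map List.length).sum
  have h5 : N * (3 * Th + 16) + Tc + 6 * Tprox ≤ 39 * (N * (1 + Th) + (Tc + Tprox)) := by
    nlinarith [Nat.zero_le (N * Th)]
  have h6 : 25 * N + N * (3 * Th + 14) + Tc + 3 * Tprox ≤
      39 * (N * (1 + Th) + (Tc + Tprox)) := by
    nlinarith [Nat.zero_le (N * Th)]
  have h7 := Nat.mul_le_mul_left T h5
  rw [add_mul, one_mul]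
  omega

theorem smoothness_ge {b : ℝ} (hb : b ≤ I.βh + I.Lh ^ 2) {Rs : List (List V)}
    (h : ∀ R ∈ Rs, R ≠ []) (h0 : 0 < Rs.length) : I.n * b ≤ I.smoothness Rs := by
  have hl : (0 : ℝ) < Rs.length := by exact_mod_cast h0
  have h1 := mul_le_mul_of_nonneg_right (length_le_powSum 1 h) A.βh_nonneg
  have h2 := mul_le_mul_of_nonneg_right (length_le_powSum 2 h) (sq_nonneg I.Lh)
  rw [smoothness_eq, div_mul_eq_mul_div, le_div_iff₀ hl, mul_assoc]
  refine mul_le_mul_of_nonneg_left ?_ I.n_nonneg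
  have := mul_le_mul_of_nonneg_right hb hl.le
  linarith

/-- The form matters more than the constant: for a sample of fixed length the right side is linear
in the power sums, so its mean follows without any concentration. -/
theorem proxGrad_time_le {b Δ₀ : ℝ} (hb0 : 0 < b) (hb : b ≤ I.βh + I.Lh ^ 2) (hΔ : I.Δ ≤ Δ₀)
    {Rs : List (List V)} (h : ∀ R ∈ Rs, R ≠ []) (h0 : 0 < Rs.length) {a : ℝ} (ha0 : 0 < a)
    (ha : a ≤ I.n) :
    ((I.proxGrad Rs a).time : ℝ) ≤ 39 * (Δ₀ ^ 2 + 2 / b) / a *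
      ((1 + Th) * I.n * (powSum 2 Rs * I.βh + powSum 3 Rs * I.Lh ^ 2) +
        (Tc + Tprox) * (I.n / Rs.length) * (powSum 1 Rs * I.βh + powSum 2 Rs * I.Lh ^ 2)) := by
  have hn : 0 < I.n := lt_of_lt_of_le two_pos A.two_le_n
  have hl : (0 : ℝ) < Rs.length := by exact_mod_cast h0
  have hS := length_le_powSum 1 h
  have hN : 1 ≤ (Rs.map List.length).sum := by
    have : (0 : ℝ) < ((Rs.map List.length).sum : ℕ) := by rw [sum_length_cast]; linarith
    exact_mod_cast this
  set M := I.smoothness Rs with hM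
  have hMb : I.n * b ≤ M := A.smoothness_ge hb h h0
  have hM0 : 0 < M := lt_of_lt_of_le (by positivity) hMb
  -- Here the lower bound on `βh + Lh²` enters: `M / a` is bounded below, so the initial evaluation
  -- and the rounding of the iteration count cost only a constant factor.
  have h1 : b ≤ M / a := by
    rw [le_div_iff₀ ha0]
    nlinarith
  have h2 : (2 : ℝ) ≤ 2 / b * (M / a) := by
    rw [div_mul_eq_mul_div, le_div_iff₀ hb0]
    linarith
  have hΔ2 : I.Δ ^ 2 ≤ Δ₀ ^ 2 := pow_le_pow_left₀ A.Δ_pos.le hΔ 2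
  have h3 : ((⌈3 * M * I.Δ ^ 2 / (4 * a)⌉₊ : ℕ) : ℝ) + 1 ≤ (Δ₀ ^ 2 + 2 / b) * (M / a) := by
    have := Nat.ceil_lt_add_one (a := 3 * M * I.Δ ^ 2 / (4 * a)) (by positivity)
    have e : 3 * M * I.Δ ^ 2 / (4 * a) = 3 / 4 * (I.Δ ^ 2 * (M / a)) := by field_simp
    have h4 : I.Δ ^ 2 * (M / a) ≤ Δ₀ ^ 2 * (M / a) :=
      mul_le_mul_of_nonneg_right hΔ2 (by positivity)
    have h5 : 0 ≤ I.Δ ^ 2 * (M / a) := by positivity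
    rw [e] at this ⊢
    linarith
  have h4 : ((I.proxGrad Rs a).time : ℝ) ≤ ((⌈3 * M * I.Δ ^ 2 / (4 * a)⌉₊ : ℕ) + 1) *
      (39 * (powSum 1 Rs * (1 + Th) + (Tc + Tprox))) := by
    rw [← sum_length_cast]
    exact_mod_cast A.proxGrad_time_le_nat h hN a
  have hp1 := powSum_nonneg 1 Rs
  -- The smoothness constant carries a division by the sample size, which is cancelled by the factor
  -- from Chebyshev's inequality.
  have h5 : M * powSum 1 Rs ≤ I.n * (powSum 2 Rs * I.βh + powSum 3 Rs * I.Lh ^ 2) := by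
    have e : M * powSum 1 Rs = I.n * (powSum 1 Rs * powSum 1 Rs * I.βh +
        powSum 2 Rs * powSum 1 Rs * I.Lh ^ 2) / Rs.length := by
      rw [hM, smoothness_eq]; ring
    rw [e, div_le_iff₀ hl]
    have i1 := mul_le_mul_of_nonneg_right (powSum_mul_powSum_one_le 1 Rs) A.βh_nonneg
    have i2 := mul_le_mul_of_nonneg_right (powSum_mul_powSum_one_le 2 Rs) (sq_nonneg I.Lh)
    norm_num at i1 i2
    have i3 := mul_le_mul_of_nonneg_left (add_le_add i1 i2) hn.le
    linarith
  calc _ ≤ _ := h4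
    _ ≤ (Δ₀ ^ 2 + 2 / b) * (M / a) * (39 * (powSum 1 Rs * (1 + Th) + (Tc + Tprox))) := by
        gcongr
    _ = 39 * (Δ₀ ^ 2 + 2 / b) / a * ((1 + Th) * (M * powSum 1 Rs) + (Tc + Tprox) * M) := by
        field_simp
    _ ≤ 39 * (Δ₀ ^ 2 + 2 / b) / a *
      ((1 + Th) * (I.n * (powSum 2 Rs * I.βh + powSum 3 Rs * I.Lh ^ 2)) + (Tc + Tprox) * M) := by
        gcongr
    _ = _ := by rw [hM, smoothness_eq]; ring

end Assumptions

variable [Nonempty V]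

theorem rrMoment_nonneg (j : ℕ) : 0 ≤ I.rrMoment j :=
  Finset.sum_nonneg fun _ _ => mul_nonneg (by positivity)
    (Finset.sum_nonneg fun _ _ => mul_nonneg ENNReal.toReal_nonneg (by positivity))

theorem mean_powSum_le (θ j : ℕ) :
    ((I.genRRs θ).mean fun Rs _ => ENNReal.ofReal (powSum j Rs)) ≤
      ENNReal.ofReal (θ * I.rrMoment j) := by
  have e : ∀ Rs : List (List V), ENNReal.ofReal (powSum j Rs) =
      (Rs.map fun R => (R.length : ℝ≥0∞) ^ j).sum := by
    intro Rs
    induction Rs with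
    | nil => simp
    | cons R Rs ih =>
      rw [powSum_cons, ENNReal.ofReal_add (by positivity) (powSum_nonneg j Rs), ih, List.map_cons,
        List.sum_cons, ENNReal.ofReal_pow (by positivity), ENNReal.ofReal_natCast]
  simp only [e]
  rw [mean_genRRs_sum, ENNReal.ofReal_mul (Nat.cast_nonneg _), ENNReal.ofReal_natCast]
  gcongr
  exact I.mean_genRR_length_pow j

theorem mean_linear_powSum_le (θ : ℕ) {a₁ a₂ a₃ : ℝ} (h₁ : 0 ≤ a₁) (h₂ : 0 ≤ a₂) (h₃ : 0 ≤ a₃) :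
    ((I.genRRs θ).mean fun Rs _ =>
      ENNReal.ofReal (a₁ * powSum 1 Rs + a₂ * powSum 2 Rs + a₃ * powSum 3 Rs)) ≤
      ENNReal.ofReal (θ * (a₁ * I.rrMoment 1 + a₂ * I.rrMoment 2 + a₃ * I.rrMoment 3)) := by
  have p1 := fun Rs : List (List V) => powSum_nonneg 1 Rs
  have p2 := fun Rs : List (List V) => powSum_nonneg 2 Rs
  have p3 := fun Rs : List (List V) => powSum_nonneg 3 Rs
  have r1 := I.rrMoment_nonneg 1
  have r2 := I.rrMoment_nonneg 2
  have r3 := I.rrMoment_nonneg 3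
  have e : ∀ Rs : List (List V),
      ENNReal.ofReal (a₁ * powSum 1 Rs + a₂ * powSum 2 Rs + a₃ * powSum 3 Rs) =
      ENNReal.ofReal a₁ * ENNReal.ofReal (powSum 1 Rs) +
      ENNReal.ofReal a₂ * ENNReal.ofReal (powSum 2 Rs) +
      ENNReal.ofReal a₃ * ENNReal.ofReal (powSum 3 Rs) := fun Rs => by
    rw [ENNReal.ofReal_add (by have := p1 Rs; have := p2 Rs; positivity)
      (mul_nonneg h₃ (p3 Rs)), ENNReal.ofReal_add (mul_nonneg h₁ (p1 Rs)) (mul_nonneg h₂ (p2 Rs)),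
      ENNReal.ofReal_mul h₁, ENNReal.ofReal_mul h₂, ENNReal.ofReal_mul h₃]
  simp only [e, Prog.mean_add, Prog.mean_const_mul]
  have e' : (θ : ℝ) * (a₁ * I.rrMoment 1 + a₂ * I.rrMoment 2 + a₃ * I.rrMoment 3) =
      a₁ * (θ * I.rrMoment 1) + a₂ * (θ * I.rrMoment 2) + a₃ * (θ * I.rrMoment 3) := by ring
  rw [e', ENNReal.ofReal_add (by positivity) (by positivity),
    ENNReal.ofReal_add (by positivity) (by positivity), ENNReal.ofReal_mul h₁,
    ENNReal.ofReal_mul h₂, ENNReal.ofReal_mul h₃]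
  gcongr <;> exact I.mean_powSum_le θ _

/-- The mean time of the gradient algorithm on freshly sampled RR sets. -/
theorem Assumptions.mean_proxGrad_time_le {κ : ℝ} {Th Tc Tprox : ℕ}
    (A : I.Assumptions κ Th Tc Tprox) {b Δ₀ : ℝ} (hb0 : 0 < b)
    (hb : b ≤ I.βh + I.Lh ^ 2) (hΔ : I.Δ ≤ Δ₀) {θ : ℕ} (hθ : 0 < θ) {a : ℝ} (ha0 : 0 < a)
    (ha : a ≤ I.n) :
    ((I.genRRs θ).mean fun Rs _ => ((I.proxGrad Rs a).time : ℝ≥0∞)) ≤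
      ENNReal.ofReal (39 * (Δ₀ ^ 2 + 2 / b) / a *
        ((1 + Th) * I.n * θ * (I.rrMoment 2 * I.βh + I.rrMoment 3 * I.Lh ^ 2) +
          (Tc + Tprox) * (I.rrMoment 1 * I.n * I.βh + I.rrMoment 2 * I.n * I.Lh ^ 2))) := by
  have hn := I.n_pos
  have hβ := A.βh_nonneg
  have hθ' : (0 : ℝ) < θ := by exact_mod_cast hθ
  set K := 39 * (Δ₀ ^ 2 + 2 / b) / a
  have hK : 0 ≤ K := by positivity
  refine (I.mean_genRRs_mono θ (G := fun Rs _ => ENNReal.ofReal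
    (K * ((Tc + Tprox) * (I.n / θ) * I.βh) * powSum 1 Rs +
      K * ((1 + Th) * I.n * I.βh + (Tc + Tprox) * (I.n / θ) * I.Lh ^ 2) * powSum 2 Rs +
      K * ((1 + Th) * I.n * I.Lh ^ 2) * powSum 3 Rs)) fun Rs _ h1 h2 => ?_).trans
    ((I.mean_linear_powSum_le θ (by positivity) (by positivity) (by positivity)).trans
      (ENNReal.ofReal_le_ofReal (le_of_eq ?_)))
  · rw [← ENNReal.ofReal_natCast]
    refine ENNReal.ofReal_le_ofReal ?_
    refine (A.proxGrad_time_le hb0 hb hΔ h2 (by omega) ha0 ha).trans (le_of_eq ?_)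
    rw [h1]
    ring
  · field_simp
    ring

/-! ### Concentration -/

/-- The chord of the convex function `exp (-x)` over `[0, 1]`, with `exp (-1) ≤ 2 / 5`. -/
theorem exp_neg_le {x : ℝ} (h0 : 0 ≤ x) (h1 : x ≤ 1) : Real.exp (-x) ≤ 1 - 3 / 5 * x := by
  have h := convexOn_exp.2 (Set.mem_univ 0) (Set.mem_univ (-1 : ℝ)) (sub_nonneg.2 h1) h0 (by ring)
  have he : Real.exp (-1) ≤ 2 / 5 := by
    rw [Real.exp_neg, inv_le_comm₀ (Real.exp_pos _) (by norm_num)]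
    have := Real.exp_one_gt_d9
    norm_num at this ⊢
    linarith
  simp only [smul_eq_mul, mul_zero, zero_add, Real.exp_zero, mul_one, mul_neg] at h
  nlinarith

/-- Chernoff's lower tail with the fixed exponent `-1`: Markov's inequality for `exp (-hits)`, whose
mean is a product by independence, and each factor is at most `exp (-(3 / 5) p)` with `p` the
hitting probability. -/
theorem Assumptions.hits_tail {κ : ℝ} {Th Tc Tprox : ℕ} (A : I.Assumptions κ Th Tc Tprox)
    {x : Mix d} (hx : x ∈ box I.u) (θ : ℕ) (Q : ℝ) :
    ((I.genRRs θ).mean fun Rs _ => if I.hits Rs x ≤ Q then 1 else 0) ≤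
      ENNReal.ofReal (Real.exp (Q - 3 / 5 * θ * (I.g x / I.n))) := by
  have hn := I.n_pos
  have hprod : ∀ (T : V → Finset V) (v : V),
      I.miss (I.search T (Fintype.card V) [v] [v]).val x = ∏ u ∈ rrSet T v, (1 - I.h u x) := by
    intro T v
    obtain ⟨h1, h2, -⟩ := I.search_root_spec T v
    rw [← h2, List.prod_toFinset _ h1]
    rfl
  have hp : I.g x / I.n = I.rootMean fun T v => 1 - ∏ u ∈ rrSet T v, (1 - I.h u x) := by
    rw [g_eq, mul_div_cancel_left₀ _ hn.ne']
  have h1 : (I.genRR.mean fun R _ => ENNReal.ofReal (Real.exp (-(1 - I.miss R x)))) ≤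
      ENNReal.ofReal (Real.exp (-(3 / 5 * (I.g x / I.n)))) := by
    refine (I.mean_genRR_le _
      (fun T v => Real.exp (-(1 - ∏ u ∈ rrSet T v, (1 - I.h u x))))
      (fun T v => (Real.exp_pos _).le) fun T _ v => ?_).trans (ENNReal.ofReal_le_ofReal ?_)
    · simp only [hprod, le_refl]
    · have h2 := I.rootMean_mono (f := fun T v => Real.exp (-(1 - ∏ u ∈ rrSet T v, (1 - I.h u x))))
        (f' := fun T v => 1 + -(3 / 5) * (1 - ∏ u ∈ rrSet T v, (1 - I.h u x))) fun T v => by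
          rw [← hprod]
          have := A.miss_mem hx (I.search T (Fintype.card V) [v] [v]).val
          refine (exp_neg_le (by linarith [this.2]) (by linarith [this.1])).trans (le_of_eq ?_)
          ring
      rw [rootMean_add, rootMean_const, rootMean_const_mul, ← hp] at h2
      refine h2.trans ?_
      have := Real.add_one_le_exp (-(3 / 5 * (I.g x / I.n)))
      linarith
  have h2 : ∀ Rs : List (List V), (if I.hits Rs x ≤ Q then 1 else 0 : ℝ≥0∞) ≤
      ENNReal.ofReal (Real.exp Q) *
        (Rs.map fun R => ENNReal.ofReal (Real.exp (-(1 - I.miss R x)))).prod := by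
    intro Rs
    have e : (Rs.map fun R => ENNReal.ofReal (Real.exp (-(1 - I.miss R x)))).prod =
        ENNReal.ofReal (Real.exp (-I.hits Rs x)) := by
      induction Rs with
      | nil => simp
      | cons R Rs ih =>
        rw [List.map_cons, List.prod_cons, ih, ← ENNReal.ofReal_mul (Real.exp_pos _).le,
          ← Real.exp_add, hits_cons, neg_add]
    rw [e, ← ENNReal.ofReal_mul (Real.exp_pos _).le, ← Real.exp_add]
    split_ifs with h
    · rw [ENNReal.one_le_ofReal, Real.one_le_exp_iff]
      linarith
    · exact zero_le
  refine (Prog.mean_mono _ fun Rs _ => h2 Rs).trans ?_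
  rw [Prog.mean_const_mul, mean_genRRs_prod]
  refine (mul_le_mul_right (pow_le_pow_left' h1 θ) _).trans (le_of_eq ?_)
  rw [← ENNReal.ofReal_pow (Real.exp_pos _).le, ← Real.exp_nat_mul,
    ← ENNReal.ofReal_mul (Real.exp_pos _).le, ← Real.exp_add]
  congr 2
  ring

end Problem

/-! ### Covering numbers -/

-- Scaling and translating one finite `1 / 3`-net of the unit ball refines every ball of radius `3
-- r` into `K` balls of radius `r`; `K` depends on the dimension only.
open Metric in
theorem exists_externalCoveringNumber_third_le (d : ℕ) : ∃ K : ℕ, 1 ≤ K ∧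
    ∀ (A : Set (Mix d)) (r : ℝ≥0), r ≠ 0 →
      externalCoveringNumber r A ≤ K * externalCoveringNumber (3 * r) A := by
  obtain ⟨C, -, hCfin, hC⟩ := exists_finite_isCover_of_isCompact (ε := (1 / 3 : ℝ≥0))
    (by norm_num) (isCompact_closedBall (0 : Mix d) 1)
  have hne : C.Nonempty := hC.nonempty ⟨0, by simp⟩
  refine ⟨C.ncard, (Set.ncard_pos hCfin).2 hne, fun A r hr => ?_⟩
  rw [Set.Finite.cast_ncard_eq hCfin]
  obtain ⟨C', hC', hcard⟩ : ∃ C' : Set (Mix d), IsCover (3 * r) A C' ∧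
      C'.encard = externalCoveringNumber (3 * r) A := by
    have : Nonempty {C' : Set (Mix d) // IsCover (3 * r) A C'} := ⟨⟨A, .refl _ _⟩⟩
    obtain ⟨C', h⟩ := ENat.exists_eq_iInf fun C' : {C' : Set (Mix d) // IsCover (3 * r) A C'} =>
      C'.1.encard
    exact ⟨C'.1, C'.2, by rw [h, externalCoveringNumber, iInf_subtype]⟩
  rw [← hcard]
  have hr0 : (0 : ℝ) < r := by
    have := pos_iff_ne_zero.2 hr
    exact_mod_cast this
  have hcov : IsCover r A ((fun q : Mix d × Mix d => q.2 + (3 * (r : ℝ)) • q.1) '' (C ×ˢ C')) := by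
    rw [isCover_iff_subset_iUnion_closedBall] at hC hC' ⊢
    intro a ha
    obtain ⟨y, hy, hay⟩ := Set.mem_iUnion₂.1 (hC' ha)
    rw [mem_closedBall, dist_eq_norm] at hay
    push_cast at hay
    have hb : (3 * (r : ℝ))⁻¹ • (a - y) ∈ closedBall (0 : Mix d) 1 := by
      rw [mem_closedBall, dist_zero_right, norm_smul, norm_inv,
        Real.norm_of_nonneg (by positivity), inv_mul_le_iff₀ (by positivity)]
      linarith
    obtain ⟨c, hc, hac⟩ := Set.mem_iUnion₂.1 (hC hb)
    rw [mem_closedBall, dist_eq_norm] at hac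
    push_cast at hac
    refine Set.mem_iUnion₂.2 ⟨_, Set.mem_image_of_mem _ (Set.mk_mem_prod hc hy), ?_⟩
    rw [mem_closedBall, dist_eq_norm]
    have e : a - (y + (3 * (r : ℝ)) • c) = (3 * (r : ℝ)) • ((3 * (r : ℝ))⁻¹ • (a - y) - c) := by
      rw [smul_sub, smul_smul, mul_inv_cancel₀ (by positivity), one_smul, sub_sub]
    simp only
    rw [e, norm_smul, Real.norm_of_nonneg (by positivity)]
    calc _ ≤ 3 * (r : ℝ) * (1 / 3) := by gcongr
      _ = r := by ring
  refine hcov.externalCoveringNumber_le_encard.trans ((Set.encard_image_le _ _).trans ?_)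
  rw [Set.encard_prod]

namespace Problem

variable {V : Type} [Fintype V] [DecidableEq V] {d : ℕ} {I : Problem V d}

/-- `ln (n ^ ℓ 𝒩(𝒫, r))` for the radius `r = ε / (6 L)`. -/
def logCover (I : Problem V d) : ℝ :=
  Real.log (I.n ^ I.ℓ * I.covering (I.ε / 3 / (I.L + I.L)))

namespace Assumptions

variable {κ : ℝ} {Th Tc Tprox : ℕ} (A : I.Assumptions κ Th Tc Tprox)

include A

/-- Finiteness is needed before `toNat` may be used, since `toNat` would send an infinite covering
number to zero. -/
theorem externalCoveringNumber_ne_top {r : ℝ≥0} (hr : r ≠ 0) :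
    Metric.externalCoveringNumber r I.feasible ≠ ⊤ := by
  have hb : Bornology.IsBounded I.feasible :=
    (Metric.isBounded_iff).2 ⟨I.Δ, fun x hx y hy => by
      rw [dist_eq_norm]; exact A.dist_le x hx y hy⟩
  obtain ⟨C, -, hfin, hC⟩ := Metric.exists_finite_isCover_of_isCompact_closure hr
    (Bornology.IsBounded.isCompact_closure hb)
  exact ne_top_of_le_ne_top hfin.encard_lt_top.ne hC.externalCoveringNumber_le_encard

theorem one_le_covering {r : ℝ} (hr : 0 < r) : 1 ≤ I.covering r := by
  have h0 : r.toNNReal ≠ 0 := (Real.toNNReal_pos.2 hr).ne'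
  have h1 : 0 < Metric.externalCoveringNumber r.toNNReal I.feasible :=
    Metric.externalCoveringNumber_pos_iff.2 ⟨_, A.x₀_mem⟩
  have h2 := ENat.natCast_toNat (A.externalCoveringNumber_ne_top h0)
  rw [← h2] at h1
  unfold covering
  exact_mod_cast h1

theorem covering_anti {r r' : ℝ} (hr : 0 < r) (h : r ≤ r') : I.covering r' ≤ I.covering r := by
  have h0 : r.toNNReal ≠ 0 := (Real.toNNReal_pos.2 hr).ne'
  unfold covering
  exact Nat.cast_le.2 (ENat.toNat_le_toNat
    (Metric.externalCoveringNumber_anti (Real.toNNReal_le_toNNReal h))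
    (A.externalCoveringNumber_ne_top h0))

theorem covering_le_mul {K : ℕ}
    (hK : ∀ (A : Set (Mix d)) (r : ℝ≥0), r ≠ 0 → Metric.externalCoveringNumber r A ≤
      K * Metric.externalCoveringNumber (3 * r) A) {r : ℝ} (hr : 0 < r) :
    I.covering r ≤ K * I.covering (3 * r) := by
  have h0 : r.toNNReal ≠ 0 := (Real.toNNReal_pos.2 hr).ne'
  have h3 : (3 * r).toNNReal = 3 * r.toNNReal := by
    rw [Real.toNNReal_mul (by norm_num)]; simp
  have h := hK I.feasible r.toNNReal h0
  unfold covering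
  rw [h3]
  rw [← ENat.natCast_toNat (A.externalCoveringNumber_ne_top h0),
    ← ENat.natCast_toNat (A.externalCoveringNumber_ne_top (r := 3 * r.toNNReal) (by simp [h0]))] at h
  exact_mod_cast h

theorem L_pos : 0 < I.L := by
  have h1 := A.two_le_n
  have h2 := A.Lh_pos
  have h3 := mul_nonneg A.lam_nonneg A.Lc_nonneg
  unfold L
  positivity

/-! ### The optimum -/

theorem k_nonneg : 0 ≤ I.k := (A.c_nonneg _ A.x₀_mem.1).trans A.x₀_mem.2

theorem two_le_n_add : 2 ≤ I.n + I.lam * I.k := by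
  linarith [A.two_le_n, mul_nonneg A.lam_nonneg A.k_nonneg]

theorem n_add_le_two_mul : I.n + I.lam * I.k ≤ 2 * I.n := by linarith [A.lam_mul_k_le]

theorem one_le_logb : 1 ≤ Real.logb 2 (I.n + I.lam * I.k) := by
  rw [Real.le_logb_iff_rpow_le (by norm_num) (by linarith [A.two_le_n_add])]
  simpa using A.two_le_n_add

theorem exists_isOpt : ∃ x ∈ I.feasible, I.g x + I.s x = I.OPT ∧
    ∀ y ∈ I.feasible, I.g y + I.s y ≤ I.OPT := by
  obtain ⟨x, hx, h⟩ := A.opt_attained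
  have : IsGreatest ((fun x => I.g x + I.s x) '' I.feasible) (I.g x + I.s x) :=
    ⟨Set.mem_image_of_mem _ hx, by rintro _ ⟨y, hy, rfl⟩; exact h y hy⟩
  have e : I.OPT = I.g x + I.s x := this.csSup_eq
  exact ⟨x, hx, e.symm, fun y hy => e ▸ h y hy⟩

/-- The assumption that the optimum dominates the spread of every single node is used through this
bound: it makes the mean cost of an RR set proportional to the optimum, and gives an optimum of at
least 1. -/
theorem spread_le_OPT (v : V) : I.spread {v} ≤ I.OPT := by
  obtain ⟨x, hx, h⟩ := A.spread_le v
  obtain ⟨_, -, -, hopt⟩ := A.exists_isOpt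
  linarith [hopt x hx, A.s_nonneg hx]

theorem one_le_OPT [Nonempty V] : 1 ≤ I.OPT :=
  (I.one_le_spread_singleton (Classical.arbitrary V)).trans (A.spread_le_OPT _)

theorem OPT_le [Nonempty V] : I.OPT ≤ I.n + I.lam * I.k := by
  obtain ⟨x, hx, h, -⟩ := A.exists_isOpt
  rw [← h, g_eq]
  refine add_le_add (mul_le_of_le_one_right I.n_nonneg ?_) (A.s_le hx)
  refine (I.rootMean_mono (f' := fun _ _ => 1) fun T v => ?_).trans (I.rootMean_const 1).le
  have : 0 ≤ ∏ u ∈ TriggeringModel.rrSet T v, (1 - I.h u x) :=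
    Finset.prod_nonneg fun u _ => by linarith [(A.h_mem u x (A.dom_subset hx.1)).2]
  linarith

/-! ### The guesses and the numbers of RR sets -/

theorem guess_pos (i : ℕ) : 0 < I.guess i := by
  have := A.two_le_n_add
  unfold guess
  positivity

theorem guess_succ (i : ℕ) : I.guess (i + 1) = I.guess i / 2 := by
  unfold guess
  rw [pow_succ, div_div]

theorem two_le_guess {i : ℕ} (h : i ≤ I.numRounds) : 2 ≤ I.guess i := by
  have h1 : ((i : ℝ) + 1) ≤ Real.logb 2 (I.n + I.lam * I.k) := by
    have := Nat.floor_le (sub_nonneg.2 A.one_le_logb)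
    have h' : (i : ℝ) ≤ I.numRounds := by exact_mod_cast h
    unfold numRounds at h'
    linarith
  rw [Real.le_logb_iff_rpow_le (by norm_num) (by linarith [A.two_le_n_add])] at h1
  have h2 : (2 : ℝ) ^ ((i : ℝ) + 1) = 2 ^ i * 2 := by
    rw [Real.rpow_add_one (by norm_num), Real.rpow_natCast]
  unfold guess
  rw [le_div_iff₀ (by positivity)]
  linarith

/-- If all rounds fail, the fallback `LB = 1` is then at most one halving below the scale at which
the loop ends, and it costs no more than one further round up to a constant. -/
theorem guess_last_le : I.guess (I.numRounds + 1) ≤ 2 := by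
  have h1 : Real.logb 2 (I.n + I.lam * I.k) < ((I.numRounds + 2 : ℕ) : ℝ) := by
    have := Nat.lt_floor_add_one (Real.logb 2 (I.n + I.lam * I.k) - 1)
    push_cast
    unfold numRounds
    linarith
  rw [Real.logb_lt_iff_lt_rpow (by norm_num) (by linarith [A.two_le_n_add]),
    Real.rpow_natCast] at h1
  unfold guess
  rw [div_le_iff₀ (by positivity)]
  have : (2 : ℝ) ^ (I.numRounds + 2) = 2 * 2 ^ (I.numRounds + 1) := by ring
  linarith

theorem guess_le (i : ℕ) : I.guess (i + 1) ≤ I.n := by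
  have h1 := A.n_add_le_two_mul
  have h2 : (1 : ℝ) ≤ 2 ^ i := one_le_pow₀ (by norm_num)
  have h3 := I.n_nonneg
  unfold guess
  rw [div_le_iff₀ (by positivity), pow_succ]
  nlinarith

theorem two_le_n_rpow : 2 ≤ I.n ^ I.ℓ := A.two_le_n_add.trans A.n_add_le

theorem logCover_eq : I.logCover =
    Real.log (I.n ^ I.ℓ) + Real.log (I.covering (I.ε / 3 / (I.L + I.L))) := by
  have h1 := A.two_le_n_rpow
  have h2 := A.L_pos
  have h3 := A.ε_pos
  have h4 := A.one_le_covering (r := I.ε / 3 / (I.L + I.L)) (by positivity)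
  exact Real.log_mul (by linarith) (by linarith)

theorem log_two_le_log_n_rpow : Real.log 2 ≤ Real.log (I.n ^ I.ℓ) :=
  Real.log_le_log (by norm_num) A.two_le_n_rpow

theorem log_covering_mem {r : ℝ} (hr : I.ε / 3 / (I.L + I.L) ≤ r) :
    0 ≤ Real.log (I.covering r) ∧
      Real.log (I.covering r) ≤ Real.log (I.covering (I.ε / 3 / (I.L + I.L))) := by
  have h2 := A.L_pos
  have h3 := A.ε_pos
  have hpos : 0 < I.ε / 3 / (I.L + I.L) := by positivity
  have h4 := A.one_le_covering (hpos.trans_le hr)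
  exact ⟨Real.log_nonneg h4, Real.log_le_log (by linarith) (A.covering_anti hpos hr)⟩

theorem log_two_le_logCover : Real.log 2 ≤ I.logCover := by
  rw [A.logCover_eq]
  linarith [(A.log_covering_mem le_rfl).1, A.log_two_le_log_n_rpow]

theorem half_le_logCover : 1 / 2 ≤ I.logCover := by
  linarith [A.log_two_le_logCover, Real.log_two_gt_d9]

theorem ε'_mem : 0 < I.ε' ∧ I.ε' ≤ 1 / 2 * I.ε ∧ I.ε' ^ 2 = 2 / 9 * I.ε ^ 2 := by
  have h := A.ε_pos
  have h1 : 0 < Real.sqrt 2 := by positivity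
  have h2 : Real.sqrt 2 ≤ 3 / 2 := by
    rw [Real.sqrt_le_left (by norm_num)]; norm_num
  have h3 : Real.sqrt 2 ^ 2 = 2 := Real.sq_sqrt (by norm_num)
  unfold ε'
  refine ⟨by positivity, by nlinarith, ?_⟩
  rw [div_pow, mul_pow, h3]; ring

/-- The lower bound feeds the Chernoff exponent. In the upper bound the covering radius is at least
`ε / (6 L)`, so every logarithm is dominated by `logCover`. -/
theorem theta_bounds {i : ℕ} (h1 : 1 ≤ i) (h : i ≤ I.numRounds) :
    12 * I.n ≤ I.theta i * I.guess i ∧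
      (I.theta i : ℝ) ≤ 1945 * I.n * I.logCover / (I.ε ^ 2 * I.guess i) := by
  have hn := A.two_le_n
  have hε := A.ε_pos
  have hε2 := A.ε_lt
  have hL := A.L_pos
  have hx := A.two_le_guess h
  have hxn : I.guess i ≤ I.n := by
    obtain ⟨j, rfl⟩ := Nat.exists_eq_add_of_le' h1
    exact A.guess_le j
  obtain ⟨e1, e2, e3⟩ := A.ε'_mem
  have hcov := A.log_covering_mem (r := I.ε / 3 / I.L * I.guess i) (by
    rw [div_mul_eq_mul_div, div_le_div_iff₀ (by positivity) (by positivity)]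
    nlinarith [mul_pos hε hL])
  have hlog2 := Real.log_two_gt_d9
  have hn2 := A.log_two_le_log_n_rpow
  have hnl : Real.log (I.n ^ I.ℓ) = I.ℓ * Real.log I.n := Real.log_rpow (by linarith) _
  have hX := A.two_le_n_add
  have hloglog0 : 0 ≤ Real.log (Real.logb 2 (I.n + I.lam * I.k)) := Real.log_nonneg A.one_le_logb
  -- A crude bound suffices: `log₂ X ≤ 2 X` and `X ≤ n ^ ℓ`.
  have hloglog : Real.log (Real.logb 2 (I.n + I.lam * I.k)) ≤
      Real.log 2 + Real.log (I.n ^ I.ℓ) := by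
    have h1 : Real.logb 2 (I.n + I.lam * I.k) ≤ 2 * (I.n + I.lam * I.k) := by
      rw [Real.logb, div_le_iff₀ (by linarith)]
      have := Real.log_le_sub_one_of_pos (x := I.n + I.lam * I.k) (by linarith)
      nlinarith
    have h2 := Real.log_le_log (by linarith [A.one_le_logb]) h1
    rw [Real.log_mul (by norm_num) (by linarith)] at h2
    linarith [Real.log_le_log (by linarith) A.n_add_le]
  set Num := Real.log (I.covering (I.ε / 3 / I.L * I.guess i)) + I.ℓ * Real.log I.n + Real.log 2
      + Real.log (Real.logb 2 (I.n + I.lam * I.k)) with hNum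
  have hΛ := A.logCover_eq
  have hN1 : 1.38 ≤ Num := by linarith
  have hN2 : Num ≤ 4 * I.logCover := by linarith [(A.log_covering_mem le_rfl).1]
  have hden : 0 < I.ε' ^ 2 * I.guess i := by positivity
  have hε4 : I.ε ^ 2 ≤ 1 / 4 := by nlinarith
  unfold theta
  rw [← hNum]
  constructor
  · have h1 := Nat.le_ceil (I.n * (2 + 2 / 3 * I.ε') * Num / (I.ε' ^ 2 * I.guess i))
    refine le_trans ?_ (mul_le_mul_of_nonneg_right h1 (by linarith))
    rw [div_mul_eq_mul_div, le_div_iff₀ hden, e3]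
    have h2 : I.n * 2 * 1.38 ≤ I.n * (2 + 2 / 3 * I.ε') * Num := by
      gcongr
      linarith
    have h3 : 12 * I.n * (2 / 9 * I.ε ^ 2 * I.guess i) ≤
        12 * I.n * (2 / 9 * (1 / 4) * I.guess i) := by gcongr
    have h4 := mul_le_mul_of_nonneg_right h2 (by linarith : 0 ≤ I.guess i)
    nlinarith [mul_nonneg (by linarith : 0 ≤ I.n) (by linarith : 0 ≤ I.guess i)]
  · have h1 := Nat.ceil_lt_add_one
      (a := I.n * (2 + 2 / 3 * I.ε') * Num / (I.ε' ^ 2 * I.guess i)) (by positivity)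
    refine h1.le.trans ?_
    have hden' : 0 < I.ε ^ 2 * I.guess i := by positivity
    have h2 : I.n * (2 + 2 / 3 * I.ε') * Num / (I.ε' ^ 2 * I.guess i) ≤
        45 * I.n * I.logCover / (I.ε ^ 2 * I.guess i) := by
      rw [e3, mul_assoc (2 / 9 : ℝ), ← div_div, div_le_div_iff_of_pos_right hden',
        div_le_iff₀ (by norm_num)]
      have : I.n * (2 + 2 / 3 * I.ε') * Num ≤ I.n * (2 + 2 / 3 * (1 / 4)) * (4 * I.logCover) := by
        gcongr
        linarith
      nlinarith [mul_nonneg (by linarith : 0 ≤ I.n) (by linarith [A.half_le_logCover] : 0 ≤ I.logCover)]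
    -- This pays for the ceiling. The generous 1900 gives the rounds the same constant, 1945, as the
    -- final phase.
    have h3 : 1 ≤ 1900 * I.n * I.logCover / (I.ε ^ 2 * I.guess i) := by
      rw [le_div_iff₀ hden']
      have h5 : I.ε ^ 2 * I.guess i ≤ 1 / 4 * I.n := by gcongr
      nlinarith [mul_le_mul_of_nonneg_left A.half_le_logCover (by linarith : 0 ≤ I.n)]
    have h4 : 1945 * I.n * I.logCover / (I.ε ^ 2 * I.guess i) =
        45 * I.n * I.logCover / (I.ε ^ 2 * I.guess i) +
        1900 * I.n * I.logCover / (I.ε ^ 2 * I.guess i) := by ring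
    linarith

/-- Since `ε < 1 / 2`, `α'` is at least `1 / 3` and at most `1 / 2`. The first sample size then
gives `8 · 3 · 81 = 1944`, the second needs only 48, and one more unit pays for the ceiling. The
bound `LB ≤ 2 n` is what makes this unit affordable. -/
theorem final_theta_bounds {LB : ℝ} (h1 : 1 ≤ LB) (h2 : LB ≤ 2 * I.n) :
    0 < ⌈max (I.theta1 LB) (I.theta2 LB)⌉₊ ∧
      ((⌈max (I.theta1 LB) (I.theta2 LB)⌉₊ : ℕ) : ℝ) ≤
        1945 * I.n * I.logCover / (I.ε ^ 2 * LB) := by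
  have hn := A.two_le_n
  have hε := A.ε_pos
  have hε2 := A.ε_lt
  have hL := A.L_pos
  have hcov := A.log_covering_mem (r := I.ε / 3 / (I.L + I.L) * LB) (by
    exact le_mul_of_one_le_right (by positivity) h1)
  have hcov1 := A.one_le_covering (r := I.ε / 3 / (I.L + I.L) * LB) (by positivity)
  have hlog2 := Real.log_two_gt_d9
  have hn2 := A.log_two_le_log_n_rpow
  have hnr := A.two_le_n_rpow
  have hΛ := A.logCover_eq
  have hΛ1 := A.half_le_logCover
  have hlog4 : Real.log 4 = 2 * Real.log 2 := by
    rw [show (4 : ℝ) = 2 ^ 2 by norm_num, Real.log_pow]; norm_num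
  have e1 : Real.log (4 * I.n ^ I.ℓ) = 2 * Real.log 2 + Real.log (I.n ^ I.ℓ) := by
    rw [Real.log_mul (by norm_num) (by linarith), hlog4]
  have e2 : Real.log (4 * I.n ^ I.ℓ * I.covering (I.ε / 3 / (I.L + I.L) * LB)) =
      2 * Real.log 2 + Real.log (I.n ^ I.ℓ) +
        Real.log (I.covering (I.ε / 3 / (I.L + I.L) * LB)) := by
    rw [Real.log_mul (by positivity) (by linarith), e1]
  have b1 : Real.log (4 * I.n ^ I.ℓ) ≤ 3 * I.logCover := by
    rw [e1]; linarith [(A.log_covering_mem le_rfl).1]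
  have b2 : Real.log (4 * I.n ^ I.ℓ * I.covering (I.ε / 3 / (I.L + I.L) * LB)) ≤
      3 * I.logCover := by
    rw [e2]; linarith [(A.log_covering_mem le_rfl).1]
  have hden : 0 < I.ε ^ 2 * LB := by positivity
  have hα1 : 1 / 3 ≤ 1 / 2 - I.ε / 3 := by linarith
  have hα2 : 1 / 2 - I.ε / 3 ≤ 1 / 2 := by linarith
  have hε4 : I.ε ^ 2 ≤ 1 / 4 := by nlinarith
  have hpos1 : 0 < I.theta1 LB := by
    unfold theta1
    rw [e1]
    have : 0 < 2 * Real.log 2 + Real.log (I.n ^ I.ℓ) := by linarith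
    positivity
  have t1 : I.theta1 LB ≤ 1944 * I.n * I.logCover / (I.ε ^ 2 * LB) := by
    unfold theta1
    rw [div_le_div_iff₀ (by positivity) hden]
    have s1 : (1 / 3 : ℝ) ^ 2 ≤ (1 / 2 - I.ε / 3) ^ 2 := by gcongr
    have s2 : 8 * I.n * Real.log (4 * I.n ^ I.ℓ) ≤ 8 * I.n * (3 * I.logCover) := by gcongr
    calc _ ≤ 8 * I.n * (3 * I.logCover) * (I.ε ^ 2 * LB) := by gcongr
      _ = 1944 * I.n * I.logCover * (LB * ((1 / 3) ^ 2 * I.ε ^ 2 / 9)) := by ring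
      _ ≤ _ := by gcongr
  have t2 : I.theta2 LB ≤ 1944 * I.n * I.logCover / (I.ε ^ 2 * LB) := by
    unfold theta2
    have s0 : I.ε / 4 ≤ I.ε / 3 - 1 / 4 * (1 / 2 - I.ε / 3) ^ 2 * (I.ε / 3) := by
      have : (1 / 2 - I.ε / 3) ^ 2 ≤ (1 / 2) ^ 2 := pow_le_pow_left₀ (by linarith) hα2 2
      nlinarith
    have s1 : (I.ε / 4) ^ 2 ≤ (I.ε / 3 - 1 / 4 * (1 / 2 - I.ε / 3) ^ 2 * (I.ε / 3)) ^ 2 := by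
      gcongr
    rw [div_le_div_iff₀ (mul_pos (lt_of_lt_of_le (by positivity) s1) (by linarith)) hden]
    have s2 : 2 * (1 / 2 - I.ε / 3) * I.n *
        Real.log (4 * I.n ^ I.ℓ * I.covering (I.ε / 3 / (I.L + I.L) * LB)) ≤
        2 * (1 / 2) * I.n * (3 * I.logCover) := by
      have : 0 ≤ Real.log (4 * I.n ^ I.ℓ * I.covering (I.ε / 3 / (I.L + I.L) * LB)) := by
        rw [e2]; linarith
      gcongr
    calc _ ≤ 2 * (1 / 2) * I.n * (3 * I.logCover) * (I.ε ^ 2 * LB) := by gcongr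
      _ = 48 * I.n * I.logCover * ((I.ε / 4) ^ 2 * LB) := by ring
      _ ≤ 1944 * I.n * I.logCover * ((I.ε / 4) ^ 2 * LB) := by gcongr; norm_num
      _ ≤ _ := by gcongr
  refine ⟨Nat.ceil_pos.2 (lt_max_of_lt_left hpos1), ?_⟩
  have h3 := Nat.ceil_lt_add_one (hpos1.le.trans (le_max_left (I.theta1 LB) (I.theta2 LB)))
  have h4 : 1 ≤ I.n * I.logCover / (I.ε ^ 2 * LB) := by
    rw [le_div_iff₀ hden]
    have : I.ε ^ 2 * LB ≤ 1 / 4 * (2 * I.n) := by gcongr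
    nlinarith [mul_le_mul_of_nonneg_left hΛ1 (by linarith : 0 ≤ I.n)]
  have h5 : 1945 * I.n * I.logCover / (I.ε ^ 2 * LB) =
      1944 * I.n * I.logCover / (I.ε ^ 2 * LB) + I.n * I.logCover / (I.ε ^ 2 * LB) := by ring
  linarith [max_le t1 t2]

end Assumptions

end Problem

namespace Problem

variable {V : Type} [Fintype V] [DecidableEq V] [Nonempty V] {d : ℕ} (I : Problem V d)

/-! ### One sampling phase -/

/-- The coefficient of `1 / x ^ 2` in the mean cost of a phase at scale `x`. -/
def evalCoeff (Th : ℕ) : ℝ :=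
  (1 + Th) * I.n ^ 2 * (I.rrMoment 2 * I.βh + I.rrMoment 3 * I.Lh ^ 2) * I.logCover / I.ε ^ 3

/-- The coefficient of `1 / x` in the mean cost of a phase at scale `x`. -/
def oracleCoeff (Tc Tprox : ℕ) : ℝ :=
  (I.numEdges + I.n) * I.logCover * I.OPT / I.ε ^ 2 +
    (Tc + Tprox) * (I.rrMoment 1 * I.n * I.βh + I.rrMoment 2 * I.n * I.Lh ^ 2) / I.ε

/-- A constant for the mean cost of a phase. -/
def phaseConst (κ Δ₀ b : ℝ) : ℝ := 1945 * (κ + 49) + 1945 * (117 * (Δ₀ ^ 2 + 2 / b))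

/-- As `(m + n) / n * o ≥ 1` and `θ ≥ 1`, the 40 fixed steps and the one extra step per RR set turn
`κ + 8` into `κ + 49`. -/
theorem sampling_cost_le {κ n m o ε x Λ θ : ℝ} (hκ : 0 ≤ κ) (hn : 0 < n) (hm : 0 ≤ m)
    (ho : 1 ≤ o) (hε : 0 < ε) (hx : 0 < x) (hΛ : 1 / 2 ≤ Λ) (hθ : 1 ≤ θ)
    (hθ' : θ ≤ 1945 * n * Λ / (ε ^ 2 * x)) :
    40 + θ * ((κ + 8) * (m + n) / n * o + 1) ≤
      1945 * (κ + 49) * ((m + n) * Λ * o / ε ^ 2 / x) := by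
  have hmn : 1 ≤ (m + n) / n * o := by
    have : 1 ≤ (m + n) / n := by rw [one_le_div hn]; linarith
    nlinarith
  have s1 : 40 + θ * ((κ + 8) * (m + n) / n * o + 1) ≤ θ * ((κ + 49) * ((m + n) / n * o)) := by
    have e : (κ + 8) * (m + n) / n * o = (κ + 8) * ((m + n) / n * o) := by ring
    have : θ * 1 ≤ θ * ((m + n) / n * o) := by gcongr
    rw [e]
    linarith
  refine s1.trans ((mul_le_mul_of_nonneg_right hθ' (by positivity)).trans (le_of_eq ?_))
  field_simp

/-- One factor `1 / x` comes from the number of RR sets and one from the error `a ≥ ε x / 3`. Steps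
that do not scale with the number of RR sets see only the second, hence the two powers of `x`. -/
theorem gradient_cost_le {D p q y z n ε x Λ θ a : ℝ} (hD : 0 ≤ D) (hp : 0 ≤ p) (hq : 0 ≤ q)
    (hy : 0 ≤ y) (hz : 0 ≤ z) (hn : 0 < n) (hε : 0 < ε) (hx : 0 < x) (hΛ : 0 ≤ Λ)
    (hθ : θ ≤ 1945 * n * Λ / (ε ^ 2 * x)) (ha : ε * x / 3 ≤ a) :
    39 * D / a * (p * n * θ * y + q * z) ≤
      1945 * (117 * D) * (p * n ^ 2 * y * Λ / ε ^ 3 / x ^ 2 + q * z / ε / x) := by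
  have hqz : q * z ≤ 1945 * (q * z) := le_mul_of_one_le_left (by positivity) (by norm_num)
  have h0 : 0 < ε * x / 3 := by positivity
  calc _ ≤ 39 * D / a * (p * n * (1945 * n * Λ / (ε ^ 2 * x)) * y + 1945 * (q * z)) := by
        have : 0 ≤ 39 * D / a := div_nonneg (by positivity) (h0.le.trans ha)
        gcongr
    _ ≤ 39 * D / (ε * x / 3) *
        (p * n * (1945 * n * Λ / (ε ^ 2 * x)) * y + 1945 * (q * z)) := by
        gcongr
    _ = _ := by field_simp; ring

namespace Assumptions

variable {I} {κ : ℝ} {Th Tc Tprox : ℕ} (A : I.Assumptions κ Th Tc Tprox)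

include A

theorem evalCoeff_nonneg : 0 ≤ I.evalCoeff Th := by
  have h1 := I.rrMoment_nonneg 2
  have h2 := I.rrMoment_nonneg 3
  have h3 := A.βh_nonneg
  have h4 := A.half_le_logCover
  have h5 := A.ε_pos
  unfold evalCoeff
  positivity

theorem oracleCoeff_nonneg : 0 ≤ I.oracleCoeff Tc Tprox := by
  have h1 := I.rrMoment_nonneg 1
  have h2 := I.rrMoment_nonneg 2
  have h3 := A.βh_nonneg
  have h4 := A.half_le_logCover
  have h5 := A.ε_pos
  have h6 := A.one_le_OPT
  have h7 := I.n_pos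
  unfold oracleCoeff
  positivity

/-- Serves both the rounds, with `a = ε x / 3`, and the final phase, with `a = ε x`; the overhead 40
covers the 30 steps of a round as well. -/
theorem mean_phase_le {b Δ₀ : ℝ} (hκ : 0 ≤ κ) (hb0 : 0 < b) (hb : b ≤ I.βh + I.Lh ^ 2)
    (hΔ : I.Δ ≤ Δ₀) {θ : ℕ} (hθ : 0 < θ) {x : ℝ} (hx : 0 < x)
    (hθ' : (θ : ℝ) ≤ 1945 * I.n * I.logCover / (I.ε ^ 2 * x)) {a : ℝ} (hax : I.ε * x / 3 ≤ a)
    (ha : a ≤ I.n) :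
    ((I.genRRs θ).mean fun Rs t => 40 + ((t : ℝ≥0∞) + ((I.proxGrad Rs a).time : ℝ≥0∞))) ≤
      ENNReal.ofReal (phaseConst κ Δ₀ b *
        (I.evalCoeff Th / x ^ 2 + I.oracleCoeff Tc Tprox / x)) := by
  have hn := I.n_pos
  have hε := A.ε_pos
  have hΛ := A.half_le_logCover
  have hO := A.one_le_OPT
  have hβ := A.βh_nonneg
  have r1 := I.rrMoment_nonneg 1
  have r2 := I.rrMoment_nonneg 2
  have r3 := I.rrMoment_nonneg 3
  have ha0 : 0 < a := lt_of_lt_of_le (by positivity) hax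
  have hm : (0 : ℝ) ≤ I.numEdges := Nat.cast_nonneg _
  have hθ1 : (1 : ℝ) ≤ θ := by exact_mod_cast hθ
  have hE := I.mean_genRR_time_le hκ A.spread_le_OPT A.timeTrig_le
  have hP := A.mean_proxGrad_time_le I hb0 hb hΔ hθ ha0 ha
  set E := (κ + 8) * (I.numEdges + I.n) / I.n * I.OPT with hEdef
  have hE0 : 0 ≤ E := by positivity
  set P := 39 * (Δ₀ ^ 2 + 2 / b) / a *
        ((1 + Th) * I.n * θ * (I.rrMoment 2 * I.βh + I.rrMoment 3 * I.Lh ^ 2) +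
          (Tc + Tprox) * (I.rrMoment 1 * I.n * I.βh + I.rrMoment 2 * I.n * I.Lh ^ 2)) with hPdef
  have hP0 : 0 ≤ P := by positivity
  rw [Prog.mean_add, Prog.mean_add, Prog.mean_const, mean_genRRs_time]
  have hsum : (40 : ℝ≥0∞) + (θ * ((I.genRR.mean fun _ t => (t : ℝ≥0∞)) + 1) +
      (I.genRRs θ).mean fun Rs _ => ((I.proxGrad Rs a).time : ℝ≥0∞)) ≤
      ENNReal.ofReal (40 + (θ * (E + 1) + P)) := by
    rw [ENNReal.ofReal_add (by norm_num) (by positivity), ENNReal.ofReal_add (by positivity) hP0,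
      ENNReal.ofReal_mul (Nat.cast_nonneg _), ENNReal.ofReal_add hE0 zero_le_one,
      ENNReal.ofReal_natCast, ENNReal.ofReal_one,
      show ENNReal.ofReal 40 = 40 by norm_num]
    gcongr
  refine hsum.trans (ENNReal.ofReal_le_ofReal ?_)
  have b1 : 40 + θ * (E + 1) ≤ 1945 * (κ + 49) *
      ((I.numEdges + I.n) * I.logCover * I.OPT / I.ε ^ 2 / x) :=
    sampling_cost_le hκ hn hm hO hε hx hΛ hθ1 hθ'
  have b2 : P ≤ 1945 * (117 * (Δ₀ ^ 2 + 2 / b)) * (I.evalCoeff Th / x ^ 2 +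
      (Tc + Tprox) * (I.rrMoment 1 * I.n * I.βh + I.rrMoment 2 * I.n * I.Lh ^ 2) / I.ε / x) :=
    gradient_cost_le (by positivity) (by positivity) (by positivity) (by positivity)
      (by positivity) hn hε hx (by linarith) hθ' hax
  have q1 : 0 ≤ I.evalCoeff Th / x ^ 2 := div_nonneg A.evalCoeff_nonneg (by positivity)
  have q2 : 0 ≤ (I.numEdges + I.n) * I.logCover * I.OPT / I.ε ^ 2 / x := by positivity
  have q3 : 0 ≤ (Tc + Tprox) *
    (I.rrMoment 1 * I.n * I.βh + I.rrMoment 2 * I.n * I.Lh ^ 2) / I.ε / x := by positivity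
  have hC1 : 0 ≤ 1945 * (κ + 49) := by positivity
  have hC2 : 0 ≤ 1945 * (117 * (Δ₀ ^ 2 + 2 / b)) := by positivity
  unfold phaseConst oracleCoeff
  rw [add_div, ← add_assoc]
  refine (add_le_add b1 b2).trans ?_
  generalize I.evalCoeff Th / x ^ 2 = u at *
  generalize (I.numEdges + I.n) * I.logCover * I.OPT / I.ε ^ 2 / x = v at *
  generalize (Tc + Tprox) *
    (I.rrMoment 1 * I.n * I.βh + I.rrMoment 2 * I.n * I.Lh ^ 2) / I.ε / x = w at *
  generalize 1945 * (κ + 49) = C₁ at *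
  generalize 1945 * (117 * (Δ₀ ^ 2 + 2 / b)) = C₂ at *
  linarith [mul_nonneg hC1 q1, mul_nonneg hC1 q3, mul_nonneg hC2 q2]

/-! ### The probability that a round does not break the loop -/

/-- With `x_i ≤ OPT / 6`, the exponent is at most `-(3 / 5) θ x_i / n`, and `θ x_i ≥ 12 n` brings it
below `-7`. Only a constant failure probability below `1 / 4` is needed, because the cost at most
quadruples per round. -/
theorem mean_fail_le {i : ℕ} (h1 : 1 ≤ i) (h : i ≤ I.numRounds) (hi : I.guess i ≤ I.OPT / 6)
    {x : Mix d} (hx : x ∈ I.feasible) (hopt : I.g x + I.s x = I.OPT) :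
    ((I.genRRs (I.theta i)).mean fun Rs _ =>
      if I.hits Rs x ≤ I.theta i / I.n * (3 * I.guess i - I.s x) then 1 else 0) ≤
      ENNReal.ofReal (1 / 8) := by
  have hn := I.n_pos
  have hs := A.s_nonneg hx
  have hg := A.two_le_guess h
  refine (A.hits_tail I (A.dom_subset hx.1) _ _).trans (ENNReal.ofReal_le_ofReal ?_)
  have hθ := (A.theta_bounds h1 h).1
  have hθn : 0 ≤ (I.theta i : ℝ) / I.n := by positivity
  have e1 : I.theta i / I.n * (3 * I.guess i - I.s x) - 3 / 5 * I.theta i * (I.g x / I.n) =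
      I.theta i / I.n * (3 * I.guess i - I.s x - 3 / 5 * I.g x) := by ring
  have e2 : I.theta i / I.n * (3 * I.guess i - I.s x - 3 / 5 * I.g x) ≤ -7 := by
    have h2 : 12 ≤ I.theta i / I.n * I.guess i := by
      rw [div_mul_eq_mul_div, le_div_iff₀ hn]; exact hθ
    have h3 : 3 * I.guess i - I.s x - 3 / 5 * I.g x ≤ -(3 / 5) * I.guess i := by linarith
    have h4 := mul_le_mul_of_nonneg_left h3 hθn
    linarith
  rw [e1]
  refine (Real.exp_le_exp.2 e2).trans ?_
  rw [Real.exp_neg, one_div]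
  exact inv_anti₀ (by norm_num) (by linarith [Real.add_one_le_exp (7 : ℝ)])

end Assumptions

/-! ### The whole algorithm -/

/-- The mean time of the final phase. -/
def finalTime (LB : ℝ) : ℝ≥0∞ :=
  (I.genRRs ⌈max (I.theta1 LB) (I.theta2 LB)⌉₊).mean fun Rs t =>
    40 + ((t : ℝ≥0∞) + ((I.proxGrad Rs (I.ε * LB)).time : ℝ≥0∞))

/-- The mean time of the rounds from round `i` on and the final phase, if `j` rounds are left. -/
def totalTime (j i : ℕ) : ℝ≥0∞ := (I.rounds j i).mean fun LB t => (t : ℝ≥0∞) + I.finalTime LB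

theorem expTime_proxGradRIS : I.proxGradRIS.expTime = I.totalTime I.numRounds 1 := by
  rw [Prog.expTime_eq, proxGradRIS, totalTime]
  simp only [Prog.mean_bind, Prog.mean_ofTimed, Prog.mean_pure, time_tick, finalTime]
  congr 1
  funext LB t
  rw [Prog.const_add_mean]
  push_cast
  simp only [add_zero]

theorem totalTime_zero (i : ℕ) : I.totalTime 0 i = I.finalTime 1 := by
  rw [totalTime, rounds, Prog.mean_pure]
  simp

/-- Resampling is what makes the continuation `totalTime j (i + 1)` a constant that does not depend
on the RR sets of this round. -/
theorem totalTime_succ (j i : ℕ) : I.totalTime (j + 1) i =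
    (I.genRRs (I.theta i)).mean fun Rs t =>
      (30 + ((t : ℝ≥0∞) + ((I.proxGrad Rs (I.ε * I.guess i / 3)).time : ℝ≥0∞))) +
      if (1 + I.ε' + I.ε / 3) * I.guess i ≤ (I.proxGrad Rs (I.ε * I.guess i / 3)).val.2
      then I.finalTime ((I.proxGrad Rs (I.ε * I.guess i / 3)).val.2 / (1 + I.ε' + I.ε / 3))
      else I.totalTime j (i + 1) := by
  rw [totalTime, rounds]
  simp only [Prog.mean_bind, Prog.mean_ofTimed, time_tick]
  congr 1
  funext Rs t
  split_ifs with h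
  · simp only [Prog.mean_pure]
    push_cast
    simp only [add_zero]
  · rw [totalTime]
    rw [Prog.const_add_mean]
    push_cast
    simp only [add_assoc]

namespace Assumptions

variable {I} {κ : ℝ} {Th Tc Tprox : ℕ} (A : I.Assumptions κ Th Tc Tprox)

include A

theorem finalTime_le {b Δ₀ : ℝ} (hκ : 0 ≤ κ) (hb0 : 0 < b) (hb : b ≤ I.βh + I.Lh ^ 2)
    (hΔ : I.Δ ≤ Δ₀) {LB : ℝ} (h1 : 1 ≤ LB) (h2 : LB ≤ 2 * I.n) :
    I.finalTime LB ≤ ENNReal.ofReal (phaseConst κ Δ₀ b *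
        (I.evalCoeff Th / LB ^ 2 + I.oracleCoeff Tc Tprox / LB)) := by
  obtain ⟨h3, h4⟩ := A.final_theta_bounds h1 h2
  have hε := A.ε_pos
  have hε2 := A.ε_lt
  have hn := I.n_pos
  have : 0 ≤ I.ε * LB := by positivity
  exact A.mean_phase_le hκ hb0 hb hΔ h3 (by linarith) h4 (by linarith) (by nlinarith)

/-- The factor 2 pays for the round itself and for a final phase started by it. Only a failed round
passes its cost on to the next one. -/
theorem totalTime_succ_le {b Δ₀ : ℝ} (hκ : 0 ≤ κ) (hb0 : 0 < b) (hb : b ≤ I.βh + I.Lh ^ 2)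
    (hΔ : I.Δ ≤ Δ₀) (j : ℕ) {i : ℕ} (h1 : 1 ≤ i) (h : i ≤ I.numRounds) :
    I.totalTime (j + 1) i ≤ ENNReal.ofReal (2 * phaseConst κ Δ₀ b *
        (I.evalCoeff Th / I.guess i ^ 2 + I.oracleCoeff Tc Tprox / I.guess i)) +
      ENNReal.ofReal (if I.guess i ≤ I.OPT / 6 then 1 / 8 else 1) * I.totalTime j (i + 1) := by
  obtain ⟨x, hx, hopt, -⟩ := A.exists_isOpt
  have hn := I.n_pos
  have hε := A.ε_pos
  have hε2 := A.ε_lt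
  have hg := A.two_le_guess h
  have hgn : I.guess i ≤ I.n := by
    obtain ⟨m, rfl⟩ := Nat.exists_eq_add_of_le' h1
    exact A.guess_le m
  obtain ⟨e1, e2, e3⟩ := A.ε'_mem
  obtain ⟨t1, t2⟩ := A.theta_bounds h1 h
  have hθ : 0 < I.theta i := by
    by_contra h0
    have : I.theta i = 0 := by omega
    rw [this] at t1
    simp only [Nat.cast_zero, zero_mul] at t1
    linarith
  set Φ := phaseConst κ Δ₀ b *
    (I.evalCoeff Th / I.guess i ^ 2 + I.oracleCoeff Tc Tprox / I.guess i) with hΦ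
  have hph : 0 ≤ phaseConst κ Δ₀ b := by unfold phaseConst; positivity
  have hΦ0 : 0 ≤ Φ := mul_nonneg hph (add_nonneg
    (div_nonneg A.evalCoeff_nonneg (by positivity))
    (div_nonneg A.oracleCoeff_nonneg (by positivity)))
  have hphase := A.mean_phase_le hκ hb0 hb hΔ hθ (by linarith) t2 (a := I.ε * I.guess i / 3) le_rfl
    (by nlinarith)
  rw [totalTime_succ]
  set Q := I.theta i / I.n * (3 * I.guess i - I.s x) with hQ
  have hstep : ∀ (Rs : List (List V)) (t : ℕ), Rs.length = I.theta i → (∀ R ∈ Rs, R ≠ []) →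
      ((30 + ((t : ℝ≥0∞) + ((I.proxGrad Rs (I.ε * I.guess i / 3)).time : ℝ≥0∞))) +
      if (1 + I.ε' + I.ε / 3) * I.guess i ≤ (I.proxGrad Rs (I.ε * I.guess i / 3)).val.2
      then I.finalTime ((I.proxGrad Rs (I.ε * I.guess i / 3)).val.2 / (1 + I.ε' + I.ε / 3))
      else I.totalTime j (i + 1)) ≤
      ((40 + ((t : ℝ≥0∞) + ((I.proxGrad Rs (I.ε * I.guess i / 3)).time : ℝ≥0∞))) +
        ENNReal.ofReal Φ) + I.totalTime j (i + 1) * if I.hits Rs x ≤ Q then 1 else 0 := by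
    intro Rs t hlen hne
    have hM : 0 < I.smoothness Rs :=
      lt_of_lt_of_le (by positivity) (A.smoothness_ge hb hne (by omega))
    obtain ⟨p1, p2⟩ := A.proxGrad_spec hM (a := I.ε * I.guess i / 3) (by positivity)
    set B := (I.proxGrad Rs (I.ε * I.guess i / 3)).val.2
    rw [add_assoc _ (ENNReal.ofReal Φ)]
    refine add_le_add (by gcongr; norm_num) ?_
    split_ifs with c1 c2 c2
    all_goals try rw [mul_one]
    all_goals try rw [mul_zero]
    -- The loop breaks: the threshold test alone gives `LB ≥ x_i`, whatever the quality of the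
    -- sample, so the final phase costs no more than a phase at scale `x_i`.
    · refine le_trans ?_ le_self_add
      have hc : 0 < 1 + I.ε' + I.ε / 3 := by positivity
      have hLB : I.guess i ≤ B / (1 + I.ε' + I.ε / 3) := by
        rw [le_div_iff₀ hc]; linarith
      refine (A.finalTime_le hκ hb0 hb hΔ (by linarith) ?_).trans (ENNReal.ofReal_le_ofReal ?_)
      · refine (div_le_self (by nlinarith) (by linarith)).trans ?_
        linarith [A.n_add_le_two_mul]
      · have := A.evalCoeff_nonneg
        have := A.oracleCoeff_nonneg
        rw [hΦ]
        gcongr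
    · refine le_trans ?_ le_self_add
      have hc : 0 < 1 + I.ε' + I.ε / 3 := by positivity
      have hLB : I.guess i ≤ B / (1 + I.ε' + I.ε / 3) := by
        rw [le_div_iff₀ hc]; linarith
      refine (A.finalTime_le hκ hb0 hb hΔ (by linarith) ?_).trans (ENNReal.ofReal_le_ofReal ?_)
      · refine (div_le_self (by nlinarith) (by linarith)).trans ?_
        linarith [A.n_add_le_two_mul]
      · have := A.evalCoeff_nonneg
        have := A.oracleCoeff_nonneg
        rw [hΦ]
        gcongr
    · exact le_add_self
    -- The loop continues, so the returned value is below `(1 + ε' + ε / 3) x_i ≤ (17 / 12) x_i`.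
    -- The factor-2 guarantee bounds the empirical objective at the optimal point by `(17 / 6 + 1 /
    -- 9) x_i ≤ 3 x_i`, which is exactly the event whose probability is estimated.
    · exfalso
      apply c2
      have hp := p2 x hx
      rw [not_le] at c1
      have hobj : I.estimate Rs x + I.s x ≤ 3 * I.guess i := by
        have : (1 + I.ε' + I.ε / 3) * I.guess i ≤ (1 + 1 / 4 + 1 / 6) * I.guess i := by
          exact mul_le_mul_of_nonneg_right (by linarith) (by linarith)
        have : I.ε * I.guess i ≤ 1 / 2 * I.guess i := by gcongr
        linarith
      have hθ' : (0 : ℝ) < I.theta i := by exact_mod_cast hθ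
      rw [estimate, hlen] at hobj
      have e : I.hits Rs x = I.theta i / I.n * (I.n / I.theta i * I.hits Rs x) := by
        field_simp
      rw [hQ, e]
      gcongr
      linarith
  refine (I.mean_genRRs_mono _ fun Rs t hl hne => hstep Rs t hl hne).trans ?_
  rw [Prog.mean_add, Prog.mean_add, Prog.mean_const, Prog.mean_const_mul, mul_comm (I.totalTime j (i + 1))]
  have hsplit : ENNReal.ofReal (2 * phaseConst κ Δ₀ b *
      (I.evalCoeff Th / I.guess i ^ 2 + I.oracleCoeff Tc Tprox / I.guess i)) =
      ENNReal.ofReal Φ + ENNReal.ofReal Φ := by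
    rw [← ENNReal.ofReal_add hΦ0 hΦ0, hΦ]; ring_nf
  rw [hsplit]
  gcongr
  split_ifs with hi
  · exact A.mean_fail_le h1 h hi hx hopt
  · rw [ENNReal.ofReal_one, ← Prog.mean_const (I.genRRs (I.theta i)) 1]
    refine Prog.mean_mono _ fun Rs _ => ?_
    simp only [Prog.mean_const]
    split_ifs <;> simp

end Assumptions

/-! ### Summation over the rounds -/

/-- The mean cost of a phase at scale `x`, up to constants. -/
def scaleCost (a c x : ℝ) : ℝ := a / x ^ 2 + c / x

/-- The bound on the remaining mean time at scale `x`, when the optimum is `o`. -/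
def remainingCost (a c o x : ℝ) : ℝ :=
  if x ≤ o / 6 then 4 * scaleCost a c x else 7 * scaleCost a c (o / 12) - 2 * scaleCost a c x

section ScaleCost

variable {a c o x y : ℝ} (ha : 0 ≤ a) (hc : 0 ≤ c)

include ha hc

theorem scaleCost_nonneg (hx : 0 < x) : 0 ≤ scaleCost a c x := by
  unfold scaleCost; positivity

theorem scaleCost_anti (hx : 0 < x) (hxy : x ≤ y) : scaleCost a c y ≤ scaleCost a c x := by
  unfold scaleCost; gcongr

theorem scaleCost_half_le (hx : 0 < x) : scaleCost a c (x / 2) ≤ 4 * scaleCost a c x := by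
  have h1 : scaleCost a c (x / 2) = 4 * (a / x ^ 2) + 2 * (c / x) := by
    unfold scaleCost; field_simp; ring
  have h2 : 0 ≤ c / x := by positivity
  rw [h1]; unfold scaleCost; linarith

theorem two_mul_scaleCost_le (hx : 0 < x) : 2 * scaleCost a c x ≤ scaleCost a c (x / 2) := by
  have h1 : scaleCost a c (x / 2) = 4 * (a / x ^ 2) + 2 * (c / x) := by
    unfold scaleCost; field_simp; ring
  have h2 : 0 ≤ a / x ^ 2 := by positivity
  rw [h1]; unfold scaleCost; linarith

theorem remainingCost_nonneg (ho : 0 < o) (hx : 0 < x) : 0 ≤ remainingCost a c o x := by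
  unfold remainingCost
  split_ifs with h
  · have := scaleCost_nonneg ha hc hx
    linarith
  · have h1 := scaleCost_anti ha hc (x := o / 12) (y := x) (by positivity) (by linarith)
    have h2 := scaleCost_nonneg ha hc hx
    linarith

theorem four_mul_scaleCost_le_remainingCost (ho : 0 < o) (hx : 0 < x) :
    4 * scaleCost a c x ≤ remainingCost a c o x := by
  unfold remainingCost
  split_ifs with h
  · exact le_rfl
  · have h1 := scaleCost_anti ha hc (x := o / 12) (y := x) (by positivity) (by linarith)
    have h2 := scaleCost_nonneg ha hc hx
    linarith

/-- Below `o / 6`, the next scale costs at most four times as much and is reached with probability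
at most `1 / 8`, so `1 + 4 · 4 / 8 = 3 ≤ 4`. Above, the subtracted term makes the geometric growth
of the cost telescope. At the transition the next scale still exceeds `o / 12`, and `7 = 4 + 3`
covers the remaining cost there and the three copies at the current scale. -/
theorem remainingCost_step (ho : 0 < o) (hx : 0 < x) :
    scaleCost a c x + (if x ≤ o / 6 then 1 / 8 else 1) * remainingCost a c o (x / 2) ≤
      remainingCost a c o x := by
  have h0 := scaleCost_nonneg ha hc hx
  have h1 := scaleCost_half_le ha hc hx
  have h2 := two_mul_scaleCost_le ha hc hx
  unfold remainingCost
  by_cases h : x ≤ o / 6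
  · rw [if_pos h, if_pos h, if_pos (by linarith)]
    linarith
  · rw [if_neg h, if_neg h]
    split_ifs with h'
    · have h3 := scaleCost_anti ha hc (x := o / 12) (y := x) (by positivity) (by linarith)
      have h4 := scaleCost_anti ha hc (x := o / 12) (y := x / 2) (by positivity) (by linarith)
      linarith
    · linarith

end ScaleCost

namespace Assumptions

variable {I} {κ : ℝ} {Th Tc Tprox : ℕ} (A : I.Assumptions κ Th Tc Tprox)

include A

/-- `remainingCost` is a supersolution of the recursion in `totalTime_succ_le`, so backward
induction over the rounds applies. -/
theorem totalTime_le {b Δ₀ : ℝ} (hκ : 0 ≤ κ) (hb0 : 0 < b) (hb : b ≤ I.βh + I.Lh ^ 2)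
    (hΔ : I.Δ ≤ Δ₀) : ∀ j i : ℕ, 1 ≤ i → i + j = I.numRounds + 1 →
    I.totalTime j i ≤ ENNReal.ofReal (2 * phaseConst κ Δ₀ b *
      remainingCost (I.evalCoeff Th) (I.oracleCoeff Tc Tprox) I.OPT (I.guess i)) := by
  have ha := A.evalCoeff_nonneg
  have hc := A.oracleCoeff_nonneg
  have hO : 0 < I.OPT := by linarith [A.one_le_OPT]
  have hph : 0 ≤ phaseConst κ Δ₀ b := by unfold phaseConst; positivity
  intro j
  induction j with
  | zero =>
    intro i _ hi
    rw [totalTime_zero]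
    -- The fallback `LB = 1` is compared with half the guess after the last round, which is at most
    -- 1; one halving costs a factor of at most 4.
    have hi' : i = I.numRounds + 1 := by omega
    have hgp := A.guess_pos i
    have hg : I.guess i / 2 ≤ 1 := by
      have := A.guess_last_le
      rw [hi']; linarith
    refine (A.finalTime_le hκ hb0 hb hΔ le_rfl (by linarith [A.two_le_n])).trans
      (ENNReal.ofReal_le_ofReal ?_)
    have h1 := scaleCost_anti ha hc (half_pos hgp) hg
    have h2 := scaleCost_half_le ha hc hgp
    have h3 := four_mul_scaleCost_le_remainingCost ha hc hO hgp
    have h4 := remainingCost_nonneg ha hc hO hgp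
    rw [mul_comm 2, mul_assoc]
    refine mul_le_mul_of_nonneg_left ?_ hph
    change scaleCost _ _ 1 ≤ _
    linarith
  | succ j ih =>
    intro i h1 hi
    have hgp := A.guess_pos i
    refine (A.totalTime_succ_le hκ hb0 hb hΔ j h1 (by omega)).trans ?_
    change ENNReal.ofReal (_ * scaleCost (I.evalCoeff Th) (I.oracleCoeff Tc Tprox) _) + _ ≤ _
    have hp : (0 : ℝ) ≤ if I.guess i ≤ I.OPT / 6 then 1 / 8 else 1 := by split_ifs <;> norm_num
    refine (add_le_add_right (mul_le_mul_right (ih (i + 1) (by omega) (by omega)) _) _).trans ?_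
    rw [← ENNReal.ofReal_mul hp, ← ENNReal.ofReal_add
      (mul_nonneg (by positivity) (scaleCost_nonneg ha hc hgp))
      (mul_nonneg hp (mul_nonneg (by positivity)
        (remainingCost_nonneg ha hc hO (A.guess_pos _)))), A.guess_succ]
    refine ENNReal.ofReal_le_ofReal ?_
    have := mul_le_mul_of_nonneg_left (remainingCost_step ha hc hO hgp)
      (by positivity : 0 ≤ 2 * phaseConst κ Δ₀ b)
    exact le_trans (le_of_eq (by ring)) this

/-! ### From the cost at scale `OPT` to the stated bound -/

theorem timeBound_coeff_nonneg :
    0 ≤ I.n ^ 2 * (I.rrMoment 2 * I.βh + I.rrMoment 3 * I.Lh ^ 2) ∧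
    0 ≤ (I.rrMoment 1 * I.n * I.βh + I.rrMoment 2 * I.n * I.Lh ^ 2) / I.ε := by
  have h1 := I.rrMoment_nonneg 1
  have h2 := I.rrMoment_nonneg 2
  have h3 := I.rrMoment_nonneg 3
  have h4 := A.βh_nonneg
  have h5 := A.ε_pos
  have h6 := I.n_pos
  constructor <;> positivity

/-- The first guess is at least `OPT / 2`, so the recursion starts above the threshold `OPT / 6`.
The constant is `2016 = 2 · 7 · 144`, with `144 = 12²` from evaluating the cost at `OPT / 12`. -/
theorem expTime_le {b Δ₀ : ℝ} (hκ : 0 ≤ κ) (hb0 : 0 < b) (hb : b ≤ I.βh + I.Lh ^ 2)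
    (hΔ : I.Δ ≤ Δ₀) : I.proxGradRIS.expTime ≤ ENNReal.ofReal (2016 * phaseConst κ Δ₀ b *
      I.timeBound Th Tc Tprox (I.ε / 3 / (I.L + I.L))) := by
  have ha := A.evalCoeff_nonneg
  have hc := A.oracleCoeff_nonneg
  have hO1 := A.one_le_OPT
  have hO : 0 < I.OPT := by linarith
  have hε := A.ε_pos
  have hph : 0 ≤ phaseConst κ Δ₀ b := by unfold phaseConst; positivity
  rw [expTime_proxGradRIS]
  refine (A.totalTime_le hκ hb0 hb hΔ I.numRounds 1 le_rfl (by omega)).trans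
    (ENNReal.ofReal_le_ofReal ?_)
  have hg : ¬ I.guess 1 ≤ I.OPT / 6 := by
    have := A.OPT_le
    unfold guess
    rw [pow_one]
    intro h
    linarith
  have h1 : remainingCost (I.evalCoeff Th) (I.oracleCoeff Tc Tprox) I.OPT (I.guess 1) ≤
      7 * scaleCost (I.evalCoeff Th) (I.oracleCoeff Tc Tprox) (I.OPT / 12) := by
    rw [remainingCost, if_neg hg]
    linarith [scaleCost_nonneg ha hc (A.guess_pos 1)]
  have h2 : scaleCost (I.evalCoeff Th) (I.oracleCoeff Tc Tprox) (I.OPT / 12) ≤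
      144 * (I.evalCoeff Th / I.OPT + I.oracleCoeff Tc Tprox / I.OPT) := by
    have e : scaleCost (I.evalCoeff Th) (I.oracleCoeff Tc Tprox) (I.OPT / 12) =
        144 * (I.evalCoeff Th / I.OPT ^ 2) + 12 * (I.oracleCoeff Tc Tprox / I.OPT) := by
      unfold scaleCost; field_simp; ring
    -- One power of `OPT ≥ 1` is given away here. In the sampling term, the factor `OPT` contained
    -- in `oracleCoeff` cancels.
    have i1 : I.evalCoeff Th / I.OPT ^ 2 ≤ I.evalCoeff Th / I.OPT := by
      gcongr
      nlinarith
    have i2 : 0 ≤ I.oracleCoeff Tc Tprox / I.OPT := by positivity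
    rw [e]
    linarith
  have h3 : I.evalCoeff Th / I.OPT + I.oracleCoeff Tc Tprox / I.OPT ≤
      I.timeBound Th Tc Tprox (I.ε / 3 / (I.L + I.L)) := by
    set w := (I.rrMoment 1 * I.n * I.βh + I.rrMoment 2 * I.n * I.Lh ^ 2) / I.ε with hw
    have hw0 : 0 ≤ w := A.timeBound_coeff_nonneg.2
    have e1 : I.evalCoeff Th / I.OPT = I.n ^ 2 * (I.rrMoment 2 * I.βh + I.rrMoment 3 * I.Lh ^ 2)
      * I.logCover / (I.ε ^ 3 * I.OPT) * (1 + Th) := by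
      unfold evalCoeff; field_simp
    have e2 : I.oracleCoeff Tc Tprox / I.OPT =
        (I.numEdges + I.n) * I.logCover / I.ε ^ 2 + w * (1 / I.OPT) * (Tc + Tprox) := by
      rw [hw]; unfold oracleCoeff; field_simp
    have i1 : 1 / I.OPT ≤ Real.logb 2 (I.n + I.lam * I.k) :=
      ((div_le_one hO).2 hO1).trans A.one_le_logb
    have i2 : w * (1 / I.OPT) * (Tc + Tprox) ≤
        w * Real.logb 2 (I.n + I.lam * I.k) * (Tc + Tprox) := by gcongr
    rw [e1, e2]
    unfold timeBound
    rw [← hw]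
    change _ ≤ I.n ^ 2 * (I.rrMoment 2 * I.βh + I.rrMoment 3 * I.Lh ^ 2)
      * I.logCover / (I.ε ^ 3 * I.OPT) * (1 + Th) + _ +
        (I.numEdges + I.n) * I.logCover / I.ε ^ 2
    linarith
  calc _ ≤ 2 * phaseConst κ Δ₀ b * (7 * (144 *
        I.timeBound Th Tc Tprox (I.ε / 3 / (I.L + I.L)))) := by
        refine mul_le_mul_of_nonneg_left ?_ (by positivity)
        linarith
    _ = _ := by ring

/-- The covering number enters only through `ln (n ^ ℓ 𝒩)`, which is at least `ln 2`; an additive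
`ln K` is therefore a multiplicative constant. -/
theorem timeBound_le_of_covering_le {K : ℕ} (hK1 : 1 ≤ K) {r r' : ℝ} (hr : 0 < r) (hr' : 0 < r')
    (h : I.covering r ≤ K * I.covering r') : I.timeBound Th Tc Tprox r ≤
      (1 + Real.log K / Real.log 2) * I.timeBound Th Tc Tprox r' := by
  have hO1 := A.one_le_OPT
  have hε := A.ε_pos
  have hn := I.n_pos
  have hK : (1 : ℝ) ≤ K := by exact_mod_cast hK1
  have hlogK : 0 ≤ Real.log K := Real.log_nonneg hK
  have hlog2 : 0 < Real.log 2 := Real.log_pos (by norm_num)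
  have h1 := A.one_le_covering hr
  have h1' := A.one_le_covering hr'
  have h2 := A.two_le_n_rpow
  obtain ⟨c1, c2⟩ := A.timeBound_coeff_nonneg
  have hlogb := A.one_le_logb
  have h4 : Real.log 2 ≤ Real.log (I.n ^ I.ℓ * I.covering r') :=
    Real.log_le_log (by norm_num) (by nlinarith)
  have h3 : Real.log (I.n ^ I.ℓ * I.covering r) ≤
      (1 + Real.log K / Real.log 2) * Real.log (I.n ^ I.ℓ * I.covering r') := by
    have s1 : Real.log (I.n ^ I.ℓ * I.covering r) ≤
        Real.log (K * (I.n ^ I.ℓ * I.covering r')) := by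
      refine Real.log_le_log (by nlinarith) ?_
      have := mul_le_mul_of_nonneg_left h (by linarith : 0 ≤ I.n ^ I.ℓ)
      linarith
    rw [Real.log_mul (x := (K : ℝ)) (by linarith) (by nlinarith)] at s1
    have s2 : Real.log K ≤ Real.log K / Real.log 2 * Real.log (I.n ^ I.ℓ * I.covering r') := by
      rw [div_mul_eq_mul_div, le_div_iff₀ hlog2]
      exact mul_le_mul_of_nonneg_left h4 hlogK
    linarith
  set q := Real.log K / Real.log 2
  have hq : 0 ≤ q := by positivity
  unfold timeBound
  set Λ := Real.log (I.n ^ I.ℓ * I.covering r)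
  set Λ' := Real.log (I.n ^ I.ℓ * I.covering r')
  have t1 : I.n ^ 2 * (I.rrMoment 2 * I.βh + I.rrMoment 3 * I.Lh ^ 2) * Λ / (I.ε ^ 3 * I.OPT) *
      (1 + Th) ≤ (1 + q) * (I.n ^ 2 * (I.rrMoment 2 * I.βh + I.rrMoment 3 * I.Lh ^ 2) * Λ' /
        (I.ε ^ 3 * I.OPT) * (1 + Th)) := by
    calc _ ≤ I.n ^ 2 * (I.rrMoment 2 * I.βh + I.rrMoment 3 * I.Lh ^ 2) * ((1 + q) * Λ') /
        (I.ε ^ 3 * I.OPT) * (1 + Th) := by gcongr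
      _ = _ := by ring
  have t2 : (I.numEdges + I.n) * Λ / I.ε ^ 2 ≤ (1 + q) * ((I.numEdges + I.n) * Λ' / I.ε ^ 2) := by
    calc _ ≤ (I.numEdges + I.n) * ((1 + q) * Λ') / I.ε ^ 2 := by gcongr
      _ = _ := by ring
  have t3 : 0 ≤ (I.rrMoment 1 * I.n * I.βh + I.rrMoment 2 * I.n * I.Lh ^ 2) / I.ε *
      Real.logb 2 (I.n + I.lam * I.k) * (Tc + Tprox) := by positivity
  have t4 := mul_nonneg hq t3
  linarith

end Assumptions

end Problem

end CIMBS

end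

theorem theorem8 (κ Δ₀ b : ℝ) (hκ : 0 ≤ κ) (hΔ₀ : 0 < Δ₀) (hb : 0 < b) :
    (∃ C : ℝ, ∀ (d : ℕ) (V : Type) [Fintype V] [DecidableEq V] [Nonempty V]
      (I : CIMBS.Problem V d) (Th Tc Tprox : ℕ), I.Assumptions κ Th Tc Tprox →
      I.Δ ≤ Δ₀ → b ≤ I.βh + I.Lh ^ 2 →
      I.proxGradRIS.expTime ≤ ENNReal.ofReal (C * I.timeBound Th Tc Tprox
        (I.ε / (3 * (2 * I.n ^ 2 * I.Lh + 2 * I.lam * I.Lc))))) ∧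
    (∀ d : ℕ, ∃ C : ℝ, ∀ (V : Type) [Fintype V] [DecidableEq V] [Nonempty V]
      (I : CIMBS.Problem V d) (Th Tc Tprox : ℕ), I.Assumptions κ Th Tc Tprox →
      I.Δ ≤ Δ₀ → b ≤ I.βh + I.Lh ^ 2 →
      I.proxGradRIS.expTime ≤ ENNReal.ofReal (C * I.timeBound Th Tc Tprox
        (I.ε / (2 * I.n ^ 2 * I.Lh + 2 * I.lam * I.Lc)))) := by
  refine ⟨⟨2016 * CIMBS.Problem.phaseConst κ Δ₀ b, fun d V _ _ _ I Th Tc Tprox A hΔ hβ => ?_⟩,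
    fun d => ?_⟩
  · have e : I.ε / (3 * (2 * I.n ^ 2 * I.Lh + 2 * I.lam * I.Lc)) = I.ε / 3 / (I.L + I.L) := by
      rw [div_div]; unfold CIMBS.Problem.L; ring_nf
    rw [e]
    exact A.expTime_le hκ hb hβ hΔ
  · obtain ⟨K, hK1, hK⟩ := CIMBS.exists_externalCoveringNumber_third_le d
    refine ⟨2016 * CIMBS.Problem.phaseConst κ Δ₀ b * (1 + Real.log K / Real.log 2),
      fun V _ _ _ I Th Tc Tprox A hΔ hβ =>
        (A.expTime_le hκ hb hβ hΔ).trans (ENNReal.ofReal_le_ofReal ?_)⟩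
    have hL := A.L_pos
    have hε := A.ε_pos
    have hr : 0 < I.ε / 3 / (I.L + I.L) := by positivity
    -- The radius in (b) is three times the one in (a), so the refinement of coverings is needed
    -- just once.
    have e : I.ε / (2 * I.n ^ 2 * I.Lh + 2 * I.lam * I.Lc) = 3 * (I.ε / 3 / (I.L + I.L)) := by
      have : 2 * I.n ^ 2 * I.Lh + 2 * I.lam * I.Lc = I.L + I.L := by
        unfold CIMBS.Problem.L; ring
      rw [this]
      ring
    rw [e, mul_assoc (2016 * CIMBS.Problem.phaseConst κ Δ₀ b)]
    refine mul_le_mul_of_nonneg_left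
      (A.timeBound_le_of_covering_le hK1 hr (by positivity) (A.covering_le_mul hK hr)) ?_
    unfold CIMBS.Problem.phaseConst
    positivity
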